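/- **Model.** In the Congested Clique on $n$ nodes, in every synchronous round each node may draw fresh private random numbers and send a message of $O(\log n)$ bits (here $\lfloor\log_2 n\rfloor+1$ bits) to every other node; local computation is free. The input is a digraph or an undirected graph $G$ on the node set, each node knowing initially its out- and in-neighbours. **Parameters.** Let $h$ be a constant, $h\ge 3$ for undirected graphs and $h\ge 2$ for digraphs. An $h$-cycle is a cycle through $h$ distinct vertices. Let $t$ be the number of (copies of) $h$-cycles of $G$ and $x$ the number of vertices that lie on an $h$-cycle. If $t\ge 1$, define $\delta$ by $x^{h-\delta}=2ht$ if $G$ is undirected and by $x^{h-\delta}=ht$ if $G$ is directed. **Matrix multiplication.** Let $\mathbb F=\mathbb F_n$ be finite fields whose elements have $O(\log n)$ bits, and let $\rho=1-2/\sigma$, where $\sigma\ge 2$ is such that $d\times d$ matrices over these fields can be multiplied by bilinear algorithms with $O(d^{\sigma})$ scalar multiplications, uniformly in $n$ and $d$. For $s\le n$ let $\mathrm{MM}(k,k,k;s)$ be the (deterministic, worst-case) number of rounds that $n$ nodes need to compute $P_i=S_iT_i$ for $s$ pairs of $k\times k$ matrices over $\mathbb F_n$, where the nodes are labelled $(i,u,w)$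 with $i\in[s]$, $u,w\in[\lfloor\sqrt{\lfloor n/s\rfloor}\rfloor]$ (nodes left without a label hold nothing), row and column indices are split into $\lfloor\sqrt{\lfloor n/s\rfloor}\rfloor$ classes of equal size (up to rounding), and node $(i,u,w)$ initially holds the entries of $S_i$ and $T_i$ with row in class $u$ and column in class $w$ and must learn the same entries of $P_i$. Non-integral arguments of $\mathrm{MM}$ are rounded up. **Theorem.** For every constant $\gamma\in\mathbb N$ there is a randomized Congested Clique algorithm (one protocol for each $n$, the same for digraphs and undirected graphs, not depending on $x$, $t$, $\delta$) that detects $h$-cycles with one-sided error: 1. Every execution ends, after at most $\tilde O(n^{\rho})$ rounds, with a common answer "true" or "false" of all nodes; if $G$ has no $h$-cycle, no node ever answers "true". 2. If $G$ has an $h$-cycle, $\delta\le 2$ and $x^{\delta}\le n$ (the range in which the multiple product below is considered), then with probability at least $1-n^{-\gamma}$ all nodes have answered "true" after $$\tilde O\bigl(\mathrm{MM}(n/x,n/x,n/x;x^{\delta})+1\bigr)$$ rounds. 3. If $G$ has an $h$-cycle, then, for every value of $\delta$, with probability at least $1-n^{-\gamma}$ all nodes have answered "true" after $$\tilde O\bigl(\max\{1,\;n^{\rho}\,x^{-(2+\delta(\rho-1))}\}\bigr)$$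 rounds. Moreover, $\mathrm{MM}(n/x,n/x,n/x;x^{\delta})=O\bigl(\max\{1,\;n^{\rho}x^{-(2+\delta(\rho-1))}\}\bigr)$ for all integers $1\le x\le n$ and all real $\delta\in[0,2]$ with $x^{\delta}\le n$. Here $\tilde O$ hides a factor $C(\lfloor\log_2 n\rfloor+1)^{C}$, and $C$ and the constant in $O$ depend only on $h$, $\gamma$, $\sigma$ and the family of fields. -/

import Mathlib

namespace CongestedClique

/-! ### The Congested Clique model -/

/-- Messages on `n` nodes consist of `⌊log₂ n⌋ + 1` bits. -/
abbrev Msg (n : ℕ) : Type := Fin (Nat.log 2 n + 1) → Bool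

/-- A randomized protocol on `n` nodes, with local inputs in `I` and local outputs in `O`.
In each round every node draws a fresh private random number, uniform in `Fin (coins + 1)`, sends a
message to each node, and updates its state from the messages received. Local computation is
unbounded, as usual in the model. An output, once given, is final. -/
structure Protocol (n : ℕ) (I O : Type) where
  State : Type
  coins : ℕ
  init : Fin n → I → State
  /-- `send v st c w` is the message that `v` sends to `w`. -/
  send : Fin n → State → Fin (coins + 1) → Fin n → Msg n
  /-- `step v st c m` is the new state of `v` after it received `m u` from each node `u`. -/
  step : Fin n → State → Fin (coins + 1) → (Fin n → Msg n) → State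
  output : Fin n → State → Option O
  output_final : ∀ v st c m o, output v st = some o → output v (step v st c m) = some o

namespace Protocol

variable {n : ℕ} {I O : Type}

/-- The random numbers used in the first `R` rounds. -/
abbrev Coins (P : Protocol n I O) (R : ℕ) : Type := Fin R → Fin n → Fin (P.coins + 1)

/-- The states of all nodes after `R` rounds. -/
def run (P : Protocol n I O) (inp : Fin n → I) : (R : ℕ) → P.Coins R → Fin n → P.State
  | 0, _ => fun v => P.init v (inp v)
  | R + 1, c => fun v =>
      let st := P.run inp R (fun r => c r.castSucc)
      P.step v (st v) (c (Fin.last R) v) (fun u => P.send u (st u) (c (Fin.last R) u) v)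

/-- The output of node `v` after `R` rounds (`none` if it has not answered yet). -/
def result (P : Protocol n I O) (inp : Fin n → I) (R : ℕ) (c : P.Coins R) (v : Fin n) : Option O :=
  P.output v (P.run inp R c v)

/-- The probability of an event that depends on the random numbers of the first `R` rounds. -/
noncomputable def prob (P : Protocol n I O) (R : ℕ) (E : P.Coins R → Prop) : ℝ :=
  (Nat.card {c : P.Coins R // E c} : ℝ) / (Nat.card (P.Coins R) : ℝ)

end Protocol

/-! ### Multiplying many pairs of square matrices -/

/-- Ownership of the entry `(a, b)` of the `i`-th matrices in the problem of multiplying `s` pairs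
of `k × k` matrices on `n` nodes. With `q = ⌊√(n / s)⌋`, node `v` has the label `(i, x, y)`, where
`v = i q² + x q + y` and `x, y < q`, and it owns the submatrix `[*x*, *y*]`, where the row (column)
indices are divided into `q` classes of equal size (up to rounding), here by their residue
modulo `q`. Nodes `v ≥ s q²` own nothing. -/
def Owns (n k s : ℕ) (v : Fin n) (i : Fin s) (a b : Fin k) : Prop :=
  let q := Nat.sqrt (n / s)
  v.val / (q * q) = i.val ∧ (v.val / q) % q = a.val % q ∧ v.val % q = b.val % q

open Classical in
/-- The local input of `v`: the entries of the `S i` and `T i` that it owns, all others masked. -/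
noncomputable def productInput {K : Type} [Field K] {n k s : ℕ}
    (S T : Fin s → Matrix (Fin k) (Fin k) K) (v : Fin n) : Fin s → Fin k → Fin k → K × K :=
  fun i a b => if Owns n k s v i a b then (S i a b, T i a b) else 0

/-- `s` pairs of `k × k` matrices over `K` can be multiplied on `n` nodes in `r` rounds, always:
after `r` rounds each node has output the entries of the products at the places it owns. -/
def ProductSolvable (K : Type) [Field K] (n k s r : ℕ) : Prop :=
  ∃ P : Protocol n (Fin s → Fin k → Fin k → K × K) (Fin s → Fin k → Fin k → K),
    ∀ (S T : Fin s → Matrix (Fin k) (Fin k) K) (c : P.Coins r) (v : Fin n),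
      ∃ o, P.result (productInput S T) r c v = some o ∧
        ∀ i a b, Owns n k s v i a b → o i a b = (S i * T i) a b

/-- `MM(k, k, k; s)` on `n` nodes: the round complexity of multiplying `s` pairs of `k × k`
matrices over `K`. -/
noncomputable def MM (K : Type) [Field K] (n k s : ℕ) : ℕ∞ :=
  ⨅ (r : ℕ) (_ : ProductSolvable K n k s r), (r : ℕ∞)

/-- There is a bilinear algorithm for `d × d` matrices over `K` with `m` scalar multiplications. -/
def HasBilinearAlgorithm (K : Type) [Field K] (d m : ℕ) : Prop :=
  ∃ α β γ : Fin m → Fin d → Fin d → K, ∀ (S T : Matrix (Fin d) (Fin d) K) (i j : Fin d),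
    (S * T) i j =
      ∑ w, γ w i j * ((∑ a, ∑ b, α w a b * S a b) * (∑ a, ∑ b, β w a b * T a b))

/-- Over the fields `K n`, uniformly in `n`, matrices of size `d × d` can be multiplied by bilinear
algorithms with `O(d ^ σ)` scalar multiplications. -/
def IsMatMulExponent (K : ℕ → Type) [∀ n, Field (K n)] (σ : ℝ) : Prop :=
  ∃ c : ℝ, ∀ n d : ℕ, ∃ m : ℕ, (m : ℝ) ≤ c * (d : ℝ) ^ σ ∧ HasBilinearAlgorithm (K n) d m

/-! ### Cycles -/

/-- `(v 0, …, v (h - 1), v 0)` is an `h`-cycle: the vertices are distinct and consecutive ones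
(cyclically) are joined by an edge. -/
def IsCycleTuple {V : Type} (adj : V → V → Prop) (h : ℕ) (v : Fin h → V) : Prop :=
  Function.Injective v ∧ ∀ i, adj (v i) (v (finRotate h i))

/-- The set of vertices that participate in an `h`-cycle. -/
def cycleVertices {V : Type} (adj : V → V → Prop) (h : ℕ) : Set V :=
  {u | ∃ v : Fin h → V, IsCycleTuple adj h v ∧ u ∈ Set.range v}

/-- The copies of directed `h`-cycles in a digraph, each given by its set of arcs. -/
def directedCycles {V : Type} (D : Digraph V) (h : ℕ) : Set (Set (V × V)) :=
  {E | ∃ v : Fin h → V, IsCycleTuple D.Adj h v ∧ E = Set.range fun i => (v i, v (finRotate h i))}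

/-- The copies of `h`-cycles in an undirected graph, each given by its set of edges. -/
def undirectedCycles {V : Type} (G : SimpleGraph V) (h : ℕ) : Set (Set (Sym2 V)) :=
  {E | ∃ v : Fin h → V, IsCycleTuple G.Adj h v ∧ E = Set.range fun i => s(v i, v (finRotate h i))}

/-! ### Detection of `h`-cycles -/

/-- A protocol whose input at each node is the sets of its out-neighbours and of its in-neighbours,
and whose output is a truth value. -/
abbrev DetectionProtocol (n : ℕ) : Type 1 := Protocol n (Set (Fin n) × Set (Fin n)) Bool

/-- The local input of `v` for the (di)graph with adjacency relation `adj`. -/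
def localView {n : ℕ} (adj : Fin n → Fin n → Prop) (v : Fin n) : Set (Fin n) × Set (Fin n) :=
  ({w | adj v w}, {w | adj w v})

/-- All nodes have given the answer `b` after `R` rounds. -/
def AllAnswer {n : ℕ} (P : DetectionProtocol n) (adj : Fin n → Fin n → Prop) (R : ℕ)
    (c : P.Coins R) (b : Bool) : Prop :=
  ∀ v, P.result (localView adj) R c v = some b

/-- With probability at least `1 - n ^ (-γ)` all nodes have answered "true" after `R` rounds. -/
def DetectsWhp {n : ℕ} (P : DetectionProtocol n) (adj : Fin n → Fin n → Prop) (γ R : ℕ) : Prop :=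
  1 - 1 / (n : ℝ) ^ γ ≤ P.prob R (fun c => AllAnswer P adj R c true)

/-- The factor `C · (⌊log₂ n⌋ + 1) ^ C` that is hidden in the notation `Õ`. -/
def polylog (C n : ℕ) : ℕ := C * (Nat.log 2 n + 1) ^ C

/-- The bound `n ^ ρ · x ^ (-(2 + δ (ρ - 1)))`, but at least `1`. -/
noncomputable def explicitBound (n x : ℕ) (ρ δ : ℝ) : ℝ :=
  max 1 ((n : ℝ) ^ ρ * (x : ℝ) ^ (-(2 + δ * (ρ - 1))))

/-- What the protocol `P` guarantees on one (di)graph with adjacency relation `adj`. Here `m` stands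
for `h · t` (directed) or `2h · t` (undirected), where `t` is the number of `h`-cycles. With `x` the
number of vertices that participate in an `h`-cycle, `δ` is given by `x ^ (h - δ) = m`. -/
structure Guarantee (K : Type) [Field K] (ρ : ℝ) (h γ C : ℕ) {n : ℕ} (P : DetectionProtocol n)
    (adj : Fin n → Fin n → Prop) (m : ℕ) : Prop where
  /-- Every execution ends with a common answer, after at most `Õ(n ^ ρ)` rounds. -/
  halts : ∀ R : ℕ, (polylog C n : ℝ) * (n : ℝ) ^ ρ ≤ R → ∀ c, ∃ b, AllAnswer P adj R c b
  /-- One-sided error: without an `h`-cycle, no node ever answers "true". -/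
  one_sided : m = 0 → ∀ (R : ℕ) (c : P.Coins R) (v : Fin n),
    P.result (localView adj) R c v ≠ some true
  /-- Detection w.h.p. within `Õ(MM(n/x, n/x, n/x; x ^ δ))` rounds, in the range `δ ≤ 2`,
  `x ^ δ ≤ n` in which this multiple product is considered. -/
  detects_MM : m ≠ 0 → ∀ (x : ℕ) (δ : ℝ), x = (cycleVertices adj h).ncard →
    (x : ℝ) ^ ((h : ℝ) - δ) = m → δ ≤ 2 → (x : ℝ) ^ δ ≤ n →
    ∀ R : ℕ, (polylog C n : ℕ∞) * (MM K n ⌈(n : ℝ) / x⌉₊ ⌈(x : ℝ) ^ δ⌉₊ + 1) ≤ R →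
      DetectsWhp P adj γ R
  /-- Detection w.h.p. within `Õ(n ^ ρ · x ^ (-(2 + δ (ρ - 1))))` rounds, for all values of `δ`. -/
  detects : m ≠ 0 → ∀ (x : ℕ) (δ : ℝ), x = (cycleVertices adj h).ncard →
    (x : ℝ) ^ ((h : ℝ) - δ) = m →
    ∀ R : ℕ, (polylog C n : ℝ) * explicitBound n x ρ δ ≤ R → DetectsWhp P adj γ R

end CongestedClique

/-! Everything rests on two randomized searches whose only expensive operation is a constant number
of calls to the multiple matrix product. Both colour the nodes at random and multiply adjacency
matrices between consecutive colours. A nonzero diagonal entry of such a product yields a closed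
walk along the colours, hence `h` distinct vertices, that is, a cycle. This is true over every
field, so the error is one-sided; what needs an argument is that cycles do not cancel.

The search in tuples (`pr_tuple_ge`, `exists_tuplePhase`) distributes the nodes randomly over about
`x` classes of about `n / x` nodes and examines `s`, about `x ^ δ`, random `h`-tuples of classes,
one instance of the product per tuple. There are about `x ^ (h - δ)` cycles and about `x ^ h`
tuples, so a tuple belonging to a cycle is drawn with constant probability. With constant
probability the classes of the vertices of that cycle contain no further vertex of any cycle; then
the closed walk is unique and the diagonal entry equals one (`chain_tupleMatrix_eq_one`).

The search through start nodes (`pr_color_ge`, `exists_throughPhase`) draws about `n / X` random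
nodes, which hit a vertex of a cycle if `X ≤ x`, and computes the rows of the product at these nodes
by `X * X` block products. Many cycles may pass through a hit node. Cancellation is overcome by an
additional colour that is used in no matrix: if the total vanishes, discarding one vertex removes a
nonzero part of it (`exists_coloring_chain_ne_zero`). This search covers `δ > 2` and `x ^ δ > n`,
and with `X = 1` it is the fallback that bounds the worst case.

Since `x` and `δ` are unknown, there is one phase for every pair of dyadic scales of `x` and `s` and
for every dyadic `X`; each is repeated `O(log n)` times, in the order of increasing duration
(`exists_schedule`). The suited phase thus ends after polylogarithmically many times its own
duration.

The explicit bound comes from a bilinear algorithm on `d × d` blocks, each instance having `n / s`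
nodes of its own (`reach_product`), with `d` about `(n / s) ^ (1 / σ)`.

Protocols are not programmed. `Reach` records which situations the nodes can distinguish, and
`realize` converts this into a protocol, which is legitimate because local computation is free. -/

namespace CongestedClique

/-! ### Knowledge of the nodes -/

/-- `E v ω ω'`: node `v` cannot distinguish the situations `ω` and `ω'`. -/
abbrev Knowledge (n : ℕ) (Ω : Type) : Type := Fin n → Ω → Ω → Prop

/-- The value of `f` is determined by a knowledge relation. -/
def Knows {Ω : Type} {α : Sort*} (E : Ω → Ω → Prop) (f : Ω → α) : Prop :=
  ∀ ω ω', E ω ω' → f ω = f ω'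

/-- `Reach r E E'`: within `r` rounds the nodes can pass from the knowledge `E` to `E'`. -/
inductive Reach {n : ℕ} {Ω : Type} : ℕ → Knowledge n Ω → Knowledge n Ω → Prop
  | done {E E' : Knowledge n Ω} (h : ∀ v ω ω', E v ω ω' → E' v ω ω') : Reach 0 E E'
  | step {r : ℕ} {E E' : Knowledge n Ω} (g : Fin n → Fin n → Ω → Msg n)
      (hg : ∀ u w, Knows (E u) (g u w))
      (h : Reach r (fun v ω ω' => E v ω ω' ∧ ∀ u, g u v ω = g u v ω') E') : Reach (r + 1) E E'

namespace Reach

variable {n : ℕ} {Ω : Type}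

/-- Messages only refine knowledge, so the relation `F` of the beginning is still available when the
final relation is deduced. -/
theorem mono {r : ℕ} {E E' : Knowledge n Ω} (H : Reach r E E') :
    ∀ {F F' : Knowledge n Ω}, (∀ v ω ω', F v ω ω' → E v ω ω') →
      (∀ v ω ω', F v ω ω' → E' v ω ω' → F' v ω ω') → Reach r F F' := by
  induction H with
  | done h => exact fun h1 h2 => .done fun v ω ω' hF => h2 v ω ω' hF (h v ω ω' (h1 v ω ω' hF))
  | step g hg _ ih =>
    intro F F' h1 h2
    refine .step g (fun u w ω ω' hF => hg u w ω ω' (h1 _ _ _ hF)) (ih ?_ ?_)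
    · exact fun v ω ω' hF => ⟨h1 _ _ _ hF.1, hF.2⟩
    · exact fun v ω ω' hF hE => h2 _ _ _ hF.1 hE

theorem trans {r s : ℕ} {E E' E'' : Knowledge n Ω} (H : Reach r E E') (H' : Reach s E' E'') :
    Reach (r + s) E E'' := by
  induction H with
  | done h => rw [Nat.zero_add]; exact H'.mono h (fun _ _ _ _ h => h)
  | @step r E E' g hg _ ih => rw [Nat.add_right_comm]; exact .step g hg (ih H')

/-- Knowledge is retained. -/
theorem keep {r : ℕ} {E E' : Knowledge n Ω} (H : Reach r E E') :
    Reach r E (fun v ω ω' => E v ω ω' ∧ E' v ω ω') :=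
  H.mono (fun _ _ _ h => h) (fun _ _ _ h h' => ⟨h, h'⟩)

theorem refl (E : Knowledge n Ω) : Reach 0 E E := .done fun _ _ _ h => h

theorem wait (r : ℕ) (E : Knowledge n Ω) : Reach r E E := by
  induction r with
  | zero => exact refl E
  | succ r ih =>
    exact .step (fun _ _ _ _ => false) (fun _ _ _ _ _ => rfl)
      (ih.mono (fun _ _ _ h => h.1) (fun _ _ _ _ h => h))

theorem le {r s : ℕ} {E E' : Knowledge n Ω} (H : Reach r E E') (h : r ≤ s) : Reach s E E' := by
  obtain ⟨t, rfl⟩ := Nat.exists_eq_add_of_le h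
  exact H.trans (wait t E')

theorem then_keep {r s : ℕ} {E E' E'' : Knowledge n Ω} (H : Reach r E E')
    (H' : Reach s (fun v ω ω' => E v ω ω' ∧ E' v ω ω') E'') : Reach (r + s) E E'' :=
  H.keep.trans H'

theorem comap {Ω' : Type} (f : Ω' → Ω) {r : ℕ} {E E' : Knowledge n Ω} (H : Reach r E E') :
    Reach r (fun v ω ω' => E v (f ω) (f ω')) (fun v ω ω' => E' v (f ω) (f ω')) := by
  induction H with
  | done h => exact .done fun v ω ω' hE => h v _ _ hE
  | step g hg _ ih => exact .step (fun u w ω => g u w (f ω)) (fun u w ω ω' h => hg u w _ _ h) ih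

/-- An algorithm may depend on a value that all nodes know. -/
theorem of_public {Z : Type*} (pub : Ω → Z) {r : ℕ} {E' : Knowledge n Ω} :
    ∀ {E : Knowledge n Ω}, (∀ v, Knows (E v) pub) →
      (∀ z, Reach r (fun v ω ω' => E v ω ω' ∧ pub ω = z ∧ pub ω' = z) E') → Reach r E E' := by
  induction r with
  | zero =>
    intro E hp H
    refine .done fun v ω ω' hE => ?_
    have := H (pub ω)
    cases this with
    | done h => exact h v ω ω' ⟨hE, rfl, (hp v _ _ hE).symm⟩
  | succ r ih =>
    intro E hp H
    have H' : ∀ z, ∃ g : Fin n → Fin n → Ω → Msg n,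
        (∀ u w, Knows (fun ω ω' => E u ω ω' ∧ pub ω = z ∧ pub ω' = z) (g u w)) ∧
        Reach r (fun v ω ω' => (E v ω ω' ∧ pub ω = z ∧ pub ω' = z) ∧
          ∀ u, g u v ω = g u v ω') E' := by
      intro z
      cases H z with
      | step g hg h => exact ⟨g, hg, h⟩
    choose g hg h using H'
    -- Every sender knows `pub ω` and can therefore follow the branch that belongs to this value.
    refine .step (fun u w ω => g (pub ω) u w ω) ?_ (ih ?_ ?_)
    · intro u w ω ω' hE
      have := hp _ _ _ hE
      simp only [← this]
      exact hg _ _ _ _ _ ⟨hE, rfl, this.symm⟩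
    · exact fun v ω ω' hE => hp v _ _ hE.1
    · intro z
      refine (h z).mono ?_ (fun _ _ _ _ h => h)
      rintro v ω ω' ⟨⟨h1, h2⟩, h3, h4⟩
      exact ⟨⟨h1, h3, h4⟩, fun u => by simpa [h3, h4] using h2 u⟩

/-- Several rounds of messages that are known from the start. -/
theorem of_messages {r : ℕ} :
    ∀ {E : Knowledge n Ω} (G : Fin r → Fin n → Fin n → Ω → Msg n), (∀ i u w, Knows (E u) (G i u w)) →
      Reach r E (fun v ω ω' => ∀ i u, G i u v ω = G i u v ω') := by
  induction r with
  | zero => exact fun {E} G _ => .done fun v ω ω' _ i => i.elim0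
  | succ r ih =>
    intro E G hG
    refine .step (G 0) (hG 0) ((ih (fun i => G i.succ) ?_).mono (fun _ _ _ h => h) ?_)
    · exact fun i u w ω ω' h => hG _ _ _ _ _ h.1
    · intro v ω ω' h1 h2 i u
      induction i using Fin.cases with
      | zero => exact h1.2 u
      | succ i => exact h2 i u

/-- Each node sends to each node a value from a set with an encoding by `κ` messages. -/
theorem of_values {α : Type} (κ : ℕ) (enc : α → Fin κ → Msg n) (henc : Function.Injective enc)
    {E : Knowledge n Ω} (val : Fin n → Fin n → Ω → α) (hval : ∀ u w, Knows (E u) (val u w)) :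
    Reach κ E (fun v ω ω' => ∀ u, val u v ω = val u v ω') := by
  refine (of_messages (fun i u w ω => enc (val u w ω) i) ?_).mono (fun _ _ _ h => h) ?_
  · intro i u w ω ω' h
    simp only [hval u w ω ω' h]
  · intro v ω ω' _ h u
    exact henc (funext fun i => h i u)

end Reach

theorem exists_encoding {n : ℕ} {α : Type} [Finite α] {κ : ℕ}
    (h : Nat.card α ≤ 2 ^ (κ * (Nat.log 2 n + 1))) :
    ∃ enc : α → Fin κ → Msg n, Function.Injective enc := by
  have := Fintype.ofFinite α
  have hc : Fintype.card α ≤ Fintype.card (Fin κ → Msg n) := by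
    rw [Nat.card_eq_fintype_card] at h
    simpa [← pow_mul, mul_comm] using h
  obtain ⟨f⟩ := Function.Embedding.nonempty_of_card_le hc
  exact ⟨f, f.injective⟩

/-! ### From knowledge to protocols -/

/-- What `v` cannot distinguish after `r` rounds in which the messages `G` are sent. -/
def ViewEq {n : ℕ} {Ω : Type} (E : Knowledge n Ω) (G : ℕ → Fin n → Fin n → Ω → Msg n) (r : ℕ) :
    Knowledge n Ω :=
  fun v ω ω' => E v ω ω' ∧ ∀ i < r, ∀ u, G i u v ω = G i u v ω'

/-- The messages `G` can be computed from what the senders have learned before. -/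
def Feasible {n : ℕ} {Ω : Type} (E : Knowledge n Ω) (G : ℕ → Fin n → Fin n → Ω → Msg n) : Prop :=
  ∀ i u w, Knows (ViewEq E G i u) (G i u w)

theorem ViewEq.anti {n : ℕ} {Ω : Type} {E : Knowledge n Ω} {G : ℕ → Fin n → Fin n → Ω → Msg n}
    {r s : ℕ} (h : r ≤ s) {v : Fin n} {ω ω' : Ω} (H : ViewEq E G s v ω ω') :
    ViewEq E G r v ω ω' :=
  ⟨H.1, fun i hi => H.2 i (hi.trans_le h)⟩

/-- Puts the messages witnessing `Reach` in front of a sequence `G'` that is feasible afterwards.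
The result is again one infinite message sequence, the form in which procedures are concatenated and
turned into protocols. -/
theorem Reach.exists_feasible {n : ℕ} {Ω : Type} {r : ℕ} {E E' : Knowledge n Ω}
    (H : Reach r E E') : ∀ {G' : ℕ → Fin n → Fin n → Ω → Msg n}, Feasible E' G' →
      ∃ G, Feasible E G ∧ ∀ i v ω ω', ViewEq E G (r + i) v ω ω' → ViewEq E' G' i v ω ω' := by
  induction H with
  | @done E E' h =>
    intro G' hG'
    refine ⟨G', fun i u w ω ω' hv => hG' i u w ω ω' ⟨h _ _ _ hv.1, hv.2⟩, ?_⟩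
    intro i v ω ω' hv
    rw [Nat.zero_add] at hv
    exact ⟨h _ _ _ hv.1, hv.2⟩
  | @step r E E' g hg _ ih =>
    intro G' hG'
    obtain ⟨G, hG, hGG⟩ := ih hG'
    have key : ∀ i v ω ω', ViewEq E (fun i => Nat.casesOn i g G) (i + 1) v ω ω' →
        ViewEq (fun v ω ω' => E v ω ω' ∧ ∀ u, g u v ω = g u v ω') G i v ω ω' := fun i v ω ω' hv =>
      ⟨⟨hv.1, hv.2 0 (Nat.succ_pos i)⟩, fun j hj => hv.2 (j + 1) (Nat.succ_lt_succ hj)⟩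
    refine ⟨fun i => Nat.casesOn i g G, ?_, ?_⟩
    · intro i u w ω ω' hv
      cases i with
      | zero => exact hg u w ω ω' hv.1
      | succ i => exact hG i u w ω ω' (key i u ω ω' hv)
    · intro i v ω ω' hv
      rw [Nat.add_right_comm] at hv
      exact hGG i v ω ω' (key _ v ω ω' hv)

theorem feasible_const {n : ℕ} {Ω : Type} (E : Knowledge n Ω) :
    Feasible E (fun _ _ _ _ _ => false) := fun _ _ _ _ _ _ => rfl

section Realize

variable {n : ℕ} {Ω I O : Type} (N : ℕ) (inp : Fin n → Ω → I) (seed : Fin n → Ω → Fin (N + 1))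
  (G : ℕ → Fin n → Fin n → Ω → Msg n) (ans : ℕ → Ω → Fin n → Option O)

/-- The knowledge of a node that knows its input and its random number. -/
def initialKnowledge : Knowledge n Ω :=
  fun v ω ω' => inp v ω = inp v ω' ∧ seed v ω = seed v ω'

open Classical in
/-- The protocol that sends the messages `G` and answers `ans`. A state consists of the time, the
set of the situations that are possible from the point of view of the node, and the answer. -/
noncomputable def realize : Protocol n I O where
  State := ℕ × Set Ω × Option O
  coins := N
  init v x := (0, {ω | inp v ω = x}, none)
  -- A node remembers the set of situations compatible with all it has seen and computes its message
  -- from an arbitrary member; feasibility makes the choice irrelevant. The random number is read in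
  -- the first round only, whence the test `st.1 = 0`.
  send v st c w :=
    if h : ∃ ω ∈ st.2.1, (st.1 = 0 → seed v ω = c) then G st.1 v w h.choose else fun _ => false
  step v st c m :=
    let A : Set Ω := {ω | ω ∈ st.2.1 ∧ (st.1 = 0 → seed v ω = c) ∧ ∀ u, G st.1 u v ω = m u}
    (st.1 + 1, A, st.2.2 <|> (if h : ∃ ω, ω ∈ A then ans (st.1 + 1) h.choose v else none))
  output _ st := st.2.2
  output_final v st c m o h := by simp [h]

variable {N inp seed G ans}

/-- The statement begins with time `R + 1` because the seed is not part of the initial state: it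
enters with the first round. -/
theorem realize_run (hG : Feasible (initialKnowledge N inp seed) G)
    (hans : ∀ r v, Knows (ViewEq (initialKnowledge N inp seed) G r v) (fun ω => ans r ω v))
    (hmono : ∀ r ω v o, ans r ω v = some o → ans (r + 1) ω v = some o)
    (ω : Ω) (R : ℕ) (c : (realize N inp seed G ans).Coins (R + 1)) (hc : ∀ v, c 0 v = seed v ω)
    (v : Fin n) :
    (realize N inp seed G ans).run (fun v => inp v ω) (R + 1) c v =
      (R + 1, {ω' | ViewEq (initialKnowledge N inp seed) G (R + 1) v ω ω'}, ans (R + 1) ω v) := by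
  classical
  -- One round, starting from a set `A v` that describes the view of `v` once the seed is taken into
  -- account. This form covers both the first round, where `A v` reflects only the input, and the
  -- later ones.
  have main : ∀ (r : ℕ) (o : Fin n → Option O) (A : Fin n → Set Ω) (cc : Fin n → Fin (N + 1)),
      (∀ v, {ω' | ω' ∈ A v ∧ (r = 0 → seed v ω' = cc v)} =
        {ω' | ViewEq (initialKnowledge N inp seed) G r v ω ω'}) →
      (∀ v, (o v <|> ans (r + 1) ω v) = ans (r + 1) ω v) → ∀ v,
      (realize N inp seed G ans).step v (r, A v, o v) (cc v) (fun u =>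
        (realize N inp seed G ans).send u (r, A u, o u) (cc u) v) =
      (r + 1, {ω' | ViewEq (initialKnowledge N inp seed) G (r + 1) v ω ω'}, ans (r + 1) ω v) := by
    intro r o A cc hA ho v
    have hself : ∀ r v, ViewEq (initialKnowledge N inp seed) G r v ω ω :=
      fun r v => ⟨⟨rfl, rfl⟩, fun _ _ _ => rfl⟩
    have hsend : ∀ u, (realize N inp seed G ans).send u (r, A u, o u) (cc u) v = G r u v ω := by
      intro u
      have hmem : ∀ ω', (ω' ∈ A u ∧ (r = 0 → seed u ω' = cc u)) ↔
          ViewEq (initialKnowledge N inp seed) G r u ω ω' := fun ω' => Set.ext_iff.1 (hA u) ω'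
      have hex : ∃ ω' ∈ A u, (r = 0 → seed u ω' = cc u) := ⟨ω, (hmem ω).2 (hself r u)⟩
      simp only [realize]
      rw [dif_pos hex]
      exact (hG r u v ω _ ((hmem _).1 hex.choose_spec)).symm
    simp only [hsend]
    have hset : {ω' | ω' ∈ A v ∧ (r = 0 → seed v ω' = cc v) ∧ ∀ u, G r u v ω' = G r u v ω} =
        {ω' | ViewEq (initialKnowledge N inp seed) G (r + 1) v ω ω'} := by
      ext ω'
      have hmem := Set.ext_iff.1 (hA v) ω'
      simp only [Set.mem_ofPred_eq] at hmem ⊢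
      rw [← and_assoc, hmem]
      constructor
      · rintro ⟨h1, h2⟩
        refine ⟨h1.1, fun i hi u => ?_⟩
        rcases Nat.lt_succ_iff_lt_or_eq.1 hi with h | rfl
        · exact h1.2 i h u
        · exact (h2 u).symm
      · intro h
        exact ⟨h.anti (Nat.le_succ r), fun u => (h.2 r (Nat.lt_succ_self r) u).symm⟩
    have hex : ∃ ω', ω' ∈ {ω' | ViewEq (initialKnowledge N inp seed) G (r + 1) v ω ω'} :=
      ⟨ω, hself _ _⟩
    simp only [realize, hset]
    have e : ans (r + 1) hex.choose v = ans (r + 1) ω v :=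
      (hans (r + 1) v ω _ hex.choose_spec).symm
    rw [dif_pos hex, e, ho v]
  induction R generalizing v with
  | zero =>
    refine main 0 (fun _ => none) (fun v => {ω' | inp v ω' = inp v ω}) (c 0) ?_ ?_ v
    · intro v
      ext ω'
      simp only [Set.mem_ofPred_eq, ViewEq, initialKnowledge, hc]
      constructor
      · rintro ⟨h1, h2⟩
        exact ⟨⟨h1.symm, (h2 trivial).symm⟩, fun i hi => absurd hi (Nat.not_lt_zero i)⟩
      · rintro ⟨h1, -⟩
        exact ⟨h1.1.symm, fun _ => h1.2.symm⟩
    · intro v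
      cases ans (0 + 1) ω v <;> rfl
  | succ R ih =>
    have ih' := ih (fun r => c r.castSucc) hc
    have := main (R + 1) (fun v => ans (R + 1) ω v)
      (fun v => {ω' | ViewEq (initialKnowledge N inp seed) G (R + 1) v ω ω'}) (c (Fin.last (R + 1)))
      ?_ ?_ v
    · rw [← this]
      conv_lhs => rw [Protocol.run]
      simp only [ih']
    · intro v
      ext ω'
      simp
    · intro v
      cases h : ans (R + 1) ω v with
      | none => cases ans (R + 1 + 1) ω v <;> rfl
      | some o => rw [hmono _ _ _ _ h]; rfl

theorem realize_result (hG : Feasible (initialKnowledge N inp seed) G)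
    (hans : ∀ r v, Knows (ViewEq (initialKnowledge N inp seed) G r v) (fun ω => ans r ω v))
    (hmono : ∀ r ω v o, ans r ω v = some o → ans (r + 1) ω v = some o)
    (ω : Ω) (R : ℕ) (c : (realize N inp seed G ans).Coins (R + 1)) (hc : ∀ v, c 0 v = seed v ω)
    (v : Fin n) :
    (realize N inp seed G ans).result (fun v => inp v ω) (R + 1) c v = ans (R + 1) ω v := by
  rw [Protocol.result, realize_run hG hans hmono ω R c hc v]
  rfl

theorem realize_result_zero (x : Fin n → I) (c : (realize N inp seed G ans).Coins 0) (v : Fin n) :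
    (realize N inp seed G ans).result x 0 c v = none := rfl

end Realize

/-! ### Multiplication of matrices as a subroutine -/

/-- A product protocol is correct for all random numbers, so it can be simulated with every random
number equal to zero, deterministically. -/
theorem ProductSolvable.reach {K : Type} [Field K] {n k s r : ℕ} (H : ProductSolvable K n k s r)
    {Ω : Type} {E : Knowledge n Ω} (S T : Ω → Fin s → Matrix (Fin k) (Fin k) K)
    (hE : ∀ v i a b, Owns n k s v i a b → Knows (E v) (fun ω => (S ω i a b, T ω i a b))) :
    Reach r E (fun v ω ω' => ∀ i a b, Owns n k s v i a b →
      (S ω i * T ω i) a b = (S ω' i * T ω' i) a b) := by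
  classical
  obtain ⟨P, hP⟩ := H
  set st : ℕ → Ω → Fin n → P.State := fun R ω =>
    P.run (productInput (S ω) (T ω)) R (fun _ _ => 0) with hst
  have key : ∀ R, Reach R E (fun v ω ω' => st R ω v = st R ω' v) := by
    intro R
    induction R with
    | zero =>
      refine .done fun v ω ω' h => ?_
      have : productInput (S ω) (T ω) v = productInput (S ω') (T ω') v := by
        funext i a b
        simp only [productInput]
        split_ifs with ho
        · exact hE v i a b ho ω ω' h
        · rfl
      simp [hst, Protocol.run, this]
    | succ R ih =>
      refine ih.trans (.step (fun u w ω => P.send u (st R ω u) 0 w) ?_ (.done ?_))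
      · intro u w ω ω' h
        simp only [h]
      · rintro v ω ω' ⟨h1, h2⟩
        change P.step v (st R ω v) 0 (fun u => P.send u (st R ω u) 0 v) =
          P.step v (st R ω' v) 0 (fun u => P.send u (st R ω' u) 0 v)
        rw [h1]
        congr 1
        exact funext h2
  refine (key r).mono (fun _ _ _ h => h) ?_
  intro v ω ω' _ h i a b ho
  obtain ⟨o, h1, h2⟩ := hP (S ω) (T ω) (fun _ _ => 0) v
  obtain ⟨o', h1', h2'⟩ := hP (S ω') (T ω') (fun _ _ => 0) v
  have : some o = some o' := by
    rw [← h1, ← h1']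
    exact congrArg (P.output v) h
  rw [← h2 i a b ho, ← h2' i a b ho, Option.some.inj this]

/-- Positivity of `r` is needed because a protocol made by `realize` has no answer at time zero. -/
theorem ProductSolvable.of_reach {K : Type} [Field K] {n k s r : ℕ} (hr : 0 < r)
    (H : Reach (n := n) (Ω := (Fin s → Matrix (Fin k) (Fin k) K) × (Fin s → Matrix (Fin k) (Fin k) K)) r
      (fun v ω ω' => ∀ i a b, Owns n k s v i a b → ω.1 i a b = ω'.1 i a b ∧ ω.2 i a b = ω'.2 i a b)
      (fun v ω ω' => ∀ i a b, Owns n k s v i a b →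
        (ω.1 i * ω.2 i) a b = (ω'.1 i * ω'.2 i) a b)) :
    ProductSolvable K n k s r := by
  classical
  obtain ⟨R, rfl⟩ := Nat.exists_eq_succ_of_ne_zero hr.ne'
  let Ω := (Fin s → Matrix (Fin k) (Fin k) K) × (Fin s → Matrix (Fin k) (Fin k) K)
  let inp : Fin n → Ω → Fin s → Fin k → Fin k → K × K := fun v ω => productInput ω.1 ω.2 v
  let seed : Fin n → Ω → Fin (0 + 1) := fun _ _ => 0
  have H' : Reach (R + 1) (initialKnowledge 0 inp seed) (fun v ω ω' => ∀ i a b, Owns n k s v i a b →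
        (ω.1 i * ω.2 i) a b = (ω'.1 i * ω'.2 i) a b) := by
    refine H.mono ?_ (fun _ _ _ _ h => h)
    intro v ω ω' h i a b ho
    have := congrFun (congrFun (congrFun h.1 i) a) b
    simpa [inp, productInput, ho] using this
  obtain ⟨G, hG, hGG⟩ := H'.exists_feasible (feasible_const _)
  let ans : ℕ → Ω → Fin n → Option (Fin s → Fin k → Fin k → K) := fun t ω v =>
    if R + 1 ≤ t then some (fun i a b => if Owns n k s v i a b then (ω.1 i * ω.2 i) a b else 0)
    else none
  refine ⟨realize 0 inp seed G ans, fun S T c v => ?_⟩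
  refine ⟨fun i a b => if Owns n k s v i a b then (S i * T i) a b else 0, ?_, ?_⟩
  · refine (realize_result (inp := inp) (seed := seed) hG ?_ ?_ (S, T) R c
      (fun _ => Subsingleton.elim (α := Fin 1) _ _) v).trans ?_
    · intro t v ω ω' h
      simp only [ans]
      split_ifs with ht
      · congr 1
        funext i a b
        split_ifs with ho
        · exact (hGG 0 v ω ω' (h.anti ht)).1 i a b ho
        · rfl
      · rfl
    · intro t ω v o h
      simp only [ans] at h ⊢
      split_ifs at h with ht
      rw [if_pos (ht.trans (Nat.le_succ t)), h]
    · simp [ans]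
  · intro i a b ho
    simp [ho]

/-! ### Routing -/

-- Greedy colouring: a vertex with fewer than `c` conflicts always finds a free colour.
open Classical in
theorem exists_proper_coloring {M : Type} [Finite M] {c : ℕ} (conf : M → M → Prop)
    (hsymm : ∀ m m', conf m m' → conf m' m)
    (hc : ∀ m, Nat.card {m' // m' ≠ m ∧ conf m m'} < c) :
    ∃ col : M → Fin c, ∀ m m', m ≠ m' → conf m m' → col m ≠ col m' := by
  have := Fintype.ofFinite M
  rcases isEmpty_or_nonempty M with hM | ⟨⟨m₀⟩⟩
  · exact ⟨fun m => (hM.false m).elim, fun m => (hM.false m).elim⟩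
  have key : ∀ s : Finset M, ∃ col : M → Fin c, ∀ m ∈ s, ∀ m' ∈ s, m ≠ m' → conf m m' →
      col m ≠ col m' := by
    intro s
    induction s using Finset.induction_on with
    | empty => exact ⟨fun _ => ⟨0, (Nat.zero_le _).trans_lt (hc m₀)⟩, by simp⟩
    | insert a s ha ih =>
      obtain ⟨col, hcol⟩ := ih
      have hcard : ((Finset.univ.filter fun m' => m' ≠ a ∧ conf a m').image col).card <
          (Finset.univ : Finset (Fin c)).card := by
        refine Finset.card_image_le.trans_lt ?_
        have := hc a
        rw [Nat.card_eq_fintype_card, Fintype.card_subtype] at this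
        simpa using this
      obtain ⟨x, -, hx⟩ := Finset.exists_mem_notMem_of_card_lt_card hcard
      have hx' : ∀ m, m ≠ a → conf a m → col m ≠ x := by
        intro m hm hm' h
        exact hx (Finset.mem_image.2 ⟨m, by simp [hm, hm'], h⟩)
      refine ⟨Function.update col a x, ?_⟩
      intro m hm m' hm' hne hconf
      rcases Finset.mem_insert.1 hm with rfl | hm <;> rcases Finset.mem_insert.1 hm' with rfl | hm'
      · exact absurd rfl hne
      · rw [Function.update_self, Function.update_of_ne hne.symm]
        exact (hx' m' hne.symm hconf).symm
      · rw [Function.update_self, Function.update_of_ne hne]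
        exact hx' m hne (hsymm _ _ hconf)
      · have h1 : m ≠ a := fun h => ha (h ▸ hm)
        have h2 : m' ≠ a := fun h => ha (h ▸ hm')
        rw [Function.update_of_ne h1, Function.update_of_ne h2]
        exact hcol m hm m' hm' hne hconf
  obtain ⟨col, h⟩ := key Finset.univ
  exact ⟨col, fun m m' => h m (Finset.mem_univ _) m' (Finset.mem_univ _)⟩

/-- A message shares its source or its target with at most `2 * (D - 1)` others. The greedy bound is
about twice the optimal number of colours, which costs only a constant factor. -/
theorem exists_bipartite_coloring {M A B : Type} [Finite M] {D : ℕ} (src : M → A) (dst : M → B)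
    (hsrc : ∀ v, Nat.card {m // src m = v} ≤ D) (hdst : ∀ v, Nat.card {m // dst m = v} ≤ D) :
    ∃ col : M → Fin (2 * D), ∀ m m', col m = col m' → src m = src m' ∨ dst m = dst m' → m = m' := by
  classical
  have := Fintype.ofFinite M
  obtain ⟨col, h⟩ := exists_proper_coloring (c := 2 * D)
    (fun m m' => src m = src m' ∨ dst m = dst m')
    (fun m m' h => h.imp Eq.symm Eq.symm) (by
      intro m
      have h1 := hsrc (src m)
      have h2 := hdst (dst m)
      rw [Nat.card_eq_fintype_card, Fintype.card_subtype] at h1 h2 ⊢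
      have h3 : (Finset.univ.filter fun m' => m' ≠ m ∧ (src m = src m' ∨ dst m = dst m')) ⊆
          (Finset.univ.filter fun m' => src m' = src m).erase m ∪
          (Finset.univ.filter fun m' => dst m' = dst m).erase m := by
        intro m'
        simp only [Finset.mem_filter, Finset.mem_union, Finset.mem_erase, Finset.mem_univ, true_and]
        rintro ⟨h, h' | h'⟩
        · exact .inl ⟨h, h'.symm⟩
        · exact .inr ⟨h, h'.symm⟩
      have h4 := (Finset.card_le_card h3).trans (Finset.card_union_le _ _)
      rw [Finset.card_erase_of_mem (by simp), Finset.card_erase_of_mem (by simp)] at h4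
      have h5 : 0 < (Finset.univ.filter fun m' => src m' = src m).card :=
        Finset.card_pos.2 ⟨m, by simp⟩
      omega)
  exact ⟨col, fun m m' hc hs => by_contra fun hne => h m m' hne hs hc⟩

/-- Routing of messages that follow a fixed pattern. -/
theorem Reach.route_msg {n : ℕ} {Ω M : Type} [Finite M] (L : ℕ) {E : Knowledge n Ω}
    (src dst : M → Fin n) (val : M → Ω → Msg n) (hval : ∀ m, Knows (E (src m)) (val m))
    (hsrc : ∀ v, Nat.card {m // src m = v} ≤ L * n) (hdst : ∀ v, Nat.card {m // dst m = v} ≤ L * n) :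
    Reach (4 * L) E (fun v ω ω' => ∀ m, dst m = v → val m ω = val m ω') := by
  classical
  obtain ⟨col', hcol'⟩ := exists_bipartite_coloring src dst hsrc hdst
  -- A colour is read as a time slot and a relay node. Messages with the same source, or with the
  -- same target, differ in slot or relay, so each link carries at most one message per slot on both
  -- legs of the way.
  obtain ⟨col, hcol⟩ : ∃ col : M → Fin (2 * L) × Fin n, ∀ m m', col m = col m' →
      src m = src m' ∨ dst m = dst m' → m = m' := by
    refine ⟨fun m => finProdFinEquiv.symm (Fin.cast (by ring) (col' m)), fun m m' h => hcol' m m' ?_⟩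
    exact Fin.cast_injective _ (finProdFinEquiv.symm.injective h)
  have stage1 : Reach (2 * L) E (fun v ω ω' => ∀ m, (col m).2 = v → val m ω = val m ω') := by
    refine (Reach.of_messages (E := E) (r := 2 * L) (fun a u w ω =>
      if h : ∃ m, src m = u ∧ col m = (a, w) then val h.choose ω else fun _ => false) ?_).mono
        (fun _ _ _ h => h) ?_
    · intro a u w ω ω' h
      dsimp only
      split_ifs with hex
      · refine hval _ _ _ ?_
        rw [hex.choose_spec.1]
        exact h
      · rfl
    · intro v ω ω' _ h m hm
      have hex : ∃ m', src m' = src m ∧ col m' = ((col m).1, v) := ⟨m, rfl, Prod.ext rfl hm⟩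
      have hch : hex.choose = m := by
        refine hcol _ _ ?_ (.inl hex.choose_spec.1)
        rw [hex.choose_spec.2, ← hm]
      have := h (col m).1 (src m)
      rwa [dif_pos hex, dif_pos hex, hch] at this
  have stage2 : Reach (2 * L) (fun v ω ω' => ∀ m, (col m).2 = v → val m ω = val m ω')
      (fun v ω ω' => ∀ m, dst m = v → val m ω = val m ω') := by
    refine (Reach.of_messages (r := 2 * L) (fun a u w ω =>
      if h : ∃ m, dst m = w ∧ col m = (a, u) then val h.choose ω else fun _ => false) ?_).mono
        (fun _ _ _ h => h) ?_
    · intro a u w ω ω' h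
      dsimp only
      split_ifs with hex
      · exact h _ (by rw [hex.choose_spec.2])
      · rfl
    · intro v ω ω' _ h m hm
      have hex : ∃ m', dst m' = v ∧ col m' = ((col m).1, (col m).2) := ⟨m, hm, rfl⟩
      have hch : hex.choose = m := by
        refine hcol _ _ ?_ (.inr (hex.choose_spec.1.trans hm.symm))
        rw [hex.choose_spec.2]
      have := h (col m).1 (col m).2
      rwa [dif_pos hex, dif_pos hex, hch] at this
  have := stage1.trans stage2
  rwa [← two_mul, ← mul_assoc] at this

/-- Routing of values that are encoded by `κ` messages each. -/
theorem Reach.route {n : ℕ} {Ω M α : Type} [Finite M] {κ : ℕ} (enc : α → Fin κ → Msg n)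
    (henc : Function.Injective enc) (L : ℕ) {E : Knowledge n Ω}
    (src dst : M → Fin n) (val : M → Ω → α) (hval : ∀ m, Knows (E (src m)) (val m))
    (hsrc : ∀ v, Nat.card {m // src m = v} ≤ L * n) (hdst : ∀ v, Nat.card {m // dst m = v} ≤ L * n) :
    Reach (4 * (κ * L)) E (fun v ω ω' => ∀ m, dst m = v → val m ω = val m ω') := by
  have hcard : ∀ (f : M → Fin n), (∀ v, Nat.card {m // f m = v} ≤ L * n) → ∀ v,
      Nat.card {p : M × Fin κ // f p.1 = v} ≤ κ * L * n := by
    intro f hf v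
    have hi : Function.Injective (fun p : {p : M × Fin κ // f p.1 = v} =>
        ((⟨p.1.1, p.2⟩ : {m // f m = v}), p.1.2)) := by
      rintro ⟨⟨m, i⟩, h⟩ ⟨⟨m', i'⟩, h'⟩ h1
      simp only [Prod.mk.injEq, Subtype.mk.injEq] at h1
      simp [h1]
    refine (Nat.card_le_card_of_injective _ hi).trans ?_
    rw [Nat.card_prod, Nat.card_fin]
    calc _ ≤ L * n * κ := Nat.mul_le_mul_right _ (hf v)
      _ = _ := by ring
  refine (Reach.route_msg (M := M × Fin κ) (κ * L) (fun p => src p.1) (fun p => dst p.1)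
    (fun p ω => enc (val p.1 ω) p.2) ?_ (hcard src hsrc) (hcard dst hdst)).mono
      (fun _ _ _ h => h) ?_
  · intro p ω ω' h
    simp only [hval p.1 ω ω' h]
  · intro v ω ω' _ h m hm
    exact henc (funext fun i => h (m, i) hm)

/-! ### The owners of the entries -/

theorem exists_owner {n k s : ℕ} (hs : 0 < s) (hsn : s ≤ n) (i : Fin s) (a b : Fin k) :
    ∃ v, Owns n k s v i a b := by
  have hN : 0 < n / s := Nat.div_pos hsn hs
  set q := Nat.sqrt (n / s) with hq
  have hq0 : 0 < q := Nat.sqrt_pos.2 hN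
  have hqq : s * (q * q) ≤ n :=
    (Nat.mul_le_mul_left s (Nat.sqrt_le (n / s))).trans (Nat.mul_div_le n s)
  have ha := Nat.mod_lt a.val hq0
  have hb := Nat.mod_lt b.val hq0
  have h1 : a.val % q * q + b.val % q < q * q := by nlinarith
  have hlt : i.val * (q * q) + (a.val % q * q + b.val % q) < n := by
    have := i.isLt
    nlinarith
  refine ⟨⟨_, hlt⟩, ?_, ?_, ?_⟩
  · change (i.val * (q * q) + (a.val % q * q + b.val % q)) / (q * q) = i.val
    rw [mul_comm i.val, Nat.mul_add_div (Nat.mul_pos hq0 hq0), Nat.div_eq_of_lt h1, add_zero]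
  · change (i.val * (q * q) + (a.val % q * q + b.val % q)) / q % q = a.val % q
    have : i.val * (q * q) + (a.val % q * q + b.val % q) =
        q * (i.val * q + a.val % q) + b.val % q := by ring
    rw [this, Nat.mul_add_div hq0, Nat.div_eq_of_lt hb, add_zero, Nat.add_mod, Nat.mul_mod_left,
      zero_add, Nat.mod_mod, Nat.mod_mod]
  · change (i.val * (q * q) + (a.val % q * q + b.val % q)) % q = b.val % q
    have : i.val * (q * q) + (a.val % q * q + b.val % q) =
        q * (i.val * q + a.val % q) + b.val % q := by ring
    rw [this, Nat.mul_add_mod, Nat.mod_mod]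

/-- The label fixes the instance and both residues modulo `q`, so an owned entry is determined by
the quotients of its indices. -/
theorem card_owned_le {n k s : ℕ} (v : Fin n) :
    Nat.card {x : Fin s × Fin k × Fin k // Owns n k s v x.1 x.2.1 x.2.2} ≤
      (k / Nat.sqrt (n / s) + 1) ^ 2 := by
  set q := Nat.sqrt (n / s) with hq
  have hlt : ∀ a : Fin k, a.val / q < k / q + 1 := fun a =>
    Nat.lt_succ_of_le (Nat.div_le_div_right a.isLt.le)
  have hi : Function.Injective (fun x : {x : Fin s × Fin k × Fin k // Owns n k s v x.1 x.2.1 x.2.2} =>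
      ((⟨x.1.2.1.val / q, hlt _⟩, ⟨x.1.2.2.val / q, hlt _⟩) : Fin (k / q + 1) × Fin (k / q + 1))) := by
    rintro ⟨⟨i, a, b⟩, h1, h2, h3⟩ ⟨⟨i', a', b'⟩, h1', h2', h3'⟩ h
    simp only [Prod.mk.injEq, Fin.mk.injEq] at h
    have e1 : i = i' := Fin.ext (h1.symm.trans h1')
    have e2 : a = a' := by
      have : a.val % q = a'.val % q := h2.symm.trans h2'
      refine Fin.ext ?_
      rw [← Nat.div_add_mod a.val q, ← Nat.div_add_mod a'.val q, h.1, this]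
    have e3 : b = b' := by
      have : b.val % q = b'.val % q := h3.symm.trans h3'
      refine Fin.ext ?_
      rw [← Nat.div_add_mod b.val q, ← Nat.div_add_mod b'.val q, h.2, this]
    subst e1 e2 e3
    rfl
  refine (Nat.card_le_card_of_injective _ hi).trans ?_
  rw [Nat.card_prod, Nat.card_fin, sq]

/-- A node that owns the entry `(a, b)` of the `i`-th matrices. -/
noncomputable def owner {n k s : ℕ} (hs : 0 < s) (hsn : s ≤ n) (x : Fin s × Fin k × Fin k) : Fin n :=
  (exists_owner hs hsn x.1 x.2.1 x.2.2).choose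

theorem owns_owner {n k s : ℕ} (hs : 0 < s) (hsn : s ≤ n) (x : Fin s × Fin k × Fin k) :
    Owns n k s (owner hs hsn x) x.1 x.2.1 x.2.2 :=
  (exists_owner hs hsn x.1 x.2.1 x.2.2).choose_spec

theorem eq_owner {n k s : ℕ} (hs : 0 < s) (hsn : s ≤ n) {v : Fin n} {x : Fin s × Fin k × Fin k}
    (h : Owns n k s v x.1 x.2.1 x.2.2) : owner hs hsn x = v := by
  obtain ⟨h1, h2, h3⟩ := owns_owner hs hsn x
  obtain ⟨h1', h2', h3'⟩ := h
  set q := Nat.sqrt (n / s) with hq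
  refine Fin.ext ?_
  rw [← Nat.div_add_mod (owner hs hsn x).val q, ← Nat.div_add_mod v.val q,
    ← Nat.div_add_mod ((owner hs hsn x).val / q) q, ← Nat.div_add_mod (v.val / q) q, h2, h2', h3,
    h3', Nat.div_div_eq_div_mul, Nat.div_div_eq_div_mul, h1, h1']

theorem card_owner_eq_le {n k s : ℕ} (hs : 0 < s) (hsn : s ≤ n) (v : Fin n) :
    Nat.card {x : Fin s × Fin k × Fin k // owner hs hsn x = v} ≤
      (k / Nat.sqrt (n / s) + 1) ^ 2 := by
  have h : ∀ x : {x : Fin s × Fin k × Fin k // owner hs hsn x = v},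
      Owns n k s v x.1.1 x.1.2.1 x.1.2.2 := fun x => by
    have := owns_owner hs hsn x.1
    rwa [x.2] at this
  refine (Nat.card_le_card_of_injective (fun x => ⟨x.1, h x⟩) ?_).trans
    (card_owned_le (k := k) (s := s) v)
  intro x y h
  simpa [Subtype.ext_iff] using h

/-! ### Fast matrix multiplication -/

theorem exists_balanced (A : Type) [Finite A] {N : ℕ} (hN : 0 < N) :
    ∃ f : A → Fin N, ∀ j, Nat.card {a // f a = j} ≤ Nat.card A / N + 1 := by
  let e : A ≃ Fin (Nat.card A) := Finite.equivFinOfCardEq rfl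
  refine ⟨fun a => ⟨(e a).val % N, Nat.mod_lt _ hN⟩, fun j => ?_⟩
  have hlt : ∀ a, (e a).val / N < Nat.card A / N + 1 := fun a =>
    Nat.lt_succ_of_le (Nat.div_le_div_right (e a).isLt.le)
  have hi : Function.Injective (fun x : {a // (⟨(e a).val % N, Nat.mod_lt _ hN⟩ : Fin N) = j} =>
      (⟨(e x.1).val / N, hlt _⟩ : Fin (Nat.card A / N + 1))) := by
    rintro ⟨a, ha⟩ ⟨a', ha'⟩ h
    simp only [Fin.mk.injEq] at h
    have h2 : (e a).val % N = (e a').val % N := congrArg Fin.val (ha.trans ha'.symm)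
    refine Subtype.ext (e.injective (Fin.ext ?_))
    rw [← Nat.div_add_mod (e a).val N, ← Nat.div_add_mod (e a').val N, h, h2]
  simpa using Nat.card_le_card_of_injective _ hi

/-- As `node` is injective, a node serves a single instance, and its load is the load within this
instance. -/
theorem card_fiber_node_le {n s N D : ℕ} {A : Type} [Finite A] (node : Fin s × Fin N ↪ Fin n)
    (f : A → Fin N) (hf : ∀ j, Nat.card {a // f a = j} ≤ D) (v : Fin n) :
    Nat.card {x : Fin s × A // node (x.1, f x.2) = v} ≤ D := by
  by_cases hv : ∃ y, node y = v
  · obtain ⟨y, rfl⟩ := hv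
    have h : ∀ x : {x : Fin s × A // node (x.1, f x.2) = node y}, x.1.1 = y.1 ∧ f x.1.2 = y.2 :=
      fun x => Prod.ext_iff.1 (node.injective x.2)
    refine (Nat.card_le_card_of_injective (fun x => (⟨x.1.2, (h x).2⟩ : {a // f a = y.2})) ?_).trans
      (hf y.2)
    intro x x' hx
    exact Subtype.ext (Prod.ext ((h x).1.trans (h x').1.symm) (congrArg Subtype.val hx))
  · have : IsEmpty {x : Fin s × A // node (x.1, f x.2) = v} := ⟨fun x => hv ⟨_, x.2⟩⟩
    simp

/-- The entries of a matrix, continued by zero. -/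
def extendZero {K : Type} [Zero K] {k : ℕ} (S : Matrix (Fin k) (Fin k) K) (a b : ℕ) : K :=
  if h : a < k ∧ b < k then S ⟨a, h.1⟩ ⟨b, h.2⟩ else 0

theorem mul_apply_eq_sum_blocks {K : Type} [Field K] {k d b : ℕ} (hk : k ≤ d * b)
    (S T : Matrix (Fin k) (Fin k) K) (i j : Fin k) :
    (S * T) i j = ∑ r : Fin b, ∑ z : Fin d,
      extendZero S i (z + d * r) * extendZero T (z + d * r) j := by
  rw [← Fintype.sum_prod_type' (f := fun (r : Fin b) (z : Fin d) =>
    extendZero S i (z + d * r) * extendZero T (z + d * r) j)]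
  have h1 := Equiv.sum_comp finProdFinEquiv (fun c : Fin (b * d) =>
    extendZero S i c * extendZero T c j)
  simp only [finProdFinEquiv_apply_val] at h1
  rw [h1, Fin.sum_univ_eq_sum_range (fun c => extendZero S i c * extendZero T c j),
    ← Finset.sum_subset (Finset.range_subset_range.2 (hk.trans_eq (mul_comm d b))),
    ← Fin.sum_univ_eq_sum_range (fun c => extendZero S i c * extendZero T c j), Matrix.mul_apply]
  · refine Finset.sum_congr rfl fun c _ => ?_
    simp [extendZero]
  · intro c _ hc
    have : ¬ c < k := by simpa using hc
    simp [extendZero, this]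

/-- The `d × d` combination of the blocks of a matrix with coefficients `α`. -/
def blockCombination {K : Type} [Field K] {k d : ℕ} (α : Fin d → Fin d → K)
    (S : Matrix (Fin k) (Fin k) K) (p r : ℕ) : K :=
  ∑ x : Fin d, ∑ y : Fin d, α x y * extendZero S (x + d * p) (y + d * r)

theorem mul_apply_eq_sum_bilinear {K : Type} [Field K] {k d b m : ℕ} (hk : k ≤ d * b)
    (α β γ : Fin m → Fin d → Fin d → K)
    (h : ∀ (S T : Matrix (Fin d) (Fin d) K) (i j : Fin d), (S * T) i j =
      ∑ w, γ w i j * ((∑ a, ∑ b, α w a b * S a b) * (∑ a, ∑ b, β w a b * T a b)))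
    (S T : Matrix (Fin k) (Fin k) K) (i j : Fin k) (x y : Fin d) (p q : ℕ)
    (hi : i.val = x + d * p) (hj : j.val = y + d * q) :
    (S * T) i j = ∑ w, γ w x y *
      ∑ r : Fin b, blockCombination (α w) S p r * blockCombination (β w) T r q := by
  rw [mul_apply_eq_sum_blocks hk, hi, hj]
  simp only [Finset.mul_sum]
  refine Eq.trans (Finset.sum_congr rfl fun r _ => ?_) Finset.sum_comm
  have := h (Matrix.of fun a b => extendZero S (a + d * p) (b + d * r))
    (Matrix.of fun a b => extendZero T (a + d * r) (b + d * q)) x y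
  simpa [Matrix.mul_apply, blockCombination] using this

/-- The knowledge of the owners of the factors in a multiple matrix product. -/
abbrev factorKnowledge (K : Type) (n k s : ℕ) :
    Knowledge n ((Fin s → Matrix (Fin k) (Fin k) K) × (Fin s → Matrix (Fin k) (Fin k) K)) :=
  fun v ω ω' => ∀ i a b, Owns n k s v i a b → ω.1 i a b = ω'.1 i a b ∧ ω.2 i a b = ω'.2 i a b

/-- The knowledge of the owners of the results of a multiple matrix product. -/
abbrev productKnowledge (K : Type) [Field K] (n k s : ℕ) :
    Knowledge n ((Fin s → Matrix (Fin k) (Fin k) K) × (Fin s → Matrix (Fin k) (Fin k) K)) :=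
  fun v ω ω' => ∀ i a b, Owns n k s v i a b → (ω.1 i * ω.2 i) a b = (ω'.1 i * ω'.2 i) a b

theorem exists_pair_encoding {n κ : ℕ} {α : Type} {enc : α → Fin κ → Msg n}
    (henc : Function.Injective enc) :
    ∃ enc' : α × α → Fin (κ + κ) → Msg n, Function.Injective enc' := by
  refine ⟨fun p => Fin.append (enc p.1) (enc p.2), fun p p' h => Prod.ext (henc ?_) (henc ?_)⟩
  · funext i
    simpa using congrFun h (Fin.castAdd κ i)
  · funext i
    simpa only [Fin.append_right] using congrFun h (Fin.natAdd κ i)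

/-- Matrix products by a bilinear algorithm: the linear combinations of the blocks are formed
position by position, and the products of the combinations elsewhere. -/
theorem reach_product_of_owners {K : Type} [Field K] {n k s d b m κ L : ℕ} (hs : 0 < s)
    (hsn : s ≤ n) (enc : K → Fin κ → Msg n) (henc : Function.Injective enc)
    (pos : Fin k → Fin b) (blk : Fin k → Fin d) (hpb : ∀ a : Fin k, a.val = blk a + d * pos a)
    (hpos : ∀ (x : Fin d) (p : Fin b) (h : x + d * p < k), pos ⟨x + d * p, h⟩ = p)
    (hk : k ≤ d * b) (H : HasBilinearAlgorithm K d m)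
    (posOwner : Fin s → Fin b × Fin b → Fin n) (prodOwner : Fin s → Fin m → Fin n)
    (hL1 : (k / Nat.sqrt (n / s) + 1) ^ 2 ≤ L * n)
    (hL2 : ∀ v, Nat.card {x : Fin s × Fin k × Fin k // posOwner x.1 (pos x.2.1, pos x.2.2) = v} ≤
      L * n)
    (hL3 : ∀ v, Nat.card {x : Fin s × Fin m × Fin b × Fin b // posOwner x.1 x.2.2 = v} ≤ L * n)
    (hL4 : ∀ v, Nat.card {x : Fin s × Fin m × Fin b × Fin b // prodOwner x.1 x.2.1 = v} ≤ L * n) :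
    Reach (24 * (κ * L)) (factorKnowledge K n k s) (productKnowledge K n k s) := by
  obtain ⟨α, β, γ, hT⟩ := H
  obtain ⟨enc', henc'⟩ := exists_pair_encoding henc
  have hL1' : ∀ v, Nat.card {x : Fin s × Fin k × Fin k // owner hs hsn x = v} ≤ L * n :=
    fun v => (card_owner_eq_le hs hsn v).trans hL1
  have step1 := Reach.route enc' henc' L (E := factorKnowledge K n k s)
    (fun x : Fin s × Fin k × Fin k => owner hs hsn x)
    (fun x => posOwner x.1 (pos x.2.1, pos x.2.2))
    (fun x ω => (ω.1 x.1 x.2.1 x.2.2, ω.2 x.1 x.2.1 x.2.2))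
    (fun x ω ω' h => Prod.ext_iff.2 (h _ _ _ (owns_owner hs hsn x))) hL1' hL2
  have step2 := Reach.route enc' henc' L
    (E := fun v (ω ω' : (Fin s → Matrix (Fin k) (Fin k) K) × (Fin s → Matrix (Fin k) (Fin k) K)) =>
      ∀ x : Fin s × Fin k × Fin k, posOwner x.1 (pos x.2.1, pos x.2.2) = v →
        (ω.1 x.1 x.2.1 x.2.2, ω.2 x.1 x.2.1 x.2.2) = (ω'.1 x.1 x.2.1 x.2.2, ω'.2 x.1 x.2.1 x.2.2))
    (fun x : Fin s × Fin m × Fin b × Fin b => posOwner x.1 x.2.2)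
    (fun x => prodOwner x.1 x.2.1)
    (fun x ω => (blockCombination (α x.2.1) (ω.1 x.1) x.2.2.1 x.2.2.2,
      blockCombination (β x.2.1) (ω.2 x.1) x.2.2.1 x.2.2.2)) (by
        rintro ⟨i, w, p, r⟩ ω ω' h
        -- The owner of the position `(p, r)` holds the corresponding entry of all `d * d` blocks;
        -- entries beyond the size `k` are zero and need not be sent.
        have key : ∀ x y : Fin d,
            extendZero (ω.1 i) (x + d * p) (y + d * r) = extendZero (ω'.1 i) (x + d * p) (y + d * r) ∧
            extendZero (ω.2 i) (x + d * p) (y + d * r) = extendZero (ω'.2 i) (x + d * p) (y + d * r) := by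
          intro x y
          simp only [extendZero]
          by_cases hxy : x + d * p < k ∧ y + d * r < k
          · have := h (i, ⟨_, hxy.1⟩, ⟨_, hxy.2⟩) (by simp only [hpos])
            simpa only [dif_pos hxy, Prod.mk.injEq] using this
          · simp [hxy]
        simp only [blockCombination, key]) hL3 hL4
  have step3 := Reach.route enc henc L
    (E := fun v (ω ω' : (Fin s → Matrix (Fin k) (Fin k) K) × (Fin s → Matrix (Fin k) (Fin k) K)) =>
      ∀ x : Fin s × Fin m × Fin b × Fin b, prodOwner x.1 x.2.1 = v →
        (blockCombination (α x.2.1) (ω.1 x.1) x.2.2.1 x.2.2.2,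
          blockCombination (β x.2.1) (ω.2 x.1) x.2.2.1 x.2.2.2) =
        (blockCombination (α x.2.1) (ω'.1 x.1) x.2.2.1 x.2.2.2,
          blockCombination (β x.2.1) (ω'.2 x.1) x.2.2.1 x.2.2.2))
    (fun x : Fin s × Fin m × Fin b × Fin b => prodOwner x.1 x.2.1)
    (fun x => posOwner x.1 x.2.2)
    (fun x ω => ∑ r : Fin b, blockCombination (α x.2.1) (ω.1 x.1) x.2.2.1 r *
      blockCombination (β x.2.1) (ω.2 x.1) r x.2.2.2) (by
        rintro ⟨i, w, p, q⟩ ω ω' h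
        refine Finset.sum_congr rfl fun r _ => ?_
        have h1 := (Prod.ext_iff.1 (h (i, w, p, r) rfl)).1
        have h2 := (Prod.ext_iff.1 (h (i, w, r, q) rfl)).2
        exact congrArg₂ (· * ·) h1 h2) hL4 hL3
  have step4 := Reach.route enc henc L
    (E := fun v (ω ω' : (Fin s → Matrix (Fin k) (Fin k) K) × (Fin s → Matrix (Fin k) (Fin k) K)) =>
      ∀ x : Fin s × Fin m × Fin b × Fin b, posOwner x.1 x.2.2 = v →
        ∑ r : Fin b, blockCombination (α x.2.1) (ω.1 x.1) x.2.2.1 r *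
          blockCombination (β x.2.1) (ω.2 x.1) r x.2.2.2 =
        ∑ r : Fin b, blockCombination (α x.2.1) (ω'.1 x.1) x.2.2.1 r *
          blockCombination (β x.2.1) (ω'.2 x.1) r x.2.2.2)
    (fun x : Fin s × Fin k × Fin k => posOwner x.1 (pos x.2.1, pos x.2.2))
    (fun x => owner hs hsn x)
    (fun x ω => (ω.1 x.1 * ω.2 x.1) x.2.1 x.2.2) (by
        rintro ⟨i, a, c⟩ ω ω' h
        simp only
        rw [mul_apply_eq_sum_bilinear hk α β γ hT (ω.1 i) (ω.2 i) a c _ _ _ _ (hpb a) (hpb c),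
          mul_apply_eq_sum_bilinear hk α β γ hT (ω'.1 i) (ω'.2 i) a c _ _ _ _ (hpb a) (hpb c)]
        exact Finset.sum_congr rfl fun w _ => congrArg _ (h (i, w, pos a, pos c) rfl)) hL2 hL1'
  -- Two routings of pairs and two of single field elements: `8 + 8 + 4 + 4 = 24`.
  refine ((((step1.trans step2).trans step3).trans step4).mono (fun _ _ _ h => h) ?_).le
    (le_of_eq (by ring))
  intro v ω ω' _ h i a c ho
  exact h (i, a, c) (eq_owner hs hsn ho)

/-- Each instance receives `n / s` nodes of its own, among which its `b * b` positions and its `m`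
products are divided evenly. The four bounds concern the loads of the owners, of the positions
(entries and combinations), and of the products. -/
theorem reach_product {K : Type} [Field K] {n k s d b m κ L : ℕ} (hs : 0 < s) (hsn : s ≤ n)
    (enc : K → Fin κ → Msg n) (henc : Function.Injective enc)
    (hd : 0 < d) (hk : k ≤ d * b) (H : HasBilinearAlgorithm K d m)
    (hL1 : (k / Nat.sqrt (n / s) + 1) ^ 2 ≤ L * n) (hL2 : (b * b / (n / s) + 1) * (d * d) ≤ L * n)
    (hL3 : (b * b / (n / s) + 1) * m ≤ L * n) (hL4 : (m / (n / s) + 1) * (b * b) ≤ L * n) :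
    Reach (24 * (κ * L)) (factorKnowledge K n k s) (productKnowledge K n k s) := by
  have hN : 0 < n / s := Nat.div_pos hsn hs
  have hsN : s * (n / s) ≤ n := Nat.mul_div_le n s
  obtain ⟨N, hNdef⟩ : ∃ N, N = n / s := ⟨_, rfl⟩
  rw [← hNdef] at hN hsN hL2 hL3 hL4
  obtain ⟨node⟩ : Nonempty (Fin s × Fin N ↪ Fin n) :=
    ⟨finProdFinEquiv.toEmbedding.trans (Fin.castLEEmb hsN)⟩
  obtain ⟨f, hf⟩ := exists_balanced (Fin b × Fin b) hN
  obtain ⟨g, hg⟩ := exists_balanced (Fin m) hN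
  simp only [Nat.card_prod, Nat.card_fin] at hf hg
  have hdiv : ∀ a : Fin k, a.val / d < b := fun a =>
    (Nat.div_lt_iff_lt_mul hd).2 (by rw [mul_comm]; exact a.isLt.trans_le hk)
  obtain ⟨pos, hpos⟩ : ∃ pos : Fin k → Fin b, ∀ a, (pos a).val = a.val / d :=
    ⟨fun a => ⟨a.val / d, hdiv a⟩, fun _ => rfl⟩
  obtain ⟨blk, hblk⟩ : ∃ blk : Fin k → Fin d, ∀ a, (blk a).val = a.val % d :=
    ⟨fun a => ⟨a.val % d, Nat.mod_lt _ hd⟩, fun _ => rfl⟩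
  have hpb : ∀ a : Fin k, a.val = blk a + d * pos a := fun a => by
    rw [hpos, hblk, Nat.mod_add_div]
  refine reach_product_of_owners hs hsn enc henc pos blk hpb ?_ hk H
    (fun i x => node (i, f x)) (fun i w => node (i, g w)) hL1 ?_ ?_ ?_
  · intro x p h
    refine Fin.ext ?_
    rw [hpos]
    simp only
    rw [add_comm, Nat.mul_add_div hd, Nat.div_eq_of_lt x.isLt, add_zero]
  · refine fun v => (card_fiber_node_le node (fun x : Fin k × Fin k => f (pos x.1, pos x.2))
      (fun j => ?_) v).trans hL2
    refine (Nat.card_le_card_of_injective (β := {x // f x = j} × Fin d × Fin d)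
      (fun x => (⟨(pos x.1.1, pos x.1.2), x.2⟩, blk x.1.1, blk x.1.2)) ?_).trans ?_
    · rintro ⟨⟨a, a'⟩, h⟩ ⟨⟨c, c'⟩, h'⟩ he
      simp only [Prod.mk.injEq, Subtype.mk.injEq] at he
      have h1 : a = c := Fin.ext (by rw [hpb a, hpb c, he.1.1, he.2.1])
      have h2 : a' = c' := Fin.ext (by rw [hpb a', hpb c', he.1.2, he.2.2])
      simp [h1, h2]
    · rw [Nat.card_prod, Nat.card_prod, Nat.card_fin]
      exact Nat.mul_le_mul_right _ (hf j)
  · refine fun v => (card_fiber_node_le node (fun x : Fin m × Fin b × Fin b => f x.2)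
      (fun j => ?_) v).trans hL3
    refine (Nat.card_le_card_of_injective (β := {x // f x = j} × Fin m)
      (fun x => (⟨x.1.2, x.2⟩, x.1.1)) ?_).trans ?_
    · rintro ⟨⟨a, a'⟩, h⟩ ⟨⟨c, c'⟩, h'⟩ he
      simp only [Prod.mk.injEq, Subtype.mk.injEq] at he
      simp [he.1, he.2]
    · rw [Nat.card_prod, Nat.card_fin]
      exact Nat.mul_le_mul_right _ (hf j)
  · refine fun v => (card_fiber_node_le node (fun x : Fin m × Fin b × Fin b => g x.1)
      (fun j => ?_) v).trans hL4
    refine (Nat.card_le_card_of_injective (β := {x // g x = j} × Fin b × Fin b)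
      (fun x => (⟨x.1.1, x.2⟩, x.1.2)) ?_).trans ?_
    · rintro ⟨⟨a, a'⟩, h⟩ ⟨⟨c, c'⟩, h'⟩ he
      simp only [Prod.mk.injEq, Subtype.mk.injEq] at he
      simp [he.1, he.2]
    · rw [Nat.card_prod, Nat.card_prod, Nat.card_fin]
      exact Nat.mul_le_mul_right _ (hg j)

theorem sq_div_sqrt_add_one_le {k N A : ℕ} (hN : 0 < N) (hk : k * k ≤ N * A) :
    (k / Nat.sqrt N + 1) ^ 2 ≤ 8 * A + 2 := by
  have hq : 0 < Nat.sqrt N := Nat.sqrt_pos.2 hN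
  have h1 : N < (Nat.sqrt N + 1) * (Nat.sqrt N + 1) := Nat.lt_succ_sqrt N
  generalize Nat.sqrt N = q at *
  have h2 : k / q * q ≤ k := Nat.div_mul_le_self k q
  generalize k / q = t at *
  have h3 : t * t ≤ 4 * A := by
    have h5 : (q * q) * (t * t) ≤ (q * q) * (4 * A) := by
      calc (q * q) * (t * t) = (t * q) * (t * q) := by ring
        _ ≤ k * k := Nat.mul_le_mul h2 h2
        _ ≤ N * A := hk
        _ ≤ (4 * (q * q)) * A := Nat.mul_le_mul_right _ (by nlinarith)
        _ = _ := by ring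
    exact Nat.le_of_mul_le_mul_left h5 (Nat.mul_pos hq hq)
  nlinarith [sq_nonneg ((t : ℤ) - 1), two_mul_le_add_sq t 1]

/-- With `b` about `k / d`, the `s * m * b * b` combinations are `O(n * (k / d) ^ 2)` field elements
up to rounding. Spread evenly over `n` nodes, each routing `n` elements in `O(1)` rounds, they cost
about `k * k / (d * d * n)` rounds. -/
theorem exists_reach_product {K : Type} [Field K] {n k s d m κ C₀ : ℕ} (hs : 0 < s) (hsn : s ≤ n)
    (enc : K → Fin κ → Msg n) (henc : Function.Injective enc) (hd : 0 < d) (hdN : d * d ≤ n / s)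
    (H : HasBilinearAlgorithm K d m) (hm : m ≤ C₀ * (n / s)) :
    Reach (24 * (κ * (10 * (C₀ + 1) * (k * k / (d * d * n) + 1)))) (factorKnowledge K n k s)
      (productKnowledge K n k s) := by
  have hN : 0 < n / s := Nat.div_pos hsn hs
  have hNn : n / s ≤ n := Nat.div_le_self n s
  have hn : 0 < n := hs.trans_le hsn
  have hQ : k * k ≤ d * d * n * (k * k / (d * d * n) + 1) :=
    (Nat.lt_mul_div_succ _ (by positivity)).le
  have hQ0 : 1 ≤ k * k / (d * d * n) + 1 := Nat.le_add_left _ _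
  generalize k * k / (d * d * n) + 1 = Q at *
  have hnQ : n ≤ n * Q := Nat.le_mul_of_pos_right n hQ0
  have hkd : k / d * d ≤ k := Nat.div_mul_le_self k d
  have hb : (k / d + 1) * (k / d + 1) ≤ 4 * (n * Q) := by
    have h5 : (d * d) * ((k / d + 1) * (k / d + 1)) ≤ (d * d) * (4 * (n * Q)) := by
      calc (d * d) * ((k / d + 1) * (k / d + 1)) = (k / d * d + d) * (k / d * d + d) := by ring
        _ ≤ (k + d) * (k + d) := Nat.mul_le_mul (by omega) (by omega)
        _ ≤ 2 * (k * k) + 2 * (d * d) := by nlinarith [two_mul_le_add_sq k d]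
        _ ≤ 2 * (d * d * n * Q) + 2 * (d * d * (n * Q)) := by
            exact Nat.add_le_add (Nat.mul_le_mul_left _ hQ)
              (Nat.mul_le_mul_left _ (Nat.le_mul_of_pos_right _ (hn.trans_le hnQ)))
        _ = _ := by ring
    exact Nat.le_of_mul_le_mul_left h5 (Nat.mul_pos hd hd)
  have hbN : (k / d + 1) * (k / d + 1) / (n / s) * (n / s) ≤ 4 * (n * Q) :=
    (Nat.div_mul_le_self _ _).trans hb
  refine reach_product (b := k / d + 1) hs hsn enc henc hd (Nat.lt_mul_div_succ k hd).le H ?_ ?_ ?_ ?_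
  · refine (sq_div_sqrt_add_one_le (A := n * Q) hN ?_).trans ?_
    · calc _ ≤ _ := hQ
        _ = d * d * (n * Q) := by ring
        _ ≤ _ := Nat.mul_le_mul_right _ hdN
    · nlinarith [Nat.zero_le (C₀ * (n * Q))]
  · calc _ ≤ ((k / d + 1) * (k / d + 1) / (n / s) + 1) * (n / s) := Nat.mul_le_mul_left _ hdN
      _ = (k / d + 1) * (k / d + 1) / (n / s) * (n / s) + n / s := by ring
      _ ≤ 4 * (n * Q) + n * Q := by omega
      _ ≤ _ := by nlinarith [Nat.zero_le (C₀ * (n * Q))]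
  · calc _ ≤ ((k / d + 1) * (k / d + 1) / (n / s) + 1) * (C₀ * (n / s)) := Nat.mul_le_mul_left _ hm
      _ = C₀ * ((k / d + 1) * (k / d + 1) / (n / s) * (n / s) + n / s) := by ring
      _ ≤ C₀ * (4 * (n * Q) + n * Q) := Nat.mul_le_mul_left _ (by omega)
      _ ≤ _ := by nlinarith [Nat.zero_le (C₀ * (n * Q))]
  · calc _ ≤ (C₀ + 1) * (4 * (n * Q)) :=
          Nat.mul_le_mul (Nat.succ_le_succ (Nat.div_le_of_le_mul (by rw [mul_comm]; exact hm))) hb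
      _ ≤ _ := by nlinarith [Nat.zero_le (C₀ * (n * Q))]

theorem explicitBound_ge_one (n x : ℕ) (ρ δ : ℝ) : 1 ≤ explicitBound n x ρ δ := le_max_left _ _

/-- Without rounding, `k = n / x` and `d ^ 2 = (n / x ^ δ) ^ (2 / σ)` turn the left side into
exactly `n ^ ρ * x ^ (-(2 + δ * (ρ - 1)))`. The roundings of `k`, of `d` and of `n / s` contribute a
factor `4` each. -/
theorem sq_div_le_explicitBound {n x d : ℕ} {σ δ : ℝ} (hσ : 2 ≤ σ) (hx : 1 ≤ x) (hxn : x ≤ n)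
    (hδ : 0 ≤ δ) (hd : ((n / ⌈(x : ℝ) ^ δ⌉₊ : ℕ) : ℝ) ^ (1 / σ) ≤ 2 * d) (hd0 : 0 < d)
    (hN : 0 < n / ⌈(x : ℝ) ^ δ⌉₊) :
    (⌈(n : ℝ) / x⌉₊ : ℝ) ^ 2 / (d ^ 2 * n) ≤ 64 * explicitBound n x (1 - 2 / σ) δ := by
  have hx0 : (0 : ℝ) < x := by exact_mod_cast hx
  have hx1 : (1 : ℝ) ≤ x := by exact_mod_cast hx
  have hn0 : (0 : ℝ) < n := by exact_mod_cast (hx.trans hxn)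
  have hσ0 : 0 < σ := by linarith
  have hxδ : 1 ≤ (x : ℝ) ^ δ := Real.one_le_rpow hx1 hδ
  set y : ℝ := (x : ℝ) ^ δ with hy
  have hk : (⌈(n : ℝ) / x⌉₊ : ℝ) ≤ 2 * (n / x) := by
    have h1 : (1 : ℝ) ≤ n / x := by rw [le_div_iff₀ hx0, one_mul]; exact_mod_cast hxn
    have := (Nat.ceil_lt_add_one (zero_le_one.trans h1)).le
    linarith
  have hs : (⌈y⌉₊ : ℝ) ≤ 2 * y := by
    have := (Nat.ceil_lt_add_one (zero_le_one.trans hxδ)).le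
    linarith
  have hs0 : (0 : ℝ) < ⌈y⌉₊ := by exact_mod_cast Nat.ceil_pos.2 (zero_lt_one.trans_le hxδ)
  set N := n / ⌈y⌉₊ with hNdef
  have hN0 : (0 : ℝ) < N := by exact_mod_cast hN
  have hNn : (n : ℝ) ≤ N * (4 * y) := by
    have h1 : n < ⌈y⌉₊ * (N + 1) := Nat.lt_mul_div_succ n (by exact_mod_cast hs0)
    have h2 : (n : ℝ) ≤ ⌈y⌉₊ * (N + 1) := by exact_mod_cast h1.le
    have h3 : (1 : ℝ) ≤ N := by exact_mod_cast hN
    nlinarith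
  set t : ℝ := 1 / σ with ht
  have ht0 : 0 < t := by positivity
  have ht2 : t * 2 ≤ 1 := by rw [ht, div_mul_eq_mul_div, div_le_one hσ0]; linarith
  have hd2 : ((N : ℝ) ^ t) ^ 2 ≤ 4 * (d : ℝ) ^ 2 := by
    have : 0 ≤ (N : ℝ) ^ t := by positivity
    nlinarith
  have hN2 : ((N : ℝ) ^ t) ^ 2 = (N : ℝ) ^ (t * 2) := by
    rw [← Real.rpow_natCast, ← Real.rpow_mul hN0.le]; norm_num
  have hpow : (n : ℝ) ^ (t * 2) ≤ (N : ℝ) ^ (t * 2) * (4 * y ^ (t * 2)) := by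
    calc (n : ℝ) ^ (t * 2) ≤ (N * (4 * y)) ^ (t * 2) := Real.rpow_le_rpow hn0.le hNn (by positivity)
      _ = (N : ℝ) ^ (t * 2) * (4 ^ (t * 2) * y ^ (t * 2)) := by
          rw [Real.mul_rpow hN0.le (by positivity), Real.mul_rpow (by norm_num) (by positivity)]
      _ ≤ (N : ℝ) ^ (t * 2) * (4 * y ^ (t * 2)) := by
          gcongr
          calc (4 : ℝ) ^ (t * 2) ≤ 4 ^ (1 : ℝ) :=
                Real.rpow_le_rpow_of_exponent_le (by norm_num) ht2
            _ = 4 := Real.rpow_one 4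
  have hbound : (n : ℝ) ^ (1 - 2 / σ) * (x : ℝ) ^ (-(2 + δ * ((1 - 2 / σ) - 1))) =
      n * y ^ (t * 2) / (x ^ 2 * (n : ℝ) ^ (t * 2)) := by
    have e1 : 1 - 2 / σ = 1 - t * 2 := by rw [ht]; ring
    have e2 : -(2 + δ * ((1 - 2 / σ) - 1)) = δ * (t * 2) - 2 := by rw [ht]; ring
    rw [e2, e1, Real.rpow_sub hn0, Real.rpow_sub hx0, Real.rpow_one, hy, ← Real.rpow_mul hx0.le]
    norm_num
    ring
  have hle : n * y ^ (t * 2) / (x ^ 2 * (n : ℝ) ^ (t * 2)) ≤ explicitBound n x (1 - 2 / σ) δ := by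
    rw [← hbound]
    exact le_max_right _ _
  refine le_trans ?_ (mul_le_mul_of_nonneg_left hle (by norm_num))
  have hd0' : (0 : ℝ) < d := by exact_mod_cast hd0
  rw [← mul_div_assoc, div_le_div_iff₀ (by positivity) (by positivity)]
  have hk2 : (⌈(n : ℝ) / x⌉₊ : ℝ) ^ 2 * x ^ 2 ≤ 4 * n ^ 2 := by
    have h1 : (⌈(n : ℝ) / x⌉₊ : ℝ) * x ≤ 2 * n := by
      calc _ ≤ 2 * (n / x) * (x : ℝ) := by gcongr
        _ = 2 * n := by field_simp
    have h2 : 0 ≤ (⌈(n : ℝ) / x⌉₊ : ℝ) * x := by positivity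
    nlinarith
  have hyp : 0 < y ^ (t * 2) := by positivity
  calc (⌈(n : ℝ) / x⌉₊ : ℝ) ^ 2 * (x ^ 2 * (n : ℝ) ^ (t * 2))
      = ((⌈(n : ℝ) / x⌉₊ : ℝ) ^ 2 * x ^ 2) * (n : ℝ) ^ (t * 2) := by ring
    _ ≤ (4 * n ^ 2) * ((4 * (d : ℝ) ^ 2) * (4 * y ^ (t * 2))) := by
        rw [hN2] at hd2
        gcongr
        exact hpow.trans (mul_le_mul_of_nonneg_right hd2 (by positivity))
    _ = 64 * (n * y ^ (t * 2)) * (d ^ 2 * n) := by ring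

/-- The bound on the complexity of the multiple matrix product. -/
theorem exists_productSolvable (K : ℕ → Type) [∀ n, Field (K n)] [∀ n, Finite (K n)]
    (κ : ℕ) (hκ : ∀ n, Nat.card (K n) ≤ 2 ^ (κ * (Nat.log 2 n + 1)))
    (σ : ℝ) (hσ2 : 2 ≤ σ) (hσ : IsMatMulExponent K σ) :
    ∃ C : ℕ, ∀ (n x : ℕ) (δ : ℝ), 1 ≤ x → x ≤ n → 0 ≤ δ → (x : ℝ) ^ δ ≤ n →
      ∃ r : ℕ, ProductSolvable (K n) n ⌈(n : ℝ) / x⌉₊ ⌈(x : ℝ) ^ δ⌉₊ r ∧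
        (r : ℝ) ≤ C * explicitBound n x (1 - 2 / σ) δ := by
  obtain ⟨c, hc⟩ := hσ
  refine ⟨24 * κ * (10 * (⌈c⌉₊ + 1)) * 65 + 1, fun n x δ hx hxn hδ hxδ => ?_⟩
  obtain ⟨enc, henc⟩ := exists_encoding (hκ n)
  have hx1 : (1 : ℝ) ≤ x := by exact_mod_cast hx
  have hσ0 : 0 < σ := by linarith
  have h1 : 1 ≤ (x : ℝ) ^ δ := Real.one_le_rpow hx1 hδ
  have hs : 0 < ⌈(x : ℝ) ^ δ⌉₊ := Nat.ceil_pos.2 (zero_lt_one.trans_le h1)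
  have hsn : ⌈(x : ℝ) ^ δ⌉₊ ≤ n := Nat.ceil_le.2 hxδ
  have hN : 0 < n / ⌈(x : ℝ) ^ δ⌉₊ := Nat.div_pos hsn hs
  have hN1 : (1 : ℝ) ≤ (n / ⌈(x : ℝ) ^ δ⌉₊ : ℕ) := by exact_mod_cast hN
  have hN0 : (0 : ℝ) ≤ (n / ⌈(x : ℝ) ^ δ⌉₊ : ℕ) := by positivity
  obtain ⟨N, hNdef⟩ : ∃ N, N = n / ⌈(x : ℝ) ^ δ⌉₊ := ⟨_, rfl⟩
  have hroot : 1 ≤ (N : ℝ) ^ (1 / σ) := Real.one_le_rpow (hNdef ▸ hN1) (by positivity)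
  -- The largest `d` with `d ^ σ ≤ N`: there are then `O(1)` block products for each of the `N`
  -- nodes of an instance.
  obtain ⟨d, hd⟩ : ∃ d, d = ⌊(N : ℝ) ^ (1 / σ)⌋₊ := ⟨_, rfl⟩
  have hd0 : 0 < d := by rw [hd]; exact Nat.floor_pos.2 hroot
  have hd1 : (1 : ℝ) ≤ d := by exact_mod_cast hd0
  have hdle : (d : ℝ) ≤ (N : ℝ) ^ (1 / σ) := by
    rw [hd]; exact Nat.floor_le (zero_le_one.trans hroot)
  have hdge : (N : ℝ) ^ (1 / σ) ≤ 2 * d := by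
    have := (Nat.lt_floor_add_one ((N : ℝ) ^ (1 / σ))).le
    rw [← hd] at this
    linarith
  have hdσ : (d : ℝ) ^ σ ≤ N := by
    calc (d : ℝ) ^ σ ≤ ((N : ℝ) ^ (1 / σ)) ^ σ := Real.rpow_le_rpow (by positivity) hdle hσ0.le
      _ = N := by
        rw [← Real.rpow_mul (by positivity), one_div, inv_mul_cancel₀ hσ0.ne', Real.rpow_one]
  have hdN : d * d ≤ n / ⌈(x : ℝ) ^ δ⌉₊ := by
    rw [← hNdef]
    have : (d : ℝ) ^ (2 : ℝ) ≤ N :=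
      (Real.rpow_le_rpow_of_exponent_le hd1 hσ2).trans hdσ
    rw [Real.rpow_two, sq] at this
    exact_mod_cast this
  obtain ⟨m, hm, H⟩ := hc n d
  have hmN : m ≤ ⌈c⌉₊ * (n / ⌈(x : ℝ) ^ δ⌉₊) := by
    rw [← hNdef]
    have : (m : ℝ) ≤ ⌈c⌉₊ * (N : ℝ) :=
      hm.trans (mul_le_mul (Nat.le_ceil c) hdσ (by positivity) (by positivity))
    exact_mod_cast this
  have hreach := exists_reach_product (k := ⌈(n : ℝ) / x⌉₊) hs hsn enc henc hd0 hdN H hmN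
  refine ⟨_, .of_reach (Nat.succ_pos _) (hreach.le (Nat.le_succ _)), ?_⟩
  have hE := explicitBound_ge_one n x (1 - 2 / σ) δ
  have hQ : ((⌈(n : ℝ) / x⌉₊ * ⌈(n : ℝ) / x⌉₊ / (d * d * n) + 1 : ℕ) : ℝ) ≤
      65 * explicitBound n x (1 - 2 / σ) δ := by
    have h2 := sq_div_le_explicitBound hσ2 hx hxn hδ (hNdef ▸ hdge) hd0 hN
    have h3 : ((⌈(n : ℝ) / x⌉₊ * ⌈(n : ℝ) / x⌉₊ / (d * d * n) : ℕ) : ℝ) ≤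
        (⌈(n : ℝ) / x⌉₊ : ℝ) ^ 2 / (d ^ 2 * n) := by
      refine Nat.cast_div_le.trans (le_of_eq ?_)
      push_cast
      ring
    push_cast at h3 ⊢
    linarith
  have hnn : (0 : ℝ) ≤ 24 * κ * (10 * (⌈c⌉₊ + 1)) := by positivity
  have := mul_le_mul_of_nonneg_left hQ hnn
  push_cast at this ⊢
  linarith

/-! ### Uniform probabilities -/

/-- The probability of an event for a uniformly distributed element of `A`. -/
noncomputable def pr {A : Type} (E : A → Prop) : ℝ := (Nat.card {a // E a} : ℝ) / Nat.card A

theorem pr_equiv {A B : Type} (e : A ≃ B) (E : B → Prop) : pr (fun a => E (e a)) = pr E := by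
  rw [pr, pr, Nat.card_congr e, Nat.card_congr (e.subtypeEquiv (q := E) fun a => Iff.rfl)]

theorem pr_mono {A : Type} [Finite A] {E F : A → Prop} (h : ∀ a, E a → F a) : pr E ≤ pr F := by
  refine div_le_div_of_nonneg_right ?_ (Nat.cast_nonneg _)
  exact_mod_cast Nat.card_le_card_of_injective (fun x : {a // E a} => (⟨x.1, h _ x.2⟩ : {a // F a}))
    fun x y h => Subtype.ext (Subtype.ext_iff.1 h :)

theorem pr_le_one {A : Type} [Finite A] (E : A → Prop) : pr E ≤ 1 := by
  refine div_le_one_of_le₀ ?_ (Nat.cast_nonneg _)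
  exact_mod_cast Nat.card_le_card_of_injective (fun x : {a // E a} => x.1) Subtype.val_injective

theorem pr_nonneg {A : Type} (E : A → Prop) : 0 ≤ pr E := by unfold pr; positivity

theorem pr_not {A : Type} [Finite A] [Nonempty A] (E : A → Prop) : pr (fun a => ¬ E a) = 1 - pr E := by
  classical
  have := Fintype.ofFinite A
  have h0 : (Nat.card A : ℝ) ≠ 0 := by exact_mod_cast Nat.card_pos.ne'
  have h : Nat.card {a // ¬ E a} + Nat.card {a // E a} = Nat.card A := by
    simp only [Nat.card_eq_fintype_card]
    have := Fintype.card_subtype_compl E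
    have h2 := Fintype.card_subtype_le E
    omega
  rw [pr, pr, eq_sub_iff_add_eq, ← add_div, div_eq_one_iff_eq h0]
  exact_mod_cast h

theorem pr_prod {A B : Type} [Finite A] [Finite B] (E : A → Prop) (F : B → Prop) :
    pr (fun x : A × B => E x.1 ∧ F x.2) = pr E * pr F := by
  rw [pr, pr, pr, Nat.card_congr (Equiv.subtypeProdEquivProd (p := E) (q := F)), Nat.card_prod,
    Nat.card_prod, div_mul_div_comm]
  push_cast
  rfl

theorem pr_true {A : Type} [Finite A] [Nonempty A] : pr (fun _ : A => True) = 1 := by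
  have h0 : (Nat.card A : ℝ) ≠ 0 := by exact_mod_cast Nat.card_pos.ne'
  rw [pr, Nat.card_congr (Equiv.subtypeUnivEquiv fun _ => trivial), div_self h0]

theorem pr_fst {A B : Type} [Finite A] [Finite B] [Nonempty B] (E : A → Prop) :
    pr (fun x : A × B => E x.1) = pr E := by
  have := pr_prod E (fun _ : B => True)
  rw [pr_true, mul_one] at this
  simpa using this

theorem pr_eval {ι : Type} [Finite ι] {B : ι → Type} [∀ i, Finite (B i)] [∀ i, Nonempty (B i)]
    (i : ι) (E : B i → Prop) : pr (fun f : ∀ i, B i => E (f i)) = pr E := by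
  classical
  have h := pr_equiv (Equiv.piSplitAt i B) (fun x => E x.1)
  rw [pr_fst] at h
  exact h

theorem pr_forall {A : Type} [Finite A] (T : ℕ) (E : A → Prop) :
    pr (fun f : Fin T → A => ∀ t, E (f t)) = pr E ^ T := by
  have e : {f : Fin T → A // ∀ t, E (f t)} ≃ (Fin T → {a // E a}) :=
    Equiv.subtypePiEquivPi (p := fun _ => E)
  rw [pr, pr, Nat.card_congr e, Nat.card_fun, Nat.card_fun, Nat.card_fin, div_pow]
  push_cast
  rfl

/-! ### Scheduling of randomized phases -/

theorem exists_feasible_list {n : ℕ} {Ω : Type} (l : List (ℕ × (Ω → Prop))) :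
    ∀ {E : Knowledge n Ω}, (∀ p ∈ l, Reach p.1 E fun _ ω ω' => p.2 ω = p.2 ω') →
      ∃ G, Feasible E G ∧ ∀ l₁ p l₂, l = l₁ ++ p :: l₂ → ∀ v,
        Knows (ViewEq E G ((l₁.map Prod.fst).sum + p.1) v) p.2 := by
  induction l with
  | nil => exact fun {E} _ => ⟨_, feasible_const E, fun l₁ p l₂ h => by simp at h⟩
  | cons p l ih =>
    intro E hl
    obtain ⟨G', hG', h'⟩ := ih (E := fun v ω ω' => E v ω ω' ∧ p.2 ω = p.2 ω') fun q hq =>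
      (hl q (List.mem_cons_of_mem _ hq)).mono (fun _ _ _ h => h.1) (fun _ _ _ _ h => h)
    obtain ⟨G, hG, hGG⟩ := (hl p List.mem_cons_self).keep.exists_feasible hG'
    refine ⟨G, hG, fun l₁ q l₂ hq v ω ω' hv => ?_⟩
    cases l₁ with
    | nil =>
      simp only [List.nil_append, List.cons.injEq] at hq
      obtain ⟨rfl, rfl⟩ := hq
      simp only [List.map_nil, List.sum_nil, Nat.zero_add] at hv
      exact (hGG 0 v ω ω' hv).1.2
    | cons a l₁ =>
      simp only [List.cons_append, List.cons.injEq] at hq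
      obtain ⟨rfl, hq⟩ := hq
      simp only [List.map_cons, List.sum_cons, Nat.add_assoc] at hv
      exact h' l₁ q l₂ hq v ω ω' (hGG _ v ω ω' hv)

/-- A randomized procedure of a fixed duration at the end of which all nodes know whether
something was found. -/
structure Phase (n : ℕ) where
  Seed : Type
  finite : Finite Seed
  nonempty : Nonempty Seed
  rounds : ℕ
  found : (Fin n → Fin n → Prop) → (Fin n → Seed) → Prop
  reach : Reach (Ω := (Fin n → Fin n → Prop) × (Fin n → Seed)) rounds
    (fun v ω ω' => localView ω.1 v = localView ω'.1 v ∧ ω.2 v = ω'.2 v)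
    (fun _ ω ω' => found ω.1 ω.2 = found ω'.1 ω'.2)

attribute [instance] Phase.finite Phase.nonempty

theorem sum_le_of_pairwise {α : Type} (f : α → ℕ) {l l₁ l₂ : List α} {a : α}
    (hl : l.Pairwise fun a b => f a ≤ f b) (h : l = l₁ ++ a :: l₂) :
    (l₁.map f).sum + f a ≤ l.length * f a := by
  subst h
  have h1 : ∀ x ∈ l₁.map f, x ≤ f a := by
    intro x hx
    obtain ⟨b, hb, rfl⟩ := List.mem_map.1 hx
    exact (List.pairwise_append.1 hl).2.2 b hb a List.mem_cons_self
  have h2 := List.sum_le_card_nsmul _ _ h1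
  simp only [List.length_map, smul_eq_mul] at h2
  simp only [List.length_append, List.length_cons]
  nlinarith [Nat.zero_le (l₂.length * f a)]

/-- The procedures are run in the order of increasing duration, so none that precedes `j` takes
longer than `dur j`. A fast suitable procedure thus pays only for the number of competitors. -/
theorem exists_schedule {n : ℕ} {Ω J : Type} [Finite J] {E : Knowledge n Ω} (dur : J → ℕ)
    (F : J → Ω → Prop) (hF : ∀ j, Reach (dur j) E fun _ ω ω' => F j ω = F j ω') :
    ∃ (G : ℕ → Fin n → Fin n → Ω → Msg n) (time : J → ℕ), Feasible E G ∧
      (∀ j v, Knows (ViewEq E G (time j) v) (F j)) ∧ ∀ j, time j ≤ Nat.card J * dur j := by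
  classical
  have := Fintype.ofFinite J
  have hsorted := List.pairwise_insertionSort (fun a b => dur a ≤ dur b) (Finset.univ : Finset J).toList
  set l := (Finset.univ : Finset J).toList.insertionSort (fun a b => dur a ≤ dur b) with hl
  have hmem : ∀ j, j ∈ l := fun j =>
    ((List.perm_insertionSort _ _).mem_iff).2 (Finset.mem_toList.2 (Finset.mem_univ j))
  have hlen : l.length = Nat.card J := by
    rw [hl, List.length_insertionSort, Finset.length_toList, Finset.card_univ,
      Nat.card_eq_fintype_card]
  obtain ⟨G, hG, h⟩ := exists_feasible_list (l.map fun j => (dur j, F j)) (E := E) (by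
    intro p hp
    obtain ⟨j, -, rfl⟩ := List.mem_map.1 hp
    exact hF j)
  choose l₁ l₂ hsplit using fun j => List.append_of_mem (hmem j)
  refine ⟨G, fun j => ((l₁ j).map dur).sum + dur j, hG, fun j v => ?_, fun j => ?_⟩
  · have := h ((l₁ j).map fun j => (dur j, F j)) (dur j, F j) ((l₂ j).map fun j => (dur j, F j))
      (by conv_lhs => rw [hsplit j, List.map_append, List.map_cons]) v
    simpa [List.map_map, Function.comp_def] using this
  · rw [← hlen]
    exact sum_le_of_pairwise dur hsorted (hsplit j)

/-- The phase `i₀` is the fallback: only phases not slower than it are scheduled, which bounds the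
total time. Each is tried `T` times with independent seeds. -/
theorem exists_detectionProtocol {n : ℕ} {ι : Type} [Finite ι] (ph : ι → Phase n) (T : ℕ) (i₀ : ι) :
    ∃ P : DetectionProtocol n,
      (∀ adj R, Nat.card ι * T * (ph i₀).rounds + 1 ≤ R → ∀ c, ∃ b, AllAnswer P adj R c b) ∧
      (∀ adj, (∀ i ρ, ¬ (ph i).found adj ρ) → ∀ R (c : P.Coins R) v,
        P.result (localView adj) R c v ≠ some true) ∧
      (∀ adj i R, (ph i).rounds ≤ (ph i₀).rounds → Nat.card ι * T * (ph i).rounds + 1 ≤ R →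
        1 - (1 - pr ((ph i).found adj)) ^ T ≤ P.prob R fun c => AllAnswer P adj R c true) := by
  classical
  -- The seeds of a node for all phases and trials are packed into its single random number of the
  -- first round.
  obtain ⟨N, ⟨e⟩⟩ : ∃ N, Nonempty (Fin (N + 1) ≃ ∀ i, Fin T → (ph i).Seed) := by
    obtain ⟨N, hN⟩ := Nat.exists_eq_succ_of_ne_zero
      (Nat.card_pos (α := ∀ i, Fin T → (ph i).Seed)).ne'
    exact ⟨N, ⟨(Finite.equivFinOfCardEq hN).symm⟩⟩
  let J := {i : ι // (ph i).rounds ≤ (ph i₀).rounds} × Fin T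
  let Ω := (Fin n → Fin n → Prop) × (Fin n → Fin (N + 1))
  let inp : Fin n → Ω → Set (Fin n) × Set (Fin n) := fun v ω => localView ω.1 v
  let seed : Fin n → Ω → Fin (N + 1) := fun v ω => ω.2 v
  let F : J → Ω → Prop := fun j ω => (ph j.1).found ω.1 (fun v => e (ω.2 v) j.1 j.2)
  obtain ⟨G, time, hG, hknow, htime⟩ := exists_schedule (E := initialKnowledge N inp seed)
    (fun j : J => (ph j.1).rounds) F (by
      intro j
      refine ((ph j.1).reach.comap (fun ω : Ω => (ω.1, fun v => e (ω.2 v) j.1 j.2))).mono ?_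
        (fun _ _ _ _ h => h)
      intro v ω ω' h
      refine ⟨h.1, ?_⟩
      have h2 : ω.2 v = ω'.2 v := h.2
      simp only [h2])
  have hcard : Nat.card J ≤ Nat.card ι * T := by
    rw [Nat.card_prod, Nat.card_fin]
    exact Nat.mul_le_mul_right _ (Nat.card_le_card_of_injective _ Subtype.val_injective)
  have htime' : ∀ j : J, time j ≤ Nat.card ι * T * (ph j.1).rounds := fun j =>
    (htime j).trans (Nat.mul_le_mul_right _ hcard)
  let Rmax := Nat.card ι * T * (ph i₀).rounds
  have hmax : ∀ j, time j ≤ Rmax := fun j =>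
    (htime' j).trans (Nat.mul_le_mul_left _ j.1.2)
  -- "True" is answered as soon as some trial is known to have succeeded, "false" only when all
  -- trials are over; hence answers are common and final.
  let ans : ℕ → Ω → Fin n → Option Bool := fun r ω _ =>
    if ∃ j, time j ≤ r ∧ F j ω then some true else if Rmax ≤ r then some false else none
  have hans : ∀ r v, Knows (ViewEq (initialKnowledge N inp seed) G r v) (fun ω => ans r ω v) := by
    intro r v ω ω' h
    have : (∃ j, time j ≤ r ∧ F j ω) = ∃ j, time j ≤ r ∧ F j ω' := by
      refine propext (exists_congr fun j => and_congr_right fun hj => ?_)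
      rw [hknow j v ω ω' (h.anti hj)]
    simp only [ans, this]
  have hmono : ∀ r ω v o, ans r ω v = some o → ans (r + 1) ω v = some o := by
    intro r ω v o h
    simp only [ans] at h ⊢
    by_cases h1 : ∃ j, time j ≤ r ∧ F j ω
    · have h2 : ∃ j, time j ≤ r + 1 ∧ F j ω := by
        obtain ⟨j, hj, hj'⟩ := h1
        exact ⟨j, by omega, hj'⟩
      rw [if_pos h1] at h
      rw [if_pos h2, h]
    · rw [if_neg h1] at h
      by_cases h3 : Rmax ≤ r
      · have h2 : ¬ ∃ j, time j ≤ r + 1 ∧ F j ω := by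
          rintro ⟨j, -, hj⟩
          exact h1 ⟨j, (hmax j).trans h3, hj⟩
        rw [if_neg h2, if_pos (h3.trans (Nat.le_succ r))]
        rwa [if_pos h3] at h
      · simp [h3] at h
  have hres : ∀ adj R (c : (realize N inp seed G ans).Coins (R + 1)) v,
      (realize N inp seed G ans).result (localView adj) (R + 1) c v = ans (R + 1) (adj, c 0) v :=
    fun adj R c v => realize_result hG hans hmono (adj, c 0) R c (fun _ => rfl) v
  refine ⟨realize N inp seed G ans, ?_, ?_, ?_⟩
  · intro adj R hR c
    obtain ⟨R, rfl⟩ := Nat.exists_eq_add_of_le' ((Nat.le_add_left _ _).trans hR)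
    by_cases h : ∃ j, time j ≤ R + 1 ∧ F j (adj, c 0)
    · exact ⟨true, fun v => by rw [hres]; simp only [ans]; rw [if_pos h]⟩
    · exact ⟨false, fun v => by
        rw [hres]; simp only [ans]; rw [if_neg h, if_pos ((Nat.le_succ _).trans hR)]⟩
  · intro adj h R c v
    cases R with
    | zero => simp [realize_result_zero]
    | succ R =>
      rw [hres]
      simp only [ans]
      rw [if_neg]
      · split_ifs <;> simp
      · rintro ⟨j, -, hj⟩
        exact h _ _ hj
  · intro adj i R hi hR
    obtain ⟨R, rfl⟩ := Nat.exists_eq_add_of_le' ((Nat.le_add_left _ _).trans hR)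
    have h1 : pr (fun c : (realize N inp seed G ans).Coins (R + 1) =>
        ∃ t, (ph i).found adj (fun v => e (c 0 v) i t)) = 1 - (1 - pr ((ph i).found adj)) ^ T := by
      -- Only the numbers of the first round matter. Regrouped by phase and trial instead of by
      -- node, they exhibit the `T` trials of phase `i` as independent.
      have e1 := pr_eval (ι := Fin (R + 1)) (B := fun _ => Fin n → Fin (N + 1)) 0
        (fun x => ∃ t, (ph i).found adj (fun v => e (x v) i t))
      have e2 := pr_equiv (A := Fin n → Fin (N + 1)) (B := ∀ i, Fin T → Fin n → (ph i).Seed)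
        { toFun := fun x i t v => e (x v) i t
          invFun := fun y v => e.symm fun i t => y i t v
          left_inv := fun x => by simp
          right_inv := fun y => by simp }
        (fun y => ∃ t, (ph i).found adj (y i t))
      have e3 := pr_eval (B := fun i => Fin T → Fin n → (ph i).Seed) i
        (fun y => ∃ t, (ph i).found adj (y t))
      have e4 := pr_not (fun y : Fin T → Fin n → (ph i).Seed => ∃ t, (ph i).found adj (y t))
      have e5 := pr_forall T (fun x => ¬ (ph i).found adj x)
      simp only [not_exists] at e4
      rw [pr_not] at e5
      refine e1.trans (e2.trans (e3.trans ?_))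
      rw [← e5, e4]
      ring
    rw [← h1]
    refine pr_mono fun c hc v => ?_
    rw [hres]
    simp only [ans]
    rw [if_pos]
    obtain ⟨t, ht⟩ := hc
    exact ⟨(⟨i, hi⟩, t), (htime' _).trans ((Nat.le_succ _).trans hR), ht⟩

/-! ### Walks and products of matrices -/

/-- The product `M t * M (t + 1) * ⋯ * M (t + m - 1)`. -/
def chain {ι K : Type} [Fintype ι] [DecidableEq ι] [Field K] (M : ℕ → Matrix ι ι K) (t m : ℕ) :
    Matrix ι ι K := ((List.range' t m).map M).prod

section Chain

variable {ι K : Type} [Fintype ι] [DecidableEq ι] [Field K] (M : ℕ → Matrix ι ι K)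

theorem chain_one (t : ℕ) : chain M t 1 = M t := by simp [chain]

theorem chain_succ_left (t m : ℕ) : chain M t (m + 1) = M t * chain M (t + 1) m := by
  simp [chain, List.range'_succ]

theorem chain_succ_right (t m : ℕ) : chain M t (m + 1) = chain M t m * M (t + m) := by
  simp [chain, List.range'_concat]

/-- A nonzero sum has a nonzero term. As this needs nothing of the characteristic, cancellation can
hide walks but never feign one. -/
theorem exists_walk_of_chain_ne_zero {m : ℕ} : ∀ {t : ℕ} {a b : ι}, chain M t m a b ≠ 0 →
    ∃ f : ℕ → ι, f t = a ∧ f (t + m) = b ∧ ∀ j, t ≤ j → j < t + m → M j (f j) (f (j + 1)) ≠ 0 := by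
  induction m with
  | zero =>
    intro t a b h
    have : a = b := by
      by_contra hab
      simp [chain, hab] at h
    exact ⟨fun _ => a, rfl, this, fun j h1 h2 => by omega⟩
  | succ m ih =>
    intro t a b h
    rw [chain_succ_left, Matrix.mul_apply] at h
    obtain ⟨c, -, hc⟩ := Finset.exists_ne_zero_of_sum_ne_zero h
    obtain ⟨f, h1, h2, h3⟩ := ih (right_ne_zero_of_mul hc)
    refine ⟨Function.update f t a, Function.update_self .., ?_, fun j hj hj' => ?_⟩
    · rw [Function.update_of_ne (by omega), ← h2]
      congr 1
      omega
    · rw [Function.update_of_ne (a := j + 1) (by omega)]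
      rcases hj.eq_or_lt with rfl | hlt
      · rw [Function.update_self, h1]
        exact left_ne_zero_of_mul hc
      · rw [Function.update_of_ne (by omega)]
        exact h3 j hlt (by omega)

end Chain

theorem finRotate_val {h : ℕ} (j : Fin h) : (finRotate h j).val = (j.val + 1) % h := by
  obtain ⟨h, rfl⟩ := Nat.exists_eq_succ_of_ne_zero (Fin.pos j).ne'
  rw [finRotate_apply, Fin.val_add, Fin.val_one', Nat.add_mod_mod]

/-- The colour of a vertex tells its position on the walk, which forces the vertices to be distinct.
-/
theorem IsCycleTuple.of_walk {V : Type} {adj : V → V → Prop} {h : ℕ} (f : ℕ → V)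
    (c : V → ℕ) (hc : ∀ j < h, c (f j) = j) (hadj : ∀ j < h, adj (f j) (f (j + 1)))
    (hclose : f h = f 0) : IsCycleTuple adj h (fun j => f j) := by
  refine ⟨fun i j hij => Fin.ext ?_, fun i => ?_⟩
  · rw [← hc i i.isLt, ← hc j j.isLt]
    exact congrArg c hij
  · simp only [finRotate_val]
    have h1 := hadj i i.isLt
    rcases (Nat.succ_le_of_lt i.isLt).eq_or_lt with hlt | hlt
    · have : i.val + 1 = h := hlt
      rw [this] at h1
      rwa [this, Nat.mod_self, ← hclose]
    · rwa [Nat.mod_eq_of_lt hlt]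

/-! ### Building blocks of the phases -/

/-- All nodes broadcast their seeds first. The random choices are then public, and a deterministic
procedure for each fixed `ρ` suffices. -/
theorem reach_seeds {n c r : ℕ} {S : Type} [Finite S]
    (hS : Nat.card S ≤ 2 ^ (c * (Nat.log 2 n + 1)))
    (found : (Fin n → Fin n → Prop) → (Fin n → S) → Prop)
    (H : ∀ ρ, Reach (n := n) (Ω := Fin n → Fin n → Prop) r
      (fun v adj adj' => localView adj v = localView adj' v)
      (fun _ adj adj' => found adj ρ = found adj' ρ)) :
    Reach (n := n) (Ω := (Fin n → Fin n → Prop) × (Fin n → S)) (c + r)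
      (fun v ω ω' => localView ω.1 v = localView ω'.1 v ∧ ω.2 v = ω'.2 v)
      (fun _ ω ω' => found ω.1 ω.2 = found ω'.1 ω'.2) := by
  obtain ⟨enc, henc⟩ := exists_encoding hS
  have h1 := Reach.of_values (Ω := (Fin n → Fin n → Prop) × (Fin n → S)) c enc henc
    (E := fun v ω ω' => localView ω.1 v = localView ω'.1 v ∧ ω.2 v = ω'.2 v)
    (fun u _ ω => ω.2 u) (fun u w ω ω' h => h.2)
  refine h1.then_keep (Reach.of_public (fun ω => ω.2) (fun v ω ω' h => funext h.2) fun z => ?_)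
  refine ((H z).comap (fun ω : (Fin n → Fin n → Prop) × (Fin n → S) => ω.1)).mono
    (fun v ω ω' h => h.1.1.1) ?_
  rintro v ω ω' ⟨-, h2, h3⟩ h
  rw [h2, h3]
  exact h

/-- In one round all nodes learn whether some node holds the bit one. -/
theorem Reach.exists_bit {n : ℕ} {Ω : Type} {E : Knowledge n Ω} (bit : Fin n → Ω → Prop)
    (h : ∀ v, Knows (E v) (bit v)) :
    Reach 1 E (fun _ ω ω' => (∃ v, bit v ω) = ∃ v, bit v ω') := by
  classical
  refine .step (fun u _ ω _ => decide (bit u ω)) ?_ (.done ?_)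
  · intro u w ω ω' hE
    simp only [h u ω ω' hE]
  · rintro v ω ω' ⟨-, h2⟩
    have : ∀ u, bit u ω ↔ bit u ω' := fun u => by
      have := congrFun (h2 u) ⟨0, Nat.succ_pos _⟩
      simpa using this
    exact propext (exists_congr this)

/-- The owners of the entries know the matrices `A`. -/
abbrev OwnersKnow {n k s : ℕ} {Ω K : Type} (A : Ω → Fin s → Matrix (Fin k) (Fin k) K) :
    Knowledge n Ω :=
  fun v ω ω' => ∀ i a b, Owns n k s v i a b → A ω i a b = A ω' i a b

/-- The value `none` of `src` marks entries that are the same in all situations and need no message.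
This is how discarded tuples become free of cost. -/
theorem Reach.load {n k s κ L : ℕ} {Ω K : Type} (hs : 0 < s) (hsn : s ≤ n)
    (enc : K → Fin κ → Msg n) (henc : Function.Injective enc) {E : Knowledge n Ω}
    (A : Ω → Fin s → Matrix (Fin k) (Fin k) K) (src : Fin s × Fin k × Fin k → Option (Fin n))
    (hnone : ∀ x, src x = none → ∀ ω ω', A ω x.1 x.2.1 x.2.2 = A ω' x.1 x.2.1 x.2.2)
    (hsome : ∀ x u, src x = some u → Knows (E u) fun ω => A ω x.1 x.2.1 x.2.2)
    (hL1 : (k / Nat.sqrt (n / s) + 1) ^ 2 ≤ L * n)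
    (hL2 : ∀ u, Nat.card {x // src x = some u} ≤ L * n) :
    Reach (4 * (κ * L)) E (OwnersKnow A) := by
  have h := Reach.route (M := {x // (src x).isSome}) enc henc L (E := E)
    (fun x => (src x.1).get x.2) (fun x => owner hs hsn x.1)
    (fun x ω => A ω x.1.1 x.1.2.1 x.1.2.2)
    (fun x => hsome x.1 _ (Option.some_get _).symm) (fun u => ?_) (fun v => ?_)
  · refine h.mono (fun _ _ _ h => h) ?_
    intro v ω ω' _ h i a b ho
    cases hx : src (i, a, b) with
    | none => exact hnone (i, a, b) hx ω ω'
    | some u => exact h ⟨(i, a, b), by simp [hx]⟩ (eq_owner hs hsn ho)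
  · have h1 : ∀ x : {x : {x // (src x).isSome} // (src x.1).get x.2 = u}, src x.1.1 = some u :=
      fun x => (Option.some_get x.1.2).symm.trans (congrArg some x.2)
    refine (Nat.card_le_card_of_injective (fun x => (⟨x.1.1, h1 x⟩ : {x // src x = some u})) ?_).trans
      (hL2 u)
    intro x y hxy
    exact Subtype.ext (Subtype.ext (Subtype.ext_iff.1 hxy :))
  · refine (Nat.card_le_card_of_injective
      (fun x => (⟨x.1.1, x.2⟩ : {x // owner hs hsn x = v})) ?_).trans
      ((card_owner_eq_le hs hsn v).trans hL1)
    intro x y hxy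
    exact Subtype.ext (Subtype.ext (Subtype.ext_iff.1 hxy :))

theorem Reach.chain {n k s r ℓ : ℕ} {Ω K : Type} [Field K] {E : Knowledge n Ω}
    (H : ProductSolvable K n k s r) (A : Ω → Fin s → ℕ → Matrix (Fin k) (Fin k) K) (m : ℕ)
    (hA : ∀ j ≤ m, Reach ℓ E (OwnersKnow fun ω i => A ω i j)) :
    Reach ((m + 1) * ℓ + m * r) E (OwnersKnow fun ω i => chain (A ω i) 0 (m + 1)) := by
  induction m with
  | zero => simpa [chain_one] using hA 0 le_rfl
  | succ m ih =>
    have h1 := (ih fun j hj => hA j (hj.trans (Nat.le_succ m))).keep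
    have h2 : Reach ℓ (fun v ω ω' => E v ω ω' ∧
        OwnersKnow (n := n) (fun ω i => CongestedClique.chain (A ω i) 0 (m + 1)) v ω ω') _ :=
      ((hA (m + 1) le_rfl).mono (fun _ _ _ h => h.1) (fun _ _ _ _ h => h)).keep
    have h3 := H.reach (E := fun v ω ω' => (E v ω ω' ∧
        OwnersKnow (n := n) (fun ω i => CongestedClique.chain (A ω i) 0 (m + 1)) v ω ω') ∧
        OwnersKnow (n := n) (fun ω i => A ω i (m + 1)) v ω ω')
      (fun ω i => CongestedClique.chain (A ω i) 0 (m + 1)) (fun ω i => A ω i (m + 1))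
      (fun v i a b ho ω ω' h => Prod.ext_iff.2 ⟨h.1.2 i a b ho, h.2 i a b ho⟩)
    refine (((h1.trans h2).trans h3).mono (fun _ _ _ h => h) ?_).le (le_of_eq (by ring))
    intro v ω ω' _ h i a b ho
    have := h i a b ho
    simp only [chain_succ_right _ 0 (m + 1), Nat.zero_add]
    exact this

theorem Reach.exists_diag {n k s : ℕ} {Ω K : Type} [Field K] {E : Knowledge n Ω}
    (hs : 0 < s) (hsn : s ≤ n) (A : Ω → Fin s → Matrix (Fin k) (Fin k) K)
    (hA : ∀ v ω ω', E v ω ω' → OwnersKnow A v ω ω') :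
    Reach 1 E (fun _ ω ω' => (∃ i a, A ω i a a ≠ 0) = ∃ i a, A ω' i a a ≠ 0) := by
  refine (Reach.exists_bit (E := E) (fun v ω => ∃ i a, Owns n k s v i a a ∧ A ω i a a ≠ 0)
    fun v ω ω' h => ?_).mono (fun _ _ _ h => h) fun v ω ω' _ h => ?_
  · refine propext (exists_congr fun i => exists_congr fun a => and_congr_right fun ho => ?_)
    rw [hA v ω ω' h i a a ho]
  · have key : ∀ ω, (∃ v : Fin n, ∃ i a, Owns n k s v i a a ∧ A ω i a a ≠ 0) ↔ ∃ i a, A ω i a a ≠ 0 := by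
      intro ω
      constructor
      · rintro ⟨v, i, a, -, h⟩
        exact ⟨i, a, h⟩
      · rintro ⟨i, a, h⟩
        exact ⟨_, i, a, owns_owner hs hsn (i, a, a), h⟩
    rwa [key, key] at h

/-! ### The search for cycles in tuples of small classes -/

section Tuples

variable {n X : ℕ}

/-- The `a`-th node of the class `y`. -/
noncomputable def member (φ : Fin n → Fin X) (y : Fin X) (a : ℕ) : Option (Fin n) :=
  (Finset.univ.filter fun u => φ u = y).toList[a]?

theorem class_of_member {φ : Fin n → Fin X} {y : Fin X} {a : ℕ} {u : Fin n}
    (h : member φ y a = some u) : φ u = y := by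
  have := List.mem_of_getElem? h
  simpa using this

theorem member_injective {φ : Fin n → Fin X} {y : Fin X} {a b : ℕ} {u : Fin n}
    (ha : member φ y a = some u) (hb : member φ y b = some u) : a = b := by
  obtain ⟨h1, h2⟩ := List.getElem?_eq_some_iff.1 ha
  obtain ⟨h3, h4⟩ := List.getElem?_eq_some_iff.1 hb
  exact (List.Nodup.getElem_inj_iff (Finset.nodup_toList _)).1 (h2.trans h4.symm)

theorem exists_member {φ : Fin n → Fin X} {y : Fin X} {u : Fin n} (hu : φ u = y) {k : ℕ}
    (hk : Nat.card {u // φ u = y} ≤ k) : ∃ a : Fin k, member φ y a = some u := by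
  have hmem : u ∈ (Finset.univ.filter fun u => φ u = y).toList := by simpa using hu
  obtain ⟨a, ha, h⟩ := List.mem_iff_getElem.1 hmem
  rw [Nat.card_eq_fintype_card, Fintype.card_subtype] at hk
  rw [Finset.length_toList] at ha
  exact ⟨⟨a, ha.trans_le hk⟩, List.getElem?_eq_some_iff.2 ⟨_, h⟩⟩

variable {s h B : ℕ}

/-- The `i`-th tuple of classes does not contain a class that occurs too often. -/
def Live (h B : ℕ) (τ : Fin s → ℕ → Fin X) (i : Fin s) : Prop :=
  ∀ j < h, Nat.card {i' // τ i' j = τ i j} ≤ B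

open Classical in
/-- The adjacency matrix between the `j`-th and the `j + 1`-st class of the `i`-th tuple, where only
nodes of the colours `j` and `j + 1` (modulo `h`) are considered. -/
noncomputable def tupleMatrix (K : Type) [Field K] (k h B : ℕ) (c : Fin n → ℕ) (φ : Fin n → Fin X)
    (τ : Fin s → ℕ → Fin X) (adj : Fin n → Fin n → Prop) (i : Fin s) (j : ℕ) :
    Matrix (Fin k) (Fin k) K :=
  Matrix.of fun a b => if Live h B τ i ∧ ∃ u v, member φ (τ i j) a = some u ∧
    member φ (τ i ((j + 1) % h)) b = some v ∧ c u = j ∧ c v = (j + 1) % h ∧ adj u v then 1 else 0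

variable {K : Type} [Field K] {k : ℕ} {c : Fin n → ℕ} {φ : Fin n → Fin X} {τ : Fin s → ℕ → Fin X}
  {adj : Fin n → Fin n → Prop}

theorem tupleMatrix_ne_zero {i : Fin s} {j : ℕ} {a b : Fin k}
    (H : tupleMatrix K k h B c φ τ adj i j a b ≠ 0) : ∃ u v, member φ (τ i j) a = some u ∧
    member φ (τ i ((j + 1) % h)) b = some v ∧ c u = j ∧ c v = (j + 1) % h ∧ adj u v := by
  by_contra hno
  exact H (if_neg fun h => hno h.2)

/-- A closed walk along the tuple is a cycle. -/
theorem isCycleTuple_of_tuple_walk (hh : 0 < h) {i : Fin s} (f : ℕ → Fin k)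
    (hf : ∀ j < h, tupleMatrix K k h B c φ τ adj i j (f j) (f (j + 1)) ≠ 0) (hclose : f h = f 0) :
    ∃ g : ℕ → Fin n, (∀ j < h, member φ (τ i j) (f j) = some (g j)) ∧
      IsCycleTuple adj h (fun j => g j) := by
  have : Nonempty (Fin n) := (tupleMatrix_ne_zero (hf 0 hh)).nonempty
  choose! u v h1 h2 h3 h4 h5 using fun j (hj : j < h) => tupleMatrix_ne_zero (hf j hj)
  have hv : ∀ j < h, v j = u ((j + 1) % h) := by
    intro j hj
    have h6 := h1 ((j + 1) % h) (Nat.mod_lt _ hh)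
    have h7 : f (j + 1) = f ((j + 1) % h) := by
      rcases (Nat.succ_le_of_lt hj).eq_or_lt with hlt | hlt
      · have e : j + 1 = h := hlt
        rw [e, Nat.mod_self, hclose]
      · rw [Nat.mod_eq_of_lt hlt]
    have h8 := h2 j hj
    rw [h7, h6] at h8
    exact (Option.some.inj h8).symm
  refine ⟨fun j => u (j % h), fun j hj => ?_, ?_⟩
  · simp only [Nat.mod_eq_of_lt hj]
    exact h1 j hj
  · refine IsCycleTuple.of_walk (fun j => u (j % h)) c ?_ ?_ ?_
    · intro j hj
      rw [Nat.mod_eq_of_lt hj]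
      exact h3 j hj
    · intro j hj
      rw [Nat.mod_eq_of_lt hj, ← hv j hj]
      exact h5 j hj
    · simp

theorem exists_cycle_of_tuple (hh : 0 < h) {i : Fin s} {a : Fin k}
    (H : chain (tupleMatrix K k h B c φ τ adj i) 0 h a a ≠ 0) : ∃ v, IsCycleTuple adj h v := by
  obtain ⟨f, h1, h2, h3⟩ := exists_walk_of_chain_ne_zero _ H
  rw [Nat.zero_add] at h2
  obtain ⟨g, -, hg⟩ := isCycleTuple_of_tuple_walk hh f
    (fun j hj => h3 j (Nat.zero_le j) (by omega)) (h2.trans h1.symm)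
  exact ⟨_, hg⟩

/-- A cycle whose vertices have the right colours is found if in their classes there are no other
vertices of cycles. -/
theorem chain_tupleMatrix_eq_one (hh : 0 < h) {i : Fin s} (hlive : Live h B τ i) {v : ℕ → Fin n}
    (hv : ∀ j < h, adj (v j) (v ((j + 1) % h))) (hc : ∀ j < h, c (v j) = j) {f : ℕ → Fin k}
    (hf : ∀ j < h, member φ (τ i j) (f j) = some (v j))
    (huniq : ∀ u ∈ cycleVertices adj h, ∀ j < h, φ u = τ i j → u = v j) :
    chain (tupleMatrix K k h B c φ τ adj i) 0 h (f 0) (f 0) = 1 := by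
  have hone : ∀ j < h, tupleMatrix K k h B c φ τ adj i j (f j) (f ((j + 1) % h)) = 1 := by
    intro j hj
    have hm := Nat.mod_lt (j + 1) hh
    have : Live h B τ i ∧ ∃ u w, member φ (τ i j) (f j) = some u ∧
        member φ (τ i ((j + 1) % h)) (f ((j + 1) % h)) = some w ∧ c u = j ∧ c w = (j + 1) % h ∧
        adj u w := ⟨hlive, _, _, hf j hj, hf _ hm, hc j hj, hc _ hm, hv j hj⟩
    simp only [tupleMatrix, Matrix.of_apply, if_pos this]
  have main : ∀ m t, t + (m + 1) = h →
      chain (tupleMatrix K k h B c φ τ adj i) t (m + 1) (f t) (f 0) = 1 := by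
    intro m
    induction m with
    | zero =>
      intro t ht
      have h1 := hone t (by omega)
      rwa [show t + 1 = h from ht, Nat.mod_self, ← chain_one (tupleMatrix K k h B c φ τ adj i)] at h1
    | succ m ih =>
      intro t ht
      have h1 := hone t (by omega)
      rw [Nat.mod_eq_of_lt (by omega)] at h1
      rw [chain_succ_left, Matrix.mul_apply, Finset.sum_eq_single (f (t + 1)),
        ih (t + 1) (by omega), h1, one_mul]
      · intro b _ hb
        by_contra hne
        -- A contribution through another node `b` would close up, together with the beginning of
        -- `f`, to a cycle. Its vertex in the class at place `t + 1` must be `v (t + 1)` by `huniq`,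
        -- so that `b = f (t + 1)` after all.
        obtain ⟨g, hg1, hg2, hg3⟩ := exists_walk_of_chain_ne_zero _ (right_ne_zero_of_mul hne)
        rw [show t + 1 + (m + 1) = h by omega] at hg2
        obtain ⟨w, hw1, hw2⟩ := isCycleTuple_of_tuple_walk (K := K) (B := B) (c := c) (φ := φ)
          (τ := τ) (adj := adj) hh (i := i) (fun j => if j ≤ t then f j else g j) (by
            intro j hj
            by_cases hjt : j + 1 ≤ t
            · have := hone j hj
              rw [Nat.mod_eq_of_lt (by omega)] at this
              rw [if_pos (by omega), if_pos hjt, this]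
              exact one_ne_zero
            · rw [if_neg (by omega : ¬ j + 1 ≤ t)]
              by_cases hjt' : j = t
              · subst hjt'
                rw [if_pos le_rfl, hg1]
                exact left_ne_zero_of_mul hne
              · rw [if_neg (by omega)]
                exact hg3 j (by omega) (by omega)) (by
            rw [if_neg (by omega), if_pos (Nat.zero_le t), hg2])
        have hlt : t + 1 < h := by omega
        have h2 := hw1 (t + 1) hlt
        rw [if_neg (by omega), hg1] at h2
        have h3 : w (t + 1) = v (t + 1) :=
          huniq _ ⟨_, hw2, ⟨t + 1, hlt⟩, rfl⟩ (t + 1) hlt (class_of_member h2)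
        rw [h3] at h2
        exact hb (Fin.ext (member_injective h2 (hf _ hlt)))
      · simp
  obtain ⟨m, rfl⟩ := Nat.exists_eq_succ_of_ne_zero hh.ne'
  exact main m 0 (by omega)

/-- For each factor, a node sends its row in every live tuple that has its class at the place in
question: at most `B` tuples with `k` entries each. The restriction to `Live` tuples exists for this
bound. -/
theorem reach_tuples {κ L r : ℕ} (hs : 0 < s) (hsn : s ≤ n) (enc : K → Fin κ → Msg n)
    (henc : Function.Injective enc) (H : ProductSolvable K n k s r) (m : ℕ) (c : Fin n → ℕ)
    (φ : Fin n → Fin X) (τ : Fin s → ℕ → Fin X) (hL1 : (k / Nat.sqrt (n / s) + 1) ^ 2 ≤ L * n)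
    (hL2 : B * k ≤ L * n) :
    Reach (n := n) (Ω := Fin n → Fin n → Prop) ((m + 1) * (4 * (κ * L)) + m * r + 1)
      (fun v adj adj' => localView adj v = localView adj' v)
      (fun _ adj adj' =>
        (∃ i a, chain (tupleMatrix K k (m + 1) B c φ τ adj i) 0 (m + 1) a a ≠ 0) =
        ∃ i a, chain (tupleMatrix K k (m + 1) B c φ τ adj' i) 0 (m + 1) a a ≠ 0) := by
  classical
  have hload : ∀ j ≤ m, Reach (n := n) (Ω := Fin n → Fin n → Prop) (4 * (κ * L))
      (fun v adj adj' => localView adj v = localView adj' v)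
      (OwnersKnow fun adj i => tupleMatrix K k (m + 1) B c φ τ adj i j) := by
    intro j hj
    refine Reach.load hs hsn enc henc _ (fun x =>
      if Live (m + 1) B τ x.1 then member φ (τ x.1 j) x.2.1 else none) ?_ ?_ hL1 fun u => ?_
    · intro x hx adj adj'
      have h0 : ∀ adj, tupleMatrix K k (m + 1) B c φ τ adj x.1 j x.2.1 x.2.2 = 0 := by
        intro adj
        simp only [tupleMatrix, Matrix.of_apply]
        rw [if_neg]
        rintro ⟨hl, u, v, hu, -⟩
        rw [if_pos hl, hu] at hx
        simp at hx
      rw [h0, h0]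
    · intro x u hx adj adj' hadj
      have hl : Live (m + 1) B τ x.1 := by
        by_contra hl
        simp [hl] at hx
      rw [if_pos hl] at hx
      have h1 : ∀ v, adj u v ↔ adj' u v := fun v => Set.ext_iff.1 (Prod.ext_iff.1 hadj).1 v
      have h2 : ∀ adj₁ adj₂ : Fin n → Fin n → Prop, (∀ v, adj₁ u v → adj₂ u v) →
          (Live (m + 1) B τ x.1 ∧ ∃ u v, member φ (τ x.1 j) x.2.1 = some u ∧
            member φ (τ x.1 ((j + 1) % (m + 1))) x.2.2 = some v ∧ c u = j ∧
            c v = (j + 1) % (m + 1) ∧ adj₁ u v) →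
          (Live (m + 1) B τ x.1 ∧ ∃ u v, member φ (τ x.1 j) x.2.1 = some u ∧
            member φ (τ x.1 ((j + 1) % (m + 1))) x.2.2 = some v ∧ c u = j ∧
            c v = (j + 1) % (m + 1) ∧ adj₂ u v) := by
        rintro adj₁ adj₂ h12 ⟨hl, u', v', h3, h4, h5, h6, h7⟩
        have : u = u' := Option.some.inj (hx.symm.trans h3)
        subst this
        exact ⟨hl, u, v', h3, h4, h5, h6, h12 _ h7⟩
      exact if_congr ⟨h2 adj adj' fun v => (h1 v).1, h2 adj' adj fun v => (h1 v).2⟩ rfl rfl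
    · have hx : ∀ x : {x : Fin s × Fin k × Fin k //
          (if Live (m + 1) B τ x.1 then member φ (τ x.1 j) x.2.1 else none) = some u},
          Live (m + 1) B τ x.1.1 ∧ member φ (τ x.1.1 j) x.1.2.1 = some u := by
        rintro ⟨x, hx⟩
        split_ifs at hx with hl
        exact ⟨hl, hx⟩
      rcases isEmpty_or_nonempty {x : Fin s × Fin k × Fin k //
          (if Live (m + 1) B τ x.1 then member φ (τ x.1 j) x.2.1 else none) = some u} with he | ⟨⟨y⟩⟩
      · rw [Nat.card_of_isEmpty]
        exact Nat.zero_le _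
      · refine le_trans (Nat.card_le_card_of_injective
          (β := {i' // τ i' j = τ y.1.1 j} × Fin k) (fun x => (⟨x.1.1, ?_⟩, x.1.2.2)) ?_) ?_
        · rw [← class_of_member (hx x).2, ← class_of_member (hx y).2]
        · rintro ⟨⟨i, a, b⟩, h⟩ ⟨⟨i', a', b'⟩, h'⟩ he
          simp only [Prod.mk.injEq, Subtype.mk.injEq] at he
          obtain ⟨rfl, rfl⟩ := he
          have h1 := (hx ⟨_, h⟩).2
          have h2 := (hx ⟨_, h'⟩).2
          have := Fin.ext (member_injective h1 h2)
          simp only at this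
          subst this
          rfl
        · rw [Nat.card_prod, Nat.card_fin]
          exact (Nat.mul_le_mul_right _ ((hx y).1 j (by omega))).trans hL2
  have h1 := Reach.chain H (fun adj i j => tupleMatrix K k (m + 1) B c φ τ adj i j) m hload
  exact h1.trans (Reach.exists_diag hs hsn _ fun _ _ _ h => h)

end Tuples

/-! ### The search for cycles through given nodes -/

theorem sum_eq_sum_blocks {K : Type} [Field K] {n X k : ℕ} (hn : n ≤ X * k) (f : Fin n → K) :
    ∑ u, f u = ∑ a : Fin X, ∑ r : Fin k, if h : r + k * a < n then f ⟨r + k * a, h⟩ else 0 := by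
  let F : ℕ → K := fun c => if h : c < n then f ⟨c, h⟩ else 0
  have h1 := Equiv.sum_comp finProdFinEquiv (fun c : Fin (X * k) => F c)
  simp only [finProdFinEquiv_apply_val] at h1
  rw [Fintype.sum_prod_type, Fin.sum_univ_eq_sum_range F,
    ← Finset.sum_subset (Finset.range_subset_range.2 hn), ← Fin.sum_univ_eq_sum_range F] at h1
  · rw [h1]
    exact Finset.sum_congr rfl fun c _ => by simp [F]
  · intro c _ hc
    have : ¬ c < n := by simpa using hc
    simp [F, this]

section Rows

variable {n k X κ L r : ℕ} {K Ω : Type} [Field K]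

/-- The two block indices of an instance. -/
def blockIndex (i : Fin (X * X)) : Fin X × Fin X := finProdFinEquiv.symm i

/-- The global index `u` determines the selected block and the position in it; only the other block
and the other position remain free. -/
theorem card_block_le (sel : Fin X × Fin X → Fin X) (oth : Fin X × Fin X → Fin X)
    (hsel : ∀ p p', sel p = sel p' → oth p = oth p' → p = p')
    (pos oth' : Fin k × Fin k → Fin k)
    (hpos : ∀ p p', pos p = pos p' → oth' p = oth' p' → p = p') (u : ℕ) :
    Nat.card {x : Fin (X * X) × Fin k × Fin k //
      (pos x.2).val + k * (sel (blockIndex x.1)).val = u} ≤ X * k := by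
  refine (Nat.card_le_card_of_injective (β := Fin X × Fin k)
    (fun x => (oth (blockIndex x.1.1), oth' x.1.2)) ?_).trans (by simp)
  rintro ⟨⟨i, p⟩, h⟩ ⟨⟨i', p'⟩, h'⟩ he
  simp only [Prod.mk.injEq] at he
  have h1 : (pos p).val + k * (sel (blockIndex i)).val =
      (pos p').val + k * (sel (blockIndex i')).val := h.trans h'.symm
  have h3 : (finProdFinEquiv (sel (blockIndex i), pos p) : Fin (X * k)) =
      finProdFinEquiv (sel (blockIndex i'), pos p') := Fin.ext (by simpa using h1)
  have h2 := finProdFinEquiv.injective h3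
  simp only [Prod.mk.injEq] at h2
  have h4 : i = i' := finProdFinEquiv.symm.injective (hsel _ _ h2.1 he.1)
  have h5 := hpos p p' h2.2 he.2
  subst h4 h5
  rfl

/-- Node `v` holds column `v` of the `k × n` matrix `P` and row `v` of `M`. Cutting `P` into `X`
blocks and `M` into `X * X` blocks gives `X * X` products of `k × k` matrices; each node adds up the
`X` contributions to its column of the result. -/
theorem reach_rows (hX : 0 < X * X) (hXn : X * X ≤ n) (hkX : n ≤ X * k) (enc : K → Fin κ → Msg n)
    (henc : Function.Injective enc) (H : ProductSolvable K n k (X * X) r)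
    (hL1 : (k / Nat.sqrt (n / (X * X)) + 1) ^ 2 ≤ L * n) (hL2 : X * k ≤ L * n)
    {E : Knowledge n Ω} (P : Ω → Fin k → Fin n → K) (M : Ω → Matrix (Fin n) (Fin n) K)
    (hP : ∀ v i, Knows (E v) fun ω => P ω i v) (hM : ∀ u v, Knows (E u) fun ω => M ω u v) :
    Reach (12 * (κ * L) + r) E
      (fun v ω ω' => ∀ i, ∑ u, P ω i u * M ω u v = ∑ u, P ω' i u * M ω' u v) := by
  classical
  let S : Ω → Fin (X * X) → Matrix (Fin k) (Fin k) K := fun ω i => Matrix.of fun a b =>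
    if h : b.val + k * (blockIndex i).1 < n then P ω a ⟨_, h⟩ else 0
  let T : Ω → Fin (X * X) → Matrix (Fin k) (Fin k) K := fun ω i => Matrix.of fun a b =>
    if h : a.val + k * (blockIndex i).1 < n ∧ b.val + k * (blockIndex i).2 < n then
      M ω ⟨_, h.1⟩ ⟨_, h.2⟩ else 0
  have hcard : ∀ (e : Fin (X * X) × Fin k × Fin k → ℕ) (u : Fin n),
      Nat.card {x // e x = u.val} ≤ X * k →
      Nat.card {x // (if h : e x < n then some (⟨_, h⟩ : Fin n) else none) = some u} ≤ L * n := by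
    intro e u he
    have hx : ∀ x : {x // (if h : e x < n then some (⟨_, h⟩ : Fin n) else none) = some u},
        e x = u.val := by
      rintro ⟨x, hx⟩
      split_ifs at hx with h
      exact congrArg Fin.val (Option.some.inj hx)
    refine (Nat.card_le_card_of_injective (fun x => (⟨x.1, hx x⟩ : {x // e x = u.val})) ?_).trans
      (he.trans hL2)
    intro x y hxy
    exact Subtype.ext (Subtype.ext_iff.1 hxy :)
  have loadS : Reach (4 * (κ * L)) E (OwnersKnow S) := by
    refine Reach.load hX hXn enc henc S (fun x =>
      if h : x.2.2.val + k * (blockIndex x.1).1 < n then some ⟨_, h⟩ else none) ?_ ?_ hL1 ?_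
    · intro x hx ω ω'
      simp only [dite_eq_right_iff, reduceCtorEq, imp_false] at hx
      simp [S, hx]
    · intro x u hx ω ω' h
      split_ifs at hx with hlt
      simp only [S, Matrix.of_apply, dif_pos hlt, Option.some.inj hx]
      exact hP u _ ω ω' h
    · exact fun u => hcard _ u (card_block_le Prod.fst Prod.snd (fun p p' => Prod.ext) Prod.snd
        Prod.fst (fun p p' h h' => Prod.ext h' h) u)
  have loadT : Reach (4 * (κ * L)) E (OwnersKnow T) := by
    refine Reach.load hX hXn enc henc T (fun x =>
      if h : x.2.1.val + k * (blockIndex x.1).1 < n then some ⟨_, h⟩ else none) ?_ ?_ hL1 ?_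
    · intro x hx ω ω'
      simp only [dite_eq_right_iff, reduceCtorEq, imp_false] at hx
      simp [T, hx]
    · intro x u hx ω ω' h
      split_ifs at hx with hlt
      simp only [T, Matrix.of_apply]
      split_ifs with hlt'
      · simp only [Option.some.inj hx]
        exact hM u _ ω ω' h
      · rfl
    · exact fun u => hcard _ u (card_block_le Prod.fst Prod.snd (fun p p' => Prod.ext) Prod.fst
        Prod.snd (fun p p' => Prod.ext) u)
  have hmul := H.reach (E := fun v ω ω' => OwnersKnow (n := n) S v ω ω' ∧ OwnersKnow (n := n) T v ω ω')
    S T (fun v i a b ho ω ω' h => Prod.ext_iff.2 ⟨h.1 i a b ho, h.2 i a b ho⟩)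
  have hload : Reach (4 * (κ * L) + 4 * (κ * L)) E
      (fun v ω ω' => OwnersKnow (n := n) S v ω ω' ∧ OwnersKnow (n := n) T v ω ω') := by
    refine loadS.keep.trans (loadT.mono (fun _ _ _ h => h.1) fun v ω ω' h h' => ⟨h.2, h'⟩)
  have hback := Reach.route (M := {x : Fin (X * X) × Fin k × Fin k //
      x.2.2.val + k * (blockIndex x.1).2 < n}) enc henc L
    (E := fun v ω ω' => ∀ i a b, Owns n k (X * X) v i a b →
      (S ω i * T ω i) a b = (S ω' i * T ω' i) a b)
    (fun x => owner hX hXn x.1) (fun x => ⟨_, x.2⟩)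
    (fun x ω => (S ω x.1.1 * T ω x.1.1) x.1.2.1 x.1.2.2)
    (fun x ω ω' h => h _ _ _ (owns_owner hX hXn x.1)) (fun v => by
      refine (Nat.card_le_card_of_injective
        (fun x => (⟨x.1.1, x.2⟩ : {x // owner hX hXn x = v})) ?_).trans
        ((card_owner_eq_le hX hXn v).trans hL1)
      intro x y hxy
      exact Subtype.ext (Subtype.ext (Subtype.ext_iff.1 hxy :))) (fun v => by
      refine (Nat.card_le_card_of_injective (fun x => (⟨x.1.1, congrArg Fin.val x.2⟩ :
        {x : Fin (X * X) × Fin k × Fin k // x.2.2.val + k * (blockIndex x.1).2.val = v.val})) ?_).trans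
        ((card_block_le Prod.snd Prod.fst (fun p p' h h' => Prod.ext h' h) Prod.snd Prod.fst
          (fun p p' h h' => Prod.ext h' h) v).trans hL2)
      intro x y hxy
      exact Subtype.ext (Subtype.ext (Subtype.ext_iff.1 hxy :)))
  refine (((hload.trans hmul).trans hback).mono (fun _ _ _ h => h) ?_).le (le_of_eq (by ring))
  intro v ω ω' _ h i
  have hk : 0 < k := by
    rcases Nat.eq_zero_or_pos k with rfl | hk
    · exact absurd v.isLt (by omega)
    · exact hk
  obtain ⟨⟨b, c⟩, hbc⟩ := finProdFinEquiv.surjective (Fin.castLE hkX v)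
  have hv : c.val + k * b.val = v.val := by
    have := congrArg Fin.val hbc
    simpa using this
  have key : ∀ ω, ∑ u, P ω i u * M ω u v =
      ∑ a : Fin X, (S ω (finProdFinEquiv (a, b)) * T ω (finProdFinEquiv (a, b))) i c := by
    intro ω
    rw [sum_eq_sum_blocks hkX]
    refine Finset.sum_congr rfl fun a _ => ?_
    rw [Matrix.mul_apply]
    refine Finset.sum_congr rfl fun d _ => ?_
    simp only [S, T, Matrix.of_apply, blockIndex, Equiv.symm_apply_apply, hv]
    by_cases hd : d.val + k * a.val < n
    · simp [hd]
    · simp [hd]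
  rw [key, key]
  refine Finset.sum_congr rfl fun a _ => ?_
  have hlt : c.val + k * (blockIndex (finProdFinEquiv (a, b) : Fin (X * X))).2.val < n := by
    simp only [blockIndex, Equiv.symm_apply_apply, hv]
    exact v.isLt
  refine h ⟨(finProdFinEquiv (a, b), i, c), hlt⟩ (Fin.ext ?_)
  simp only [blockIndex, Equiv.symm_apply_apply, hv]

open Classical in
/-- The adjacency matrix from the nodes of colour `j` to those of colour `j + 1` (modulo `h`). -/
noncomputable def colorMatrix (K : Type) [Field K] (h : ℕ) (c : Fin n → ℕ)
    (adj : Fin n → Fin n → Prop) (j : ℕ) : Matrix (Fin n) (Fin n) K :=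
  Matrix.of fun u v => if c u = j ∧ c v = (j + 1) % h ∧ adj u v then 1 else 0

theorem exists_cycle_of_color {h : ℕ} {c : Fin n → ℕ} {adj : Fin n → Fin n → Prop}
    {u : Fin n} (H : chain (colorMatrix K h c adj) 0 h u u ≠ 0) : ∃ v, IsCycleTuple adj h v := by
  obtain ⟨f, h1, h2, h3⟩ := exists_walk_of_chain_ne_zero _ H
  have h4 : ∀ j < h, c (f j) = j ∧ c (f (j + 1)) = (j + 1) % h ∧ adj (f j) (f (j + 1)) := by
    intro j hj
    by_contra hno
    exact h3 j (Nat.zero_le j) (by omega) (if_neg hno)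
  rw [Nat.zero_add] at h2
  exact ⟨_, IsCycleTuple.of_walk f c (fun j hj => (h4 j hj).1) (fun j hj => (h4 j hj).2.2)
    (h2.trans h1.symm)⟩

/-- The rows at the start nodes are extended colour by colour, with `m` multiplications. The
diagonal entry at `w i` ends up at the node `w i` itself, so a single bit remains to be announced.
-/
theorem reach_through (hX : 0 < X * X) (hXn : X * X ≤ n) (hkX : n ≤ X * k)
    (enc : K → Fin κ → Msg n)
    (henc : Function.Injective enc) (H : ProductSolvable K n k (X * X) r)
    (hL1 : (k / Nat.sqrt (n / (X * X)) + 1) ^ 2 ≤ L * n) (hL2 : X * k ≤ L * n) (m : ℕ)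
    (c : Fin n → ℕ) (w : Fin k → Fin n) :
    Reach (n := n) (Ω := Fin n → Fin n → Prop) (m * (12 * (κ * L) + r) + 1)
      (fun v adj adj' => localView adj v = localView adj' v)
      (fun _ adj adj' =>
        (∃ i, chain (colorMatrix K (m + 1) c adj) 0 (m + 1) (w i) (w i) ≠ 0) =
        ∃ i, chain (colorMatrix K (m + 1) c adj') 0 (m + 1) (w i) (w i) ≠ 0) := by
  classical
  have hview : ∀ {v : Fin n} {adj adj' : Fin n → Fin n → Prop}, localView adj v = localView adj' v →
      ∀ u, (adj v u ↔ adj' v u) ∧ (adj u v ↔ adj' u v) := fun h u =>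
    ⟨Set.ext_iff.1 (Prod.ext_iff.1 h).1 u, Set.ext_iff.1 (Prod.ext_iff.1 h).2 u⟩
  have hrows : ∀ t, Reach (n := n) (Ω := Fin n → Fin n → Prop) (t * (12 * (κ * L) + r))
      (fun v adj adj' => localView adj v = localView adj' v)
      (fun v adj adj' => ∀ i, chain (colorMatrix K (m + 1) c adj) 0 (t + 1) (w i) v =
        chain (colorMatrix K (m + 1) c adj') 0 (t + 1) (w i) v) := by
    intro t
    induction t with
    | zero =>
      rw [Nat.zero_mul]
      -- The initial rows are stored by columns and cost nothing: `v` sees the entry in row `w i`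
      -- from its in-neighbours.
      refine .done fun v adj adj' h i => ?_
      simp only [Nat.zero_add, chain_one, colorMatrix, Matrix.of_apply, (hview h _).2]
    | succ t ih =>
      have h1 := reach_rows hX hXn hkX enc henc H hL1 hL2
        (E := fun v (adj adj' : Fin n → Fin n → Prop) => localView adj v = localView adj' v ∧
          ∀ i, chain (colorMatrix K (m + 1) c adj) 0 (t + 1) (w i) v =
            chain (colorMatrix K (m + 1) c adj') 0 (t + 1) (w i) v)
        (fun adj i u => chain (colorMatrix K (m + 1) c adj) 0 (t + 1) (w i) u)
        (fun adj => colorMatrix K (m + 1) c adj (t + 1)) (fun v i adj adj' h => h.2 i)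
        (fun u v adj adj' h => by
          simp only [colorMatrix, Matrix.of_apply, (hview h.1 _).1])
      refine ((ih.then_keep h1).mono (fun _ _ _ h => h) ?_).le (le_of_eq (by ring))
      intro v adj adj' _ h i
      rw [chain_succ_right _ 0 (t + 1), chain_succ_right _ 0 (t + 1), Matrix.mul_apply,
        Matrix.mul_apply, Nat.zero_add]
      exact h i
  refine (hrows m).trans ((Reach.exists_bit
    (fun v adj => ∃ i, w i = v ∧ chain (colorMatrix K (m + 1) c adj) 0 (m + 1) (w i) v ≠ 0)
    fun v adj adj' h => ?_).mono (fun _ _ _ h => h) fun v adj adj' _ h => ?_)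
  · refine propext (exists_congr fun i => and_congr_right fun _ => ?_)
    rw [h i]
  · have key : ∀ adj, (∃ v, ∃ i, w i = v ∧ chain (colorMatrix K (m + 1) c adj) 0 (m + 1) (w i) v ≠ 0) ↔
        ∃ i, chain (colorMatrix K (m + 1) c adj) 0 (m + 1) (w i) (w i) ≠ 0 := by
      intro adj
      constructor
      · rintro ⟨v, i, rfl, h⟩
        exact ⟨i, h⟩
      · rintro ⟨i, h⟩
        exact ⟨_, i, rfl, h⟩
    rwa [key, key] at h

end Rows

/-! ### Estimates of probabilities -/

open Classical in
theorem pr_eq_sum {A : Type} [Fintype A] (E : A → Prop) :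
    pr E = (∑ a, if E a then (1 : ℝ) else 0) / Nat.card A := by
  rw [pr, Nat.card_eq_fintype_card (α := {a // E a}), Fintype.card_subtype, Finset.sum_boole]

theorem pr_union {A I : Type} [Finite A] [Fintype I] (E : I → A → Prop) :
    pr (fun a => ∃ i, E i a) ≤ ∑ i, pr (E i) := by
  classical
  have := Fintype.ofFinite A
  simp only [pr_eq_sum]
  rw [← Finset.sum_div, Finset.sum_comm]
  refine div_le_div_of_nonneg_right (Finset.sum_le_sum fun a _ => ?_) (Nat.cast_nonneg _)
  split_ifs with h
  · obtain ⟨i, hi⟩ := h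
    calc (1 : ℝ) = if E i a then 1 else 0 := by rw [if_pos hi]
      _ ≤ _ := Finset.single_le_sum (f := fun i => if E i a then (1 : ℝ) else 0)
        (fun i _ => by split_ifs <;> norm_num) (Finset.mem_univ i)
  · exact Finset.sum_nonneg fun i _ => by split_ifs <;> norm_num

theorem pr_or_le {A : Type} [Finite A] (E F : A → Prop) :
    pr (fun a => E a ∨ F a) ≤ pr E + pr F := by
  have := pr_union (fun (b : Bool) a => if b then E a else F a)
  simpa [or_comm] using this

theorem sum_pr_le_of_disjoint {A I : Type} [Finite A] [Fintype I] (E : I → A → Prop) (F : A → Prop)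
    (hF : ∀ i a, E i a → F a) (hE : ∀ i i' a, E i a → E i' a → i = i') :
    ∑ i, pr (E i) ≤ pr F := by
  classical
  have := Fintype.ofFinite A
  simp only [pr_eq_sum]
  rw [← Finset.sum_div, Finset.sum_comm]
  refine div_le_div_of_nonneg_right (Finset.sum_le_sum fun a _ => ?_) (Nat.cast_nonneg _)
  by_cases h : ∃ i, E i a
  · obtain ⟨i, hi⟩ := h
    rw [if_pos (hF i a hi), Finset.sum_eq_single i, if_pos hi]
    · exact fun i' _ hne => if_neg fun hi' => hne (hE _ _ _ hi' hi)
    · simp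
  · rw [Finset.sum_eq_zero]
    · split_ifs <;> norm_num
    · exact fun i _ => if_neg fun hi => h ⟨i, hi⟩

/-- Markov's inequality for the number of events that occur. -/
theorem pr_markov {A I : Type} [Finite A] [Fintype I] (E : I → A → Prop) (B : ℕ) :
    pr (fun a => B ≤ Nat.card {i // E i a}) * B ≤ ∑ i, pr (E i) := by
  classical
  have := Fintype.ofFinite A
  simp only [pr_eq_sum]
  rw [← Finset.sum_div, Finset.sum_comm, div_mul_eq_mul_div, Finset.sum_mul]
  refine div_le_div_of_nonneg_right (Finset.sum_le_sum fun a _ => ?_) (Nat.cast_nonneg _)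
  rw [Finset.sum_boole, ← Fintype.card_subtype, ← Nat.card_eq_fintype_card]
  split_ifs with h
  · rw [one_mul]
    exact_mod_cast h
  · rw [zero_mul]
    positivity

theorem pr_prod_eq_sum {A B : Type} [Fintype A] [Finite B] (E : A × B → Prop) :
    pr E = (∑ a, pr fun b => E (a, b)) / Nat.card A := by
  classical
  have := Fintype.ofFinite B
  simp only [pr_eq_sum]
  rw [← Finset.sum_div, Fintype.sum_prod_type, Nat.card_prod, div_div]
  push_cast
  rw [mul_comm (Nat.card A : ℝ)]

theorem pr_mul_le_pr {A B : Type} [Finite A] [Finite B] {E : A × B → Prop} {G : A → Prop}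
    {q : ℝ} (h : ∀ a, G a → q ≤ pr fun b => E (a, b)) : pr G * q ≤ pr E := by
  classical
  have := Fintype.ofFinite A
  rw [pr_prod_eq_sum, pr_eq_sum, div_mul_eq_mul_div, Finset.sum_mul]
  refine div_le_div_of_nonneg_right (Finset.sum_le_sum fun a _ => ?_) (Nat.cast_nonneg _)
  split_ifs with ha
  · rw [one_mul]
    exact h a ha
  · rw [zero_mul]
    exact pr_nonneg _

theorem pr_eq_one_div {B : Type} (b : B) : pr (fun x => x = b) = 1 / Nat.card B := by
  rw [pr, Nat.card_unique]
  simp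

theorem pr_snd {A B : Type} [Finite A] [Finite B] [Nonempty A] (E : B → Prop) :
    pr (fun x : A × B => E x.2) = pr E := by
  have := pr_prod (fun _ : A => True) E
  rw [pr_true, one_mul] at this
  simpa using this

/-- Drawing some coordinates of a random function anew does not change its distribution. -/
theorem pr_resample {V B ι : Type} [Finite V] [Finite ι] [Finite B] [Nonempty B] {v : ι → V}
    (hv : Function.Injective v) (E : (V → B) → Prop) :
    pr (fun p : (V → B) × (ι → B) => E (Function.extend v p.2 p.1)) = pr E := by
  have key : ∀ p : (V → B) × (ι → B),
      (Function.extend v (p.1 ∘ v) (Function.extend v p.2 p.1),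
        Function.extend v p.2 p.1 ∘ v) = p := by
    rintro ⟨φ, g⟩
    refine Prod.ext (funext fun x => ?_) (funext fun i => hv.extend_apply _ _ i)
    by_cases hx : ∃ i, v i = x
    · obtain ⟨i, rfl⟩ := hx
      exact hv.extend_apply _ _ i
    · exact (Function.extend_apply' _ _ _ hx).trans (Function.extend_apply' _ _ _ hx)
  -- Exchanging the values on the range of `v` with the fresh ones is an involution, hence preserves
  -- the uniform distribution.
  have h := pr_equiv (A := (V → B) × (ι → B)) (B := (V → B) × (ι → B))
    { toFun := fun p => (Function.extend v p.2 p.1, p.1 ∘ v)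
      invFun := fun p => (Function.extend v p.2 p.1, p.1 ∘ v)
      left_inv := key
      right_inv := key } (fun p => E p.1)
  rw [pr_fst] at h
  exact h

theorem pr_comp_injective {V B ι : Type} [Finite V] [Finite ι] [Finite B] [Nonempty B] {v : ι → V}
    (hv : Function.Injective v) (E : (ι → B) → Prop) :
    pr (fun φ : V → B => E (φ ∘ v)) = pr E := by
  refine (pr_resample hv _).symm.trans (Eq.trans ?_ (pr_snd (A := V → B) E))
  congr 1
  funext p
  have : Function.extend v p.2 p.1 ∘ v = p.2 := funext fun i => hv.extend_apply _ _ i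
  rw [this]

theorem pr_eq_of_ne {V B : Type} [Finite V] [Finite B] [Nonempty B] {u v : V} (h : u ≠ v) :
    pr (fun φ : V → B => φ u = φ v) = 1 / Nat.card B := by
  have hinj : Function.Injective (![u, v] : Fin 2 → V) := by
    intro i j hij
    fin_cases i <;> fin_cases j <;> simp_all
  have h1 := pr_comp_injective (B := B) hinj fun g => g 0 = g 1
  refine h1.trans ?_
  have h2 := pr_equiv (finTwoArrowEquiv B) (fun p => p.1 = p.2)
  refine h2.trans ?_
  have := Fintype.ofFinite B
  have h0 : (Nat.card B : ℝ) ≠ 0 := by exact_mod_cast Nat.card_pos.ne'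
  rw [pr_prod_eq_sum]
  have h3 : ∀ a : B, pr (fun b => a = b) = 1 / Nat.card B := fun a => by
    rw [← pr_eq_one_div a]
    congr 1
    funext b
    exact propext eq_comm
  simp only [h3, Finset.sum_const, Finset.card_univ, nsmul_eq_mul, ← Nat.card_eq_fintype_card]
  field_simp

section TupleProbability

variable {n h X s k B : ℕ}

/-- A tuple `y` of classes is good at the place `i`: it occurs there, none of its classes occurs
too often, and no other tuple belongs to the set `Y`. -/
def GoodAt (B : ℕ) (Y : (Fin h → Fin X) → Prop) (y : Fin h → Fin X) (i : Fin s)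
    (τ : Fin s → Fin h → Fin X) : Prop :=
  τ i = y ∧ (∀ j, Nat.card {i' // τ i' j = τ i j} ≤ B) ∧ ∀ i', i' ≠ i → ¬ Y (τ i')

/-- The `i`-th tuple is drawn anew, independently of the rest, and equals `y` with probability `1 /
X ^ h`. The two bad events depend on the old tuples only and have probability at most `1 / 4` each,
by Markov's inequality and by the union bound. -/
theorem pr_goodAt_ge (hX : 0 < X) (Y : (Fin h → Fin X) → Prop) (y : Fin h → Fin X) (i : Fin s)
    (hB : (h : ℝ) * s ≤ X * B / 4)
    (hY : (s : ℝ) * Nat.card {y // Y y} ≤ (X : ℝ) ^ h / 4) :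
    1 / (X : ℝ) ^ h * (1 / 2) ≤ pr (GoodAt B Y y i) := by
  have : Nonempty (Fin X) := ⟨⟨0, hX⟩⟩
  have hX0 : (0 : ℝ) < X := by exact_mod_cast hX
  have hres := pr_resample (V := Fin s) (B := Fin h → Fin X) (ι := Unit) (v := fun _ => i)
    (fun _ _ _ => rfl) (GoodAt B Y y i)
  rw [← hres]
  have hext : ∀ (τ : Fin s → Fin h → Fin X) (g : Unit → Fin h → Fin X),
      Function.extend (fun _ => i) g τ i = g () ∧
        ∀ i', i' ≠ i → Function.extend (fun _ => i) g τ i' = τ i' := by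
    intro τ g
    refine ⟨?_, fun i' hi' => ?_⟩
    · exact Function.Injective.extend_apply (f := fun _ : Unit => i) (fun _ _ _ => rfl) g τ ()
    · exact Function.extend_apply' _ _ _ fun ⟨_, e⟩ => hi' e.symm
  -- the events that may prevent `y` from being good
  let bad₁ : (Fin s → Fin h → Fin X) → Prop := fun τ =>
    ∃ j, B ≤ Nat.card {i' // i' ≠ i ∧ τ i' j = y j}
  let bad₂ : (Fin s → Fin h → Fin X) → Prop := fun τ => ∃ i', Y (τ i')
  have h1 : pr bad₁ ≤ 1 / 4 := by
    refine (pr_union _).trans ?_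
    have hone : ∀ j : Fin h, pr (fun τ : Fin s → Fin h → Fin X =>
        B ≤ Nat.card {i' // i' ≠ i ∧ τ i' j = y j}) * B ≤ s / X := by
      intro j
      refine (pr_markov (fun i' (τ : Fin s → Fin h → Fin X) => i' ≠ i ∧ τ i' j = y j) B).trans ?_
      have : ∀ i' : Fin s, pr (fun τ : Fin s → Fin h → Fin X => i' ≠ i ∧ τ i' j = y j) ≤ 1 / X := by
        intro i'
        refine (pr_mono fun τ hτ => hτ.2).trans (le_of_eq ?_)
        have e1 := pr_eval (ι := Fin s) (B := fun _ => Fin h → Fin X) i' (fun x => x j = y j)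
        have e2 := pr_eval (ι := Fin h) (B := fun _ => Fin X) j (fun x => x = y j)
        rw [e1, e2, pr_eq_one_div, Nat.card_fin]
      refine (Finset.sum_le_sum fun i' _ => this i').trans (le_of_eq ?_)
      simp [div_eq_mul_inv]
    rcases Nat.eq_zero_or_pos B with rfl | hB0
    · have hs : (0 : ℝ) < s := by exact_mod_cast Fin.pos i
      have : (h : ℝ) = 0 := by
        simp only [Nat.cast_zero, mul_zero, zero_div] at hB
        have h0 : (0 : ℝ) ≤ h := by positivity
        nlinarith
      have : h = 0 := by exact_mod_cast this
      subst this
      simp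
    · have hB0' : (0 : ℝ) < B := by exact_mod_cast hB0
      calc _ ≤ ∑ _j : Fin h, (s : ℝ) / X / B :=
            Finset.sum_le_sum fun j _ => (le_div_iff₀ hB0').2 (hone j)
        _ = h * s / (X * B) := by
            rw [Finset.sum_const, Finset.card_univ, Fintype.card_fin, nsmul_eq_mul]
            field_simp
        _ ≤ 1 / 4 := by
            rw [div_le_div_iff₀ (by positivity) (by norm_num)]
            linarith
  have h2 : pr bad₂ ≤ 1 / 4 := by
    refine (pr_union _).trans ?_
    have : ∀ i' : Fin s, pr (fun τ : Fin s → Fin h → Fin X => Y (τ i')) =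
        Nat.card {y // Y y} / (X : ℝ) ^ h := by
      intro i'
      have e1 := pr_eval (ι := Fin s) (B := fun _ => Fin h → Fin X) i' Y
      rw [e1, pr, Nat.card_fun, Nat.card_fin, Nat.card_fin]
      push_cast
      rfl
    rw [Finset.sum_congr rfl fun i' _ => this i', Finset.sum_const, Finset.card_univ,
      Fintype.card_fin, nsmul_eq_mul, ← mul_div_assoc, div_le_div_iff₀ (by positivity) (by norm_num)]
    linarith
  have h3 : 1 / 2 ≤ pr fun τ => ¬ (bad₁ τ ∨ bad₂ τ) := by
    rw [pr_not]
    have := pr_or_le bad₁ bad₂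
    linarith
  have h4 : pr (fun g : Unit → Fin h → Fin X => g () = y) = 1 / (X : ℝ) ^ h := by
    have e1 := pr_eval (ι := Unit) (B := fun _ => Fin h → Fin X) () (fun x => x = y)
    rw [e1, pr_eq_one_div, Nat.card_fun, Nat.card_fin, Nat.card_fin]
    push_cast
    rfl
  have h5 := pr_prod (fun τ => ¬ (bad₁ τ ∨ bad₂ τ)) (fun g : Unit → Fin h → Fin X => g () = y)
  rw [h4] at h5
  calc 1 / (X : ℝ) ^ h * (1 / 2) ≤ pr (fun τ => ¬ (bad₁ τ ∨ bad₂ τ)) * (1 / (X : ℝ) ^ h) := by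
        rw [mul_comm]
        exact mul_le_mul_of_nonneg_right h3 (by positivity)
    _ = _ := h5.symm
    _ ≤ _ := by
        refine pr_mono ?_
        rintro ⟨τ, g⟩ ⟨hτ, hg⟩
        simp only [not_or, bad₁, bad₂, not_exists, not_le] at hτ
        change g () = y at hg
        change GoodAt B Y y i (Function.extend (fun _ => i) g τ)
        obtain ⟨e1, e2⟩ := hext τ g
        refine ⟨e1.trans hg, fun j => ?_, fun i' hi' => ?_⟩
        · have h6 := hτ.1 j
          classical
          rw [Nat.card_eq_fintype_card, Fintype.card_subtype] at h6 ⊢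
          have h7 : (Finset.univ.filter fun i' => Function.extend (fun _ : Unit => i) g τ i' j =
              Function.extend (fun _ : Unit => i) g τ i j) ⊆
              insert i (Finset.univ.filter fun i' => i' ≠ i ∧ τ i' j = y j) := by
            intro i' hi'
            rw [Finset.mem_filter, e1, hg] at hi'
            rw [Finset.mem_insert, Finset.mem_filter]
            by_cases hne : i' = i
            · exact .inl hne
            · refine .inr ⟨Finset.mem_univ _, hne, ?_⟩
              rw [← e2 i' hne]
              exact hi'.2
          have h8 := (Finset.card_le_card h7).trans (Finset.card_insert_le _ _)
          omega
        · change ¬ Y (Function.extend (fun _ => i) g τ i')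
          rw [e2 i' hi']
          exact hτ.2 i'

/-- In the classes of the vertices of `v` there are no other vertices of `W`, and these classes are
not larger than `k`. -/
def Separated (k : ℕ) (W : Set (Fin n)) (v : Fin h → Fin n) (φ : Fin n → Fin X) : Prop :=
  ∀ j, (∀ u ∈ W, φ u = φ (v j) → u = v j) ∧ Nat.card {u // φ u = φ (v j)} ≤ k

/-- Any other node falls into the class of `v j` with probability `1 / X`. A union bound over `W`
excludes collisions, and Markov's inequality excludes oversized classes. -/
theorem pr_separated_ge (hX : 0 < X) (hk : 0 < k) (W : Set (Fin n)) (v : Fin h → Fin n)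
    (hW : (h : ℝ) * (W.ncard / X + n / (X * k)) ≤ 1 / 2) :
    1 / 2 ≤ pr (Separated (X := X) k W v) := by
  classical
  have : Nonempty (Fin X) := ⟨⟨0, hX⟩⟩
  have hX0 : (0 : ℝ) < X := by exact_mod_cast hX
  have hk0 : (0 : ℝ) < k := by exact_mod_cast hk
  let bad₁ : Fin h → (Fin n → Fin X) → Prop := fun j φ => ∃ u : W, u.1 ≠ v j ∧ φ u = φ (v j)
  let bad₂ : Fin h → (Fin n → Fin X) → Prop := fun j φ =>
    k ≤ Nat.card {u // u ≠ v j ∧ φ u = φ (v j)}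
  have hone : ∀ (j : Fin h) (u : Fin n), pr (fun φ : Fin n → Fin X => u ≠ v j ∧ φ u = φ (v j)) ≤
      1 / X := by
    intro j u
    by_cases hu : u = v j
    · have : ∀ φ : Fin n → Fin X, ¬ (u ≠ v j ∧ φ u = φ (v j)) := fun φ h => h.1 hu
      simp only [pr, this]
      simp
    · refine (pr_mono fun φ hφ => hφ.2).trans (le_of_eq ?_)
      rw [pr_eq_of_ne hu, Nat.card_fin]
  have h1 : ∀ j, pr (bad₁ j) ≤ W.ncard / X := by
    intro j
    refine (pr_union _).trans ((Finset.sum_le_sum fun u _ => hone j u.1).trans (le_of_eq ?_))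
    rw [Finset.sum_const, Finset.card_univ, nsmul_eq_mul, ← Nat.card_eq_fintype_card,
      Nat.card_coe_set_eq]
    ring
  have h2 : ∀ j, pr (bad₂ j) ≤ n / (X * k) := by
    intro j
    have h3 := (pr_markov (fun u (φ : Fin n → Fin X) => u ≠ v j ∧ φ u = φ (v j)) k).trans
      (Finset.sum_le_sum fun u _ => hone j u)
    rw [Finset.sum_const, Finset.card_univ, nsmul_eq_mul, Fintype.card_fin] at h3
    refine ((le_div_iff₀ hk0).2 h3).trans (le_of_eq ?_)
    field_simp
  have h3 : pr (fun φ => ∃ j, bad₁ j φ ∨ bad₂ j φ) ≤ 1 / 2 := by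
    refine (pr_union _).trans ((Finset.sum_le_sum fun j _ => (pr_or_le _ _).trans
      (add_le_add (h1 j) (h2 j))).trans ?_)
    rw [Finset.sum_const, Finset.card_univ, nsmul_eq_mul, Fintype.card_fin]
    exact hW
  have h4 := pr_not fun φ => ∃ j, bad₁ j φ ∨ bad₂ j φ
  refine le_trans (by linarith) (h4.symm.le.trans (pr_mono ?_))
  intro φ hφ j
  have hj : ¬ (bad₁ j φ ∨ bad₂ j φ) := fun h => hφ ⟨j, h⟩
  simp only [bad₁, bad₂, not_or, not_exists, not_and, not_le] at hj
  refine ⟨fun u hu h => by_contra fun hne => hj.1 ⟨u, hu⟩ hne h, ?_⟩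
  have h6 := hj.2
  rw [Nat.card_eq_fintype_card, Fintype.card_subtype] at h6 ⊢
  have h7 : (Finset.univ.filter fun u => φ u = φ (v j)) ⊆
      insert (v j) (Finset.univ.filter fun u => u ≠ v j ∧ φ u = φ (v j)) := by
    intro u hu
    rw [Finset.mem_filter] at hu
    rw [Finset.mem_insert, Finset.mem_filter]
    by_cases hne : u = v j
    · exact .inl hne
    · exact .inr ⟨Finset.mem_univ _, hne, hu.2⟩
  have h8 := (Finset.card_le_card h7).trans (Finset.card_insert_le _ _)
  omega

/-- The probability that a tuple of the set `cyc` is found. -/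
theorem pr_tuple_ge (hh : 0 < h) (hX : 0 < X) (hk : 0 < k) (W : Set (Fin n)) (cyc : (Fin h → Fin n) → Prop)
    (hinj : ∀ v, cyc v → Function.Injective v) (hcyc : ∀ v, cyc v → ∀ j, v j ∈ W)
    (hW : (h : ℝ) * (W.ncard / X + n / (X * k)) ≤ 1 / 2) (hB : (h : ℝ) * s ≤ X * B / 4)
    (hY : (s : ℝ) * Nat.card {v // cyc v} ≤ (X : ℝ) ^ h / 4) :
    (s : ℝ) * Nat.card {v // cyc v} / (4 * (h : ℝ) ^ h * (X : ℝ) ^ h) ≤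
      pr fun p : (Fin n → Fin h) × (Fin n → Fin X) × (Fin s → Fin h → Fin X) =>
        ∃ v i, cyc v ∧ p.1 ∘ v = id ∧ Separated k W v p.2.1 ∧ p.2.2 i = p.2.1 ∘ v ∧
          ∀ j, Nat.card {i' // p.2.2 i' j = p.2.2 i j} ≤ B := by
  classical
  have : Nonempty (Fin X) := ⟨⟨0, hX⟩⟩
  have : Nonempty (Fin h) := ⟨⟨0, hh⟩⟩
  have hX0 : (0 : ℝ) < X := by exact_mod_cast hX
  have hh0 : (0 : ℝ) < h := by exact_mod_cast hh
  -- The class tuples of all elements of `cyc`. Demanding that no second drawn tuple lies in this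
  -- set makes the events below disjoint.
  let Y : (Fin n → Fin X) → (Fin h → Fin X) → Prop := fun φ y => ∃ v, cyc v ∧ y = φ ∘ v
  have hYcard : ∀ φ, Nat.card {y // Y φ y} ≤ Nat.card {v // cyc v} := by
    intro φ
    refine Nat.card_le_card_of_surjective (fun v : {v // cyc v} => ⟨φ ∘ v.1, v.1, v.2, rfl⟩) ?_
    rintro ⟨y, v, hv, rfl⟩
    exact ⟨⟨v, hv⟩, rfl⟩
  have hEv : ∀ (x : {v // cyc v} × Fin s), 1 / (4 * (h : ℝ) ^ h * (X : ℝ) ^ h) ≤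
      pr fun p : (Fin n → Fin h) × (Fin n → Fin X) × (Fin s → Fin h → Fin X) =>
        p.1 ∘ x.1.1 = id ∧ Separated k W x.1.1 p.2.1 ∧ GoodAt B (Y p.2.1) (p.2.1 ∘ x.1.1) x.2 p.2.2 := by
    rintro ⟨⟨v, hv⟩, i⟩
    have e1 := pr_prod (fun c : Fin n → Fin h => c ∘ v = id)
      (fun p : (Fin n → Fin X) × (Fin s → Fin h → Fin X) =>
        Separated k W v p.1 ∧ GoodAt B (Y p.1) (p.1 ∘ v) i p.2)
    have e2 : pr (fun c : Fin n → Fin h => c ∘ v = id) = 1 / (h : ℝ) ^ h := by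
      have := pr_comp_injective (B := Fin h) (hinj v hv) (fun g => g = id)
      rw [this, pr_eq_one_div, Nat.card_fun, Nat.card_fin]
      push_cast
      rfl
    have e3 : pr (Separated (X := X) k W v) * (1 / (X : ℝ) ^ h * (1 / 2)) ≤
        pr (fun p : (Fin n → Fin X) × (Fin s → Fin h → Fin X) =>
          Separated k W v p.1 ∧ GoodAt B (Y p.1) (p.1 ∘ v) i p.2) := by
      refine pr_mul_le_pr fun φ hφ => ?_
      simp only [hφ, true_and]
      refine pr_goodAt_ge hX (Y φ) (φ ∘ v) i hB (le_trans ?_ hY)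
      exact mul_le_mul_of_nonneg_left (by exact_mod_cast hYcard φ) (by positivity)
    have e4 := pr_separated_ge (X := X) hX hk W v hW
    rw [e2] at e1
    refine le_trans ?_ e1.symm.le
    calc 1 / (4 * (h : ℝ) ^ h * (X : ℝ) ^ h) = 1 / (h : ℝ) ^ h * (1 / 2 * (1 / (X : ℝ) ^ h * (1 / 2))) := by
          field_simp
          norm_num
      _ ≤ 1 / (h : ℝ) ^ h * (pr (Separated (X := X) k W v) * (1 / (X : ℝ) ^ h * (1 / 2))) := by
          gcongr
      _ ≤ _ := by gcongr
  -- Disjoint events have additive probabilities, so no second moment is needed. Two simultaneous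
  -- events agree in the place `i` by `GoodAt`, thus in the classes, and then in the vertices by
  -- separation.
  have hsum := sum_pr_le_of_disjoint (fun (x : {v // cyc v} × Fin s)
      (p : (Fin n → Fin h) × (Fin n → Fin X) × (Fin s → Fin h → Fin X)) =>
        p.1 ∘ x.1.1 = id ∧ Separated k W x.1.1 p.2.1 ∧ GoodAt B (Y p.2.1) (p.2.1 ∘ x.1.1) x.2 p.2.2)
      (fun p => ∃ v i, cyc v ∧ p.1 ∘ v = id ∧ Separated k W v p.2.1 ∧ p.2.2 i = p.2.1 ∘ v ∧
          ∀ j, Nat.card {i' // p.2.2 i' j = p.2.2 i j} ≤ B)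
      (fun x p hp => ⟨x.1.1, x.2, x.1.2, hp.1, hp.2.1, hp.2.2.1, hp.2.2.2.1⟩) (by
        rintro ⟨⟨v, hv⟩, i⟩ ⟨⟨v', hv'⟩, i'⟩ p ⟨-, h2, h3⟩ ⟨-, h2', h3'⟩
        have hi : i = i' := by
          by_contra hne
          exact h3.2.2 i' (Ne.symm hne) ⟨v', hv', h3'.1⟩
        subst hi
        have hvv : v = v' := by
          funext j
          have e : p.2.1 ∘ v = p.2.1 ∘ v' := h3.1.symm.trans h3'.1
          exact (h2' j).1 (v j) (hcyc v hv j) (congrFun e j)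
        subst hvv
        rfl)
  refine le_trans ?_ hsum
  refine le_trans (le_of_eq ?_) (Finset.sum_le_sum fun x _ => hEv x)
  rw [Finset.sum_const, Finset.card_univ, nsmul_eq_mul, Fintype.card_prod, Fintype.card_fin,
    ← Nat.card_eq_fintype_card]
  push_cast
  ring

end TupleProbability

/-! ### The phase that searches in random tuples of classes. -/

theorem pr_congr_snd {A B B' : Type} [Finite A] [Finite B] [Finite B'] {E : A × B → Prop}
    {F : A × B' → Prop} (h : ∀ a, pr (fun b => E (a, b)) = pr fun b => F (a, b)) : pr E = pr F := by
  have := Fintype.ofFinite A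
  rw [pr_prod_eq_sum, pr_prod_eq_sum, Finset.sum_congr rfl fun a _ => h a]

theorem mul_le_two_pow {a n : ℕ} : a * n ≤ 2 ^ ((a + 1) * (Nat.log 2 n + 1)) := by
  calc a * n ≤ 2 ^ a * 2 ^ (Nat.log 2 n + 1) :=
        Nat.mul_le_mul Nat.lt_two_pow_self.le (Nat.lt_pow_succ_log_self (by norm_num) n).le
    _ = 2 ^ (a + (Nat.log 2 n + 1)) := (pow_add _ _ _).symm
    _ ≤ _ := Nat.pow_le_pow_right (by norm_num) (by nlinarith [Nat.zero_le (a * Nat.log 2 n)])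

theorem ceil_div_mul_le {n y : ℕ} (hy : 1 ≤ y) (hyn : y ≤ n) : ⌈(n : ℝ) / y⌉₊ * y ≤ 2 * n := by
  have hy0 : (0 : ℝ) < y := by exact_mod_cast hy
  have h1 : (⌈(n : ℝ) / y⌉₊ : ℝ) ≤ n / y + 1 := (Nat.ceil_lt_add_one (by positivity)).le
  have h2 : (⌈(n : ℝ) / y⌉₊ : ℝ) * y ≤ 2 * n := by
    calc _ ≤ ((n : ℝ) / y + 1) * y := by gcongr
      _ = n + y := by field_simp
      _ ≤ _ := by
        have : (y : ℝ) ≤ n := by exact_mod_cast hyn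
        linarith
  exact_mod_cast h2

theorem le_ceil_div_mul {n y : ℕ} (hy : 1 ≤ y) : n ≤ ⌈(n : ℝ) / y⌉₊ * y := by
  have hy0 : (0 : ℝ) < y := by exact_mod_cast hy
  have h1 := Nat.le_ceil ((n : ℝ) / y)
  rw [div_le_iff₀ hy0] at h1
  exact_mod_cast h1

theorem sq_ceil_div_sqrt_add_one_le {n y s : ℕ} (hy : 1 ≤ y) (hyn : y ≤ n) (hs : 1 ≤ s)
    (hsn : s ≤ n) (hsy : s ≤ y * y) :
    (⌈(n : ℝ) / y⌉₊ / Nat.sqrt (n / s) + 1) ^ 2 ≤ 66 * n := by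
  have hk := ceil_div_mul_le hy hyn
  generalize ⌈(n : ℝ) / y⌉₊ = k at *
  have hN : 0 < n / s := Nat.div_pos hsn hs
  have h1 : n ≤ 2 * (s * (n / s)) := by
    have h2 : n < s * (n / s + 1) := Nat.lt_mul_div_succ n hs
    nlinarith
  have h3 : k * k ≤ n / s * (8 * n) := by
    refine Nat.le_of_mul_le_mul_left (?_ : s * (k * k) ≤ s * (n / s * (8 * n))) hs
    calc s * (k * k) ≤ (y * y) * (k * k) := Nat.mul_le_mul_right _ hsy
      _ = (k * y) * (k * y) := by ring
      _ ≤ (2 * n) * (2 * n) := Nat.mul_le_mul hk hk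
      _ = 4 * n * n := by ring
      _ ≤ 4 * n * (2 * (s * (n / s))) := Nat.mul_le_mul_left _ h1
      _ = _ := by ring
  refine (sq_div_sqrt_add_one_le hN h3).trans ?_
  omega

/-- The rounds needed by a search in tuples or through given nodes are at most this constant times
the rounds for one multiplication. -/
def phaseConstant (h κ : ℕ) : ℕ := (8 * h + 1) * (h + 2) + 12 * h * κ * 66 + h + 1

/-- There are `8 * h * y` classes, enough for the failure probability of the separation to be at
most `3 / 8` when at most `2 * y` vertices lie on cycles. As `s ≤ n`, each tuple of classes can be
drawn by a node of its own, which keeps the seeds short. -/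
theorem exists_tuplePhase {K : Type} [Field K] {n y s r h κ : ℕ} (hh : 1 ≤ h)
    (enc : K → Fin κ → Msg n) (henc : Function.Injective enc) (hy : 1 ≤ y) (hyn : y ≤ n)
    (hs : 1 ≤ s) (hsn : s ≤ n) (hsy : s ≤ y * y) (H : ProductSolvable K n ⌈(n : ℝ) / y⌉₊ s r) :
    ∃ Φ : Phase n, Φ.rounds ≤ phaseConstant h κ * (r + 1) ∧
      (∀ adj ρ, Φ.found adj ρ → ∃ v, IsCycleTuple adj h v) ∧
      ∀ adj, (cycleVertices adj h).ncard ≤ 2 * y →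
        (s : ℝ) * Nat.card {v // IsCycleTuple adj h v} ≤ (8 * h * y : ℝ) ^ h / 4 →
        (s : ℝ) * Nat.card {v // IsCycleTuple adj h v} / (4 * (h : ℝ) ^ h * (8 * h * y : ℝ) ^ h) ≤
          pr (Φ.found adj) := by
  obtain ⟨m, rfl⟩ := Nat.exists_eq_succ_of_ne_zero (Nat.one_le_iff_ne_zero.1 hh)
  set h := m + 1 with hm
  have hmod : ∀ j, j % h < h := fun j => Nat.mod_lt _ hh
  set X := 8 * h * y with hXdef
  have hX : 0 < X := by positivity
  have hsq := sq_ceil_div_sqrt_add_one_le hy hyn hs hsn hsy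
  have hky := ceil_div_mul_le hy hyn
  have hky' : n ≤ ⌈(n : ℝ) / y⌉₊ * y := le_ceil_div_mul hy
  have hk : 0 < ⌈(n : ℝ) / y⌉₊ := by
    rcases Nat.eq_zero_or_pos ⌈(n : ℝ) / y⌉₊ with h0 | h0
    · rw [h0] at hky'; omega
    · exact h0
  generalize ⌈(n : ℝ) / y⌉₊ = k at *
  -- Large compared with the expected number `s / X` of occurrences of a class, yet small enough for
  -- `B * k = O(n)`, thanks to `s ≤ y * y`.
  set B := s / y + 1 with hB
  have hBy : s ≤ y * B := (Nat.lt_mul_div_succ s hy).le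
  have hBk : B * k ≤ 66 * n := by
    have h1 : s / y ≤ y := Nat.div_le_of_le_mul hsy
    calc B * k ≤ (2 * y) * k := Nat.mul_le_mul_right _ (by omega)
      _ = 2 * (k * y) := by ring
      _ ≤ 2 * (2 * n) := Nat.mul_le_mul_left _ hky
      _ ≤ _ := by omega
  let S := Fin h × Fin X × (Fin h → Fin X)
  have : Nonempty (Fin h) := ⟨⟨0, hh⟩⟩
  have : Nonempty (Fin X) := ⟨⟨0, hX⟩⟩
  have hS : Nat.card S ≤ 2 ^ ((8 * h + 1) * (h + 2) * (Nat.log 2 n + 1)) := by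
    have h1 : X ≤ 8 * h * n := Nat.mul_le_mul_left _ hyn
    have h2 : h ≤ 8 * h * n := by nlinarith [Nat.le_mul_of_pos_right h (hy.trans hyn)]
    rw [Nat.card_prod, Nat.card_prod, Nat.card_fun, Nat.card_fin, Nat.card_fin]
    calc h * (X * X ^ h) ≤ (8 * h * n) * ((8 * h * n) * (8 * h * n) ^ h) := by gcongr
      _ = (8 * h * n) ^ (h + 2) := by ring
      _ ≤ (2 ^ ((8 * h + 1) * (Nat.log 2 n + 1))) ^ (h + 2) := Nat.pow_le_pow_left mul_le_two_pow _
      _ = _ := by rw [← pow_mul]; ring_nf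
  let τ' : (Fin s → Fin h → Fin X) → Fin s → ℕ → Fin X := fun τ i j => τ i ⟨j % h, hmod j⟩
  let win : (Fin n → Fin n → Prop) →
      (Fin n → Fin h) × (Fin n → Fin X) × (Fin s → Fin h → Fin X) → Prop := fun adj p =>
    ∃ i a, chain (tupleMatrix K k h B (fun v => (p.1 v).val) p.2.1 (τ' p.2.2) adj i) 0 h a a ≠ 0
  let found : (Fin n → Fin n → Prop) → (Fin n → S) → Prop := fun adj ρ =>
    win adj (fun v => (ρ v).1, fun v => (ρ v).2.1, fun i => (ρ (Fin.castLE hsn i)).2.2)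
  refine ⟨⟨S, inferInstance, inferInstance, _, found, reach_seeds hS found fun ρ =>
    reach_tuples (K := K) (k := k) hs hsn enc henc H m _ _ _ hsq hBk⟩, ?_, ?_, ?_⟩
  · change (8 * h + 1) * (h + 2) + ((m + 1) * (4 * (κ * 66)) + m * r + 1) ≤
      ((8 * h + 1) * (h + 2) + 12 * h * κ * 66 + h + 1) * (r + 1)
    have e1 : (m + 1) * (4 * (κ * 66)) ≤ 12 * h * κ * 66 := by
      rw [← hm]; nlinarith [Nat.zero_le (h * κ)]
    have e2 : m * r ≤ h * r := Nat.mul_le_mul_right _ (by omega)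
    generalize (8 * h + 1) * (h + 2) = a
    generalize 12 * h * κ * 66 = b at *
    nlinarith [Nat.zero_le (a * r), Nat.zero_le (b * r)]
  · rintro adj ρ ⟨i, a, hia⟩
    exact exists_cycle_of_tuple hh hia
  · intro adj hW hY
    have hpr : pr (found adj) = pr (win adj) := by
      have e1 := pr_equiv (A := Fin n → S)
        (B := (Fin n → Fin h) × (Fin n → Fin X) × (Fin n → Fin h → Fin X))
        { toFun := fun ρ => (fun v => (ρ v).1, fun v => (ρ v).2.1, fun v => (ρ v).2.2)
          invFun := fun p v => (p.1 v, p.2.1 v, p.2.2 v)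
          left_inv := fun ρ => rfl
          right_inv := fun p => rfl }
        (fun p => win adj (p.1, p.2.1, p.2.2 ∘ Fin.castLE hsn))
      refine e1.trans (pr_congr_snd fun c => pr_congr_snd fun φ => ?_)
      exact pr_comp_injective (Fin.castLE_injective hsn) fun τ => win adj (c, φ, τ)
    change _ ≤ pr (found adj)
    rw [hpr]
    have hy0 : (0 : ℝ) < y := by exact_mod_cast hy
    have hh0 : (0 : ℝ) < h := by exact_mod_cast hh
    have hk0 : (0 : ℝ) < k := by exact_mod_cast hk
    have hXr : (X : ℝ) = 8 * h * y := by rw [hXdef]; push_cast; ring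
    have key := pr_tuple_ge (s := s) (k := k) (B := B) hh hX hk (cycleVertices adj h)
      (IsCycleTuple adj h) (fun v hv => hv.1) (fun v hv j => ⟨v, hv, j, rfl⟩) (by
        have h1 : ((cycleVertices adj h).ncard : ℝ) ≤ 2 * y := by exact_mod_cast hW
        have h2 : (n : ℝ) ≤ k * y := by exact_mod_cast hky'
        rw [hXr]
        calc (h : ℝ) * ((cycleVertices adj h).ncard / (8 * h * y) + n / (8 * h * y * k))
            ≤ h * (2 * y / (8 * h * y) + k * y / (8 * h * y * k)) := by gcongr
          _ = 3 / 8 := by field_simp; norm_num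
          _ ≤ 1 / 2 := by norm_num) (by
        have h1 : (s : ℝ) ≤ y * B := by exact_mod_cast hBy
        rw [hXr]
        nlinarith) (by rw [hXr]; exact hY)
    rw [hXr] at key
    refine key.trans (pr_mono ?_)
    rintro ⟨c, φ, τ⟩ ⟨v, i, hv, hc, hsep, hτ, hlive⟩
    have hcls : ∀ j, φ (v j) = τ i j := fun j => (congrFun hτ j).symm
    choose f hf using fun j : Fin h => exists_member (φ := φ) (hcls j) (k := k) (by
      rw [← hcls j]
      exact (hsep j).2)
    have hone := chain_tupleMatrix_eq_one (K := K) (k := k) (B := B) (c := fun v => (c v).val)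
      (φ := φ) (τ := τ' τ) (adj := adj) hh (i := i) (fun j _ => hlive ⟨j % h, hmod j⟩)
      (v := fun j => v ⟨j % h, hmod j⟩) (fun j hj => ?_) (fun j hj => ?_)
      (f := fun j => f ⟨j % h, hmod j⟩) (fun j hj => hf _) (fun u hu j hj huj => ?_)
    · exact ⟨i, _, by rw [hone]; exact one_ne_zero⟩
    · have h1 := hv.2 ⟨j % h, hmod j⟩
      have h2 : finRotate h ⟨j % h, hmod j⟩ = ⟨(j + 1) % h % h, hmod _⟩ := Fin.ext (by
        rw [finRotate_val]; simp)
      rw [h2] at h1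
      exact h1
    · have := congrArg Fin.val (congrFun hc ⟨j % h, hmod j⟩)
      exact this.trans (Nat.mod_eq_of_lt hj)
    · exact (hsep _).1 u hu (huj.trans (hcls _).symm)

/-! ### The phase that searches for cycles through random start nodes. -/

section Through

variable {n h : ℕ} {K : Type} [Field K] {adj : Fin n → Fin n → Prop}

theorem chain_congr {ι : Type} [Fintype ι] [DecidableEq ι] {M M' : ℕ → Matrix ι ι K} {t m : ℕ}
    (H : ∀ j, t ≤ j → j < t + m → M j = M' j) : chain M t m = chain M' t m := by
  unfold chain
  congr 1
  refine List.map_congr_left fun j hj => ?_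
  rw [List.mem_range'_1] at hj
  exact H j hj.1 hj.2

/-- Whatever the colours of the other nodes are, the vertices of a cycle can be coloured (by their
position or by the colour `h`, which is never used) so that the closed walks do not cancel. -/
theorem exists_coloring_chain_ne_zero (hh : 0 < h) (v : ℕ → Fin n)
    (hinj : ∀ i < h, ∀ j < h, v i = v j → i = j) (hv : ∀ j < h, adj (v j) (v ((j + 1) % h)))
    (c₀ : Fin n → ℕ) :
    ∃ c : Fin n → ℕ, (∀ x, (∀ j < h, v j ≠ x) → c x = c₀ x) ∧ (∀ j < h, c (v j) ≤ h) ∧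
      chain (colorMatrix K h c adj) 0 h (v 0) (v 0) ≠ 0 := by
  classical
  have main : ∀ m t, t + (m + 1) = h → ∃ c : Fin n → ℕ, (∀ x, (∀ j < h, v j ≠ x) → c x = c₀ x) ∧
      (∀ j < h, c (v j) ≤ h) ∧ (∀ j ≤ t, c (v j) = j) ∧
      chain (colorMatrix K h c adj) t (m + 1) (v t) (v 0) ≠ 0 := by
    intro m
    induction m with
    | zero =>
      intro t ht
      let c : Fin n → ℕ := fun x => if hx : ∃ j < h, v j = x then hx.choose else c₀ x
      have hc : ∀ j < h, c (v j) = j := by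
        intro j hj
        have hx : ∃ j' < h, v j' = v j := ⟨j, hj, rfl⟩
        simp only [c, dif_pos hx]
        exact hinj _ hx.choose_spec.1 _ hj hx.choose_spec.2
      refine ⟨c, fun x hx => ?_, fun j hj => ?_, fun j hj => hc j (by omega), ?_⟩
      · exact dif_neg fun ⟨j, hj, e⟩ => hx j hj e
      · rw [hc j hj]; exact hj.le
      · rw [chain_one, colorMatrix, Matrix.of_apply, if_pos]
        · exact one_ne_zero
        · have h1 := hv t (by omega)
          have e : (t + 1) % h = 0 := by rw [show t + 1 = h from ht, Nat.mod_self]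
          rw [e] at h1 ⊢
          exact ⟨hc t (by omega), hc 0 hh, h1⟩
    | succ m ih =>
      intro t ht
      obtain ⟨c, h1, h2, h3, h4⟩ := ih (t + 1) (by omega)
      -- If the sum vanishes, its term through `v (t + 1)`, which is nonzero by induction, is
      -- cancelled by the others. Giving `v (t + 1)` the colour `h`, used in no matrix, deletes
      -- exactly this term.
      by_cases hne : chain (colorMatrix K h c adj) t (m + 1 + 1) (v t) (v 0) = 0
      swap
      · exact ⟨c, h1, h2, fun j hj => h3 j (by omega), hne⟩
      have hmod : (t + 1) % h = t + 1 := Nat.mod_eq_of_lt (by omega)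
      have hmod' : ∀ j, (j + 1) % h ≠ h := fun j => (Nat.mod_lt _ hh).ne
      have hct : c (v (t + 1)) = t + 1 := h3 _ le_rfl
      have hc' : ∀ j < h, j ≠ t + 1 → Function.update c (v (t + 1)) h (v j) = c (v j) :=
        fun j hj hj' => Function.update_of_ne (fun e => hj' (hinj j hj _ (by omega) e)) _ _
      refine ⟨Function.update c (v (t + 1)) h, fun x hx => ?_, fun j hj => ?_, fun j hj => ?_, ?_⟩
      · rw [Function.update_of_ne (hx (t + 1) (by omega)).symm]
        exact h1 x hx
      · by_cases hj' : j = t + 1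
        · rw [hj', Function.update_self]
        · rw [hc' j hj hj']
          exact h2 j hj
      · rw [hc' j (by omega) (by omega)]
        exact h3 j (by omega)
      · have hrow : ∀ b, b ≠ v (t + 1) →
            chain (colorMatrix K h (Function.update c (v (t + 1)) h) adj) (t + 1) (m + 1) b (v 0) =
            chain (colorMatrix K h c adj) (t + 1) (m + 1) b (v 0) := by
          intro b hb
          -- The remaining terms are unchanged: from here on the colour `t + 1` matters only for the
          -- start `b` of the walk, and `b` is not the recoloured node.
          have hcol : ∀ j, t + 1 ≤ j → j < h → ∀ x,
              (Function.update c (v (t + 1)) h x = (j + 1) % h ↔ c x = (j + 1) % h) := by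
            intro j hj hjh x
            by_cases hx : x = v (t + 1)
            · subst hx
              rw [Function.update_self, hct]
              refine iff_of_false (hmod' j).symm ?_
              rcases (Nat.succ_le_of_lt hjh).eq_or_lt with hlt | hlt
              · rw [show j + 1 = h from hlt, Nat.mod_self]; omega
              · rw [Nat.mod_eq_of_lt hlt]; omega
            · rw [Function.update_of_ne hx]
          rw [chain_succ_left, chain_succ_left, Matrix.mul_apply, Matrix.mul_apply]
          refine Finset.sum_congr rfl fun d _ => congrArg₂ (· * ·) ?_ ?_
          · simp only [colorMatrix, Matrix.of_apply, hcol (t + 1) le_rfl (by omega),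
              Function.update_of_ne hb]
          · refine congrFun (congrFun (chain_congr fun j hj hj' => ?_) d) (v 0)
            funext x y
            simp only [colorMatrix, Matrix.of_apply, hcol j (by omega) (by omega)]
            have : Function.update c (v (t + 1)) h x = j ↔ c x = j := by
              by_cases hx : x = v (t + 1)
              · subst hx
                rw [Function.update_self, hct]
                omega
              · rw [Function.update_of_ne hx]
            simp only [this]
        rw [chain_succ_left, Matrix.mul_apply, ← Finset.add_sum_erase _ _ (Finset.mem_univ (v (t + 1)))]
          at hne ⊢
        have e1 : colorMatrix K h c adj t (v t) (v (t + 1)) = 1 := by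
          have h5 := hv t (by omega)
          rw [hmod] at h5
          rw [colorMatrix, Matrix.of_apply, if_pos]
          exact ⟨h3 t (by omega), by rw [hct, hmod], h5⟩
        have e2 : colorMatrix K h (Function.update c (v (t + 1)) h) adj t (v t) (v (t + 1)) = 0 := by
          rw [colorMatrix, Matrix.of_apply, if_neg]
          rintro ⟨-, h5, -⟩
          rw [Function.update_self] at h5
          exact hmod' t h5.symm
        have e3 : ∑ b ∈ Finset.univ.erase (v (t + 1)),
            colorMatrix K h (Function.update c (v (t + 1)) h) adj t (v t) b *
              chain (colorMatrix K h (Function.update c (v (t + 1)) h) adj) (t + 1) (m + 1) b (v 0) =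
            ∑ b ∈ Finset.univ.erase (v (t + 1)), colorMatrix K h c adj t (v t) b *
              chain (colorMatrix K h c adj) (t + 1) (m + 1) b (v 0) := by
          refine Finset.sum_congr rfl fun b hb => ?_
          have hb' := Finset.ne_of_mem_erase hb
          rw [hrow b hb']
          congr 1
          simp only [colorMatrix, Matrix.of_apply, Function.update_of_ne hb',
            hc' t (by omega) (by omega)]
        rw [e2, zero_mul, zero_add, e3]
        rw [e1, one_mul] at hne
        intro h0
        rw [h0, add_zero] at hne
        exact h4 hne
  obtain ⟨m, rfl⟩ := Nat.exists_eq_succ_of_ne_zero hh.ne'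
  obtain ⟨c, h1, h2, -, h4⟩ := main m 0 (by omega)
  exact ⟨c, h1, h2, h4⟩

/-- A cycle through `u` is rotated so as to begin there, and the colours of its vertices are drawn
anew. For any colouring of the rest, at least one of the `(h + 1) ^ h` outcomes is successful. -/
theorem pr_color_ge (hh : 0 < h) {u : Fin n} (hu : u ∈ cycleVertices adj h) :
    1 / ((h : ℝ) + 1) ^ h ≤ pr fun c : Fin n → Fin (h + 1) =>
      chain (colorMatrix K h (fun x => (c x).val) adj) 0 h u u ≠ 0 := by
  obtain ⟨v, hv, i, rfl⟩ := hu
  have hmod : ∀ j, j % h < h := fun j => Nat.mod_lt _ hh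
  let w : ℕ → Fin n := fun j => v ⟨(i + j) % h, hmod _⟩
  have hw0 : w 0 = v i := congrArg v (Fin.ext (by simp [Nat.mod_eq_of_lt i.isLt]))
  have hwinj : ∀ a < h, ∀ b < h, w a = w b → a = b := by
    intro a ha b hb hab
    have h1 : (i + a) % h = (i + b) % h := congrArg Fin.val (hv.1 hab)
    have h2 : i.val + a ≡ i.val + b [MOD h] := h1
    have h3 := Nat.ModEq.add_left_cancel' _ h2
    rwa [Nat.ModEq, Nat.mod_eq_of_lt ha, Nat.mod_eq_of_lt hb] at h3
  have hwadj : ∀ j < h, adj (w j) (w ((j + 1) % h)) := by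
    intro j _
    have h1 := hv.2 ⟨(i + j) % h, hmod _⟩
    have h2 : finRotate h ⟨(i + j) % h, hmod _⟩ = ⟨(i + (j + 1) % h) % h, hmod _⟩ := Fin.ext (by
      rw [finRotate_val]
      simp only [Nat.mod_add_mod, Nat.add_mod_mod, Nat.add_assoc])
    rw [h2] at h1
    exact h1
  have hwinj' : Function.Injective (fun j : Fin h => w j) :=
    fun a b hab => Fin.ext (hwinj a a.isLt b b.isLt hab)
  rw [← hw0, ← pr_resample hwinj']
  have h1 : 1 / ((h : ℝ) + 1) ^ h = pr (fun _ : Fin n → Fin (h + 1) => True) *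
      (1 / ((h : ℝ) + 1) ^ h) := by rw [pr_true, one_mul]
  rw [h1]
  refine pr_mul_le_pr fun φ _ => ?_
  obtain ⟨c, hc1, hc2, hc3⟩ := exists_coloring_chain_ne_zero (K := K) hh w hwinj hwadj
    fun x => (φ x).val
  have h2 := pr_eq_one_div (fun j : Fin h => (⟨c (w j), Nat.lt_succ_of_le (hc2 j j.isLt)⟩ : Fin (h + 1)))
  rw [Nat.card_fun, Nat.card_fin, Nat.card_fin] at h2
  push_cast at h2
  rw [← h2]
  refine pr_mono fun g hg => ?_
  have h3 : (fun x => (Function.extend (fun j : Fin h => w j) g φ x).val) = c := by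
    funext x
    by_cases hx : ∃ j : Fin h, w j = x
    · obtain ⟨j, rfl⟩ := hx
      exact (congrArg Fin.val (hwinj'.extend_apply g φ j)).trans (by rw [hg])
    · rw [Function.extend_apply' _ _ _ hx]
      exact (hc1 x fun j hj e => hx ⟨⟨j, hj⟩, e⟩).symm
  simp only [h3]
  exact hc3

/-- With `p` the density of `W`, Bernoulli gives `(1 + p) ^ k ≥ 1 + k * p ≥ 2`, while `(1 - p) ^ k *
(1 + p) ^ k ≤ 1`. -/
theorem pr_hit_ge {k : ℕ} (hn : 0 < n) (W : Set (Fin n)) (hW : n ≤ k * W.ncard) :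
    1 / 2 ≤ pr fun w : Fin k → Fin n => ∃ i, w i ∈ W := by
  have : Nonempty (Fin n) := ⟨⟨0, hn⟩⟩
  have hn0 : (0 : ℝ) < n := by exact_mod_cast hn
  have h1 := pr_forall k (fun u : Fin n => u ∉ W)
  have h2 : pr (fun u => u ∈ W) = W.ncard / n := by
    rw [pr, Nat.card_fin]
    rfl
  rw [pr_not, h2] at h1
  have h3 := pr_not fun w : Fin k → Fin n => ∃ i, w i ∈ W
  simp only [not_exists] at h3
  rw [h1] at h3
  have h0 : 0 ≤ (W.ncard : ℝ) / n := by positivity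
  have hle : (W.ncard : ℝ) / n ≤ 1 := h2 ▸ pr_le_one _
  have h4 : 1 + (k : ℝ) * (W.ncard / n) ≤ (1 + W.ncard / n) ^ k :=
    one_add_mul_le_pow (by linarith) k
  have h5 : 1 ≤ (k : ℝ) * (W.ncard / n) := by
    rw [← mul_div_assoc, le_div_iff₀ hn0, one_mul]
    exact_mod_cast hW
  have h6 : (1 - (W.ncard : ℝ) / n) ^ k * (1 + W.ncard / n) ^ k ≤ 1 := by
    rw [← mul_pow]
    refine pow_le_one₀ (mul_nonneg (by linarith) (by linarith)) ?_
    nlinarith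
  have h7 : 0 ≤ (1 - (W.ncard : ℝ) / n) ^ k := pow_nonneg (by linarith) k
  nlinarith

/-- About `n / X` start nodes hit a set of at least `X` vertices with probability at least one half.
Start node and colours are drawn independently, so the two success probabilities multiply. -/
theorem exists_throughPhase {X r κ : ℕ} (hh : 1 ≤ h) (enc : K → Fin κ → Msg n)
    (henc : Function.Injective enc) (hX : 1 ≤ X) (hXn : X * X ≤ n)
    (H : ProductSolvable K n ⌈(n : ℝ) / X⌉₊ (X * X) r) :
    ∃ Φ : Phase n, Φ.rounds ≤ phaseConstant h κ * (r + 1) ∧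
      (∀ adj ρ, Φ.found adj ρ → ∃ v, IsCycleTuple adj h v) ∧
      ∀ adj, X ≤ (cycleVertices adj h).ncard →
        1 / (2 * ((h : ℝ) + 1) ^ h) ≤ pr (Φ.found adj) := by
  obtain ⟨m, rfl⟩ := Nat.exists_eq_succ_of_ne_zero (Nat.one_le_iff_ne_zero.1 hh)
  set h := m + 1 with hm
  have hXX : 0 < X * X := Nat.mul_pos hX hX
  have hXn' : X ≤ n := (Nat.le_mul_self X).trans hXn
  have hn : 0 < n := hX.trans hXn'
  have hsq := sq_ceil_div_sqrt_add_one_le hX hXn' hXX hXn le_rfl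
  have hkX := ceil_div_mul_le hX hXn'
  have hkX' : n ≤ ⌈(n : ℝ) / X⌉₊ * X := le_ceil_div_mul hX
  have hkn : ⌈(n : ℝ) / X⌉₊ ≤ n := Nat.ceil_le.2 (div_le_self (Nat.cast_nonneg n)
    (by exact_mod_cast hX))
  generalize ⌈(n : ℝ) / X⌉₊ = k at *
  let S := Fin (h + 1) × Fin n
  have : Nonempty (Fin n) := ⟨⟨0, hn⟩⟩
  have hS : Nat.card S ≤ 2 ^ ((h + 2) * (Nat.log 2 n + 1)) := by
    rw [Nat.card_prod, Nat.card_fin, Nat.card_fin]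
    exact mul_le_two_pow
  let win : (Fin n → Fin n → Prop) → (Fin k → Fin n) × (Fin n → Fin (h + 1)) → Prop := fun adj p =>
    ∃ i, chain (colorMatrix K h (fun x => (p.2 x).val) adj) 0 h (p.1 i) (p.1 i) ≠ 0
  let found : (Fin n → Fin n → Prop) → (Fin n → S) → Prop := fun adj ρ =>
    win adj (fun i => (ρ (Fin.castLE hkn i)).2, fun v => (ρ v).1)
  refine ⟨⟨S, inferInstance, inferInstance, _, found, reach_seeds hS found fun ρ =>
    reach_through (K := K) (k := k) (L := 66) hXX hXn (by rw [mul_comm]; exact hkX') enc henc H hsq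
      (by rw [mul_comm]; omega) m _ _⟩, ?_, ?_, ?_⟩
  · change (h + 2) + (m * (12 * (κ * 66) + r) + 1) ≤
      ((8 * h + 1) * (h + 2) + 12 * h * κ * 66 + h + 1) * (r + 1)
    have e1 : m * (12 * (κ * 66) + r) ≤ 12 * h * κ * 66 + h * r := by
      calc m * (12 * (κ * 66) + r) ≤ h * (12 * (κ * 66) + r) := Nat.mul_le_mul_right _ (by omega)
        _ = _ := by ring
    have e2 : h + 2 ≤ (8 * h + 1) * (h + 2) := Nat.le_mul_of_pos_left _ (by omega)
    generalize (8 * h + 1) * (h + 2) = a at *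
    generalize 12 * h * κ * 66 = b at *
    nlinarith [Nat.zero_le (a * r), Nat.zero_le (b * r)]
  · rintro adj ρ ⟨i, hi⟩
    exact exists_cycle_of_color hi
  · intro adj hW
    have hpr : pr (found adj) = pr (win adj) := by
      have e1 := pr_equiv (A := Fin n → S) (B := (Fin n → Fin (h + 1)) × (Fin n → Fin n))
        { toFun := fun ρ => (fun v => (ρ v).1, fun v => (ρ v).2)
          invFun := fun p v => (p.1 v, p.2 v)
          left_inv := fun ρ => rfl
          right_inv := fun p => rfl }
        (fun p => win adj (p.2 ∘ Fin.castLE hkn, p.1))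
      have e2 := pr_congr_snd (E := fun p : (Fin n → Fin (h + 1)) × (Fin n → Fin n) =>
        win adj (p.2 ∘ Fin.castLE hkn, p.1)) (F := fun p : (Fin n → Fin (h + 1)) × (Fin k → Fin n) =>
        win adj (p.2, p.1)) fun c =>
          pr_comp_injective (Fin.castLE_injective hkn) fun w => win adj (w, c)
      exact e1.trans (e2.trans (pr_equiv (Equiv.prodComm _ _) (win adj)))
    change _ ≤ pr (found adj)
    rw [hpr]
    have h1 := pr_hit_ge (k := k) hn (cycleVertices adj h)
      (hkX'.trans (Nat.mul_le_mul_left _ hW))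
    have h2 := pr_mul_le_pr (E := win adj) (G := fun w : Fin k → Fin n =>
      ∃ i, w i ∈ cycleVertices adj h) (q := 1 / ((h : ℝ) + 1) ^ h) (by
        rintro w ⟨i, hi⟩
        exact (pr_color_ge (K := K) hh hi).trans (pr_mono fun c hc => ⟨i, hc⟩))
    refine le_trans ?_ h2
    calc 1 / (2 * ((h : ℝ) + 1) ^ h) = 1 / 2 * (1 / ((h : ℝ) + 1) ^ h) := by field_simp
      _ ≤ _ := mul_le_mul_of_nonneg_right h1 (by positivity)

end Through

/-! ### Copies of cycles versus cyclic tuples. -/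

section Counting

/-- Tuples with the same image under `f` have the same range, so each arises from any other by a map
of `Fin h` to itself. -/
theorem ncard_le_pow_mul_ncard_image {V S : Type} [Finite V] {h : ℕ} (Z : Set (Fin h → V))
    (f : (Fin h → V) → S) (g : S → Set V) (hg : ∀ v ∈ Z, g (f v) = Set.range v) :
    Z.ncard ≤ h ^ h * (f '' Z).ncard := by
  classical
  have := Fintype.ofFinite V
  lift Z to Finset (Fin h → V) using Set.toFinite Z
  rw [← Finset.coe_image, Set.ncard_coe_finset, Set.ncard_coe_finset]
  refine Finset.card_le_mul_card_image _ _ fun b hb => ?_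
  obtain ⟨v, hv, rfl⟩ := Finset.mem_image.1 hb
  have hsub : Z.filter (fun w => f w = f v) ⊆
      Finset.univ.image fun φ : Fin h → Fin h => v ∘ φ := by
    intro w hw
    obtain ⟨hw1, hw2⟩ := Finset.mem_filter.1 hw
    have h1 : Set.range w = Set.range v := by
      rw [← hg w (by exact_mod_cast hw1), ← hg v (by exact_mod_cast hv), hw2]
    have h2 : ∀ i, ∃ j, v j = w i := fun i => by
      have : w i ∈ Set.range v := h1 ▸ Set.mem_range_self i
      exact this
    choose φ hφ using h2
    exact Finset.mem_image.2 ⟨φ, Finset.mem_univ _, funext hφ⟩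
  calc _ ≤ _ := Finset.card_le_card hsub
    _ ≤ _ := Finset.card_image_le
    _ = h ^ h := by simp

theorem card_cycleTuple_le {V : Type} [Finite V] (adj : V → V → Prop) (h : ℕ) :
    Nat.card {v // IsCycleTuple adj h v} ≤ (cycleVertices adj h).ncard ^ h := by
  have h1 := Nat.card_le_card_of_injective
    (fun (v : {v // IsCycleTuple adj h v}) (i : Fin h) =>
      (⟨v.1 i, v.1, v.2, Set.mem_range_self i⟩ : cycleVertices adj h))
    (fun v w e => Subtype.ext (funext fun i => congrArg Subtype.val (congrFun e i)))
  rwa [Nat.card_fun, Nat.card_fin, Nat.card_coe_set_eq] at h1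

/-- `m` agrees with the number of `h`-cycles of `adj` up to factors that depend only on `h`. -/
structure CountsCycles {V : Type} (adj : V → V → Prop) (h m : ℕ) : Prop where
  le : m ≤ 2 * h * Nat.card {v // IsCycleTuple adj h v}
  ge : Nat.card {v // IsCycleTuple adj h v} ≤ h ^ h * m

/-- Here `f` is the set of arcs or edges, `g` recovers the vertices from it, and `c` is `1` for
digraphs and `2` for undirected graphs. -/
theorem CountsCycles.of_image {V S : Type} [Finite V] {adj : V → V → Prop} {h c : ℕ} (hh : 1 ≤ h)
    (hc : 1 ≤ c) (hc2 : c ≤ 2) (f : (Fin h → V) → S) (g : S → Set V)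
    (hg : ∀ v, g (f v) = Set.range v) :
    CountsCycles adj h (c * h * (f '' {v | IsCycleTuple adj h v}).ncard) := by
  have h1 : (f '' {v | IsCycleTuple adj h v}).ncard ≤ Nat.card {v // IsCycleTuple adj h v} :=
    Set.ncard_image_le (Set.toFinite _)
  have h2 : Nat.card {v // IsCycleTuple adj h v} ≤
      h ^ h * (f '' {v | IsCycleTuple adj h v}).ncard :=
    ncard_le_pow_mul_ncard_image _ f g fun v _ => hg v
  refine ⟨Nat.mul_le_mul (Nat.mul_le_mul_right _ hc2) h1, h2.trans (Nat.mul_le_mul_left _ ?_)⟩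
  exact Nat.le_mul_of_pos_left _ (Nat.mul_pos hc hh)

theorem countsCycles_directed {V : Type} [Finite V] (D : Digraph V) {h : ℕ} (hh : 1 ≤ h) :
    CountsCycles D.Adj h (h * (directedCycles D h).ncard) := by
  have h1 := CountsCycles.of_image (adj := D.Adj) hh le_rfl one_le_two
    (fun v => Set.range fun i => (v i, v (finRotate h i))) (fun E => Prod.fst '' E)
    (fun v => by rw [← Set.range_comp]; rfl)
  rw [one_mul] at h1
  convert h1 using 3
  ext E
  exact exists_congr fun v => and_congr_right fun _ => eq_comm

theorem countsCycles_undirected {V : Type} [Finite V] (G : SimpleGraph V) {h : ℕ} (hh : 1 ≤ h) :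
    CountsCycles G.Adj h (2 * h * (undirectedCycles G h).ncard) := by
  have h1 := CountsCycles.of_image (adj := G.Adj) hh one_le_two le_rfl
    (fun v => Set.range fun i => s(v i, v (finRotate h i))) (fun E => {u | ∃ e ∈ E, u ∈ e})
    (fun v => by
      ext u
      constructor
      · rintro ⟨_, ⟨i, rfl⟩, hu⟩
        rcases Sym2.mem_iff.1 hu with rfl | rfl <;> exact Set.mem_range_self _
      · rintro ⟨i, rfl⟩
        exact ⟨_, ⟨i, rfl⟩, Sym2.mem_mk_left _ _⟩)
  convert h1 using 3
  ext E
  exact exists_congr fun v => and_congr_right fun _ => eq_comm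

end Counting

/-! ### Phases for unknown parameters, and their repetition. -/

section Schedule

variable {n h κ : ℕ} {K : Type} [Field K]

/-- A lower bound for the probability that a phase suited to the graph finds an `h`-cycle. -/
noncomputable def phaseProb (h : ℕ) : ℝ := 1 / (16 * h * h ^ h * (16 * h) ^ h)

theorem phaseProb_pos (hh : 1 ≤ h) : 0 < phaseProb h := by
  have : (0 : ℝ) < h := by exact_mod_cast hh
  unfold phaseProb
  positivity

theorem exists_trivialPhase (n : ℕ) : ∃ Φ : Phase n, ∀ adj ρ, ¬ Φ.found adj ρ :=
  ⟨⟨Unit, inferInstance, inferInstance, 0, fun _ _ => False, .done fun _ _ _ _ => rfl⟩,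
    fun _ _ => id⟩

theorem lt_two_mul_of_log_eq {a b : ℕ} (hb : b ≠ 0) (e : Nat.log 2 a = Nat.log 2 b) :
    a < 2 * b := by
  have h1 := Nat.lt_pow_succ_log_self one_lt_two a
  have h2 := Nat.pow_log_le_self 2 hb
  rw [e, pow_succ] at h1
  omega

/-- Only the binary logarithms `a`, `b` of `x` and `s` are guessed. The phase uses the pair `(y, t)`
of this cell whose product is cheapest, so its cost is bounded by that of the true pair without any
monotonicity of `MM`. Replacing `x` and `s` by `y` and `t` changes them by factors below `2`, which
affects only the constant success probability. -/
theorem exists_cellPhase (hh : 1 ≤ h) (enc : K → Fin κ → Msg n) (henc : Function.Injective enc)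
    (a b : ℕ) :
    ∃ Φ : Phase n, (∀ adj ρ, Φ.found adj ρ → ∃ v, IsCycleTuple adj h v) ∧
      ∀ x s r, Nat.log 2 x = a → Nat.log 2 s = b → 1 ≤ x → x ≤ n → 1 ≤ s → s ≤ n → s ≤ x * x →
        ProductSolvable K n ⌈(n : ℝ) / x⌉₊ s r →
        Φ.rounds ≤ phaseConstant h κ * (r + 1) ∧
        ∀ adj, (cycleVertices adj h).ncard = x →
          8 * (s * Nat.card {v // IsCycleTuple adj h v}) ≤ (4 * h * x) ^ h →
          x ^ h ≤ 2 * h * (s * Nat.card {v // IsCycleTuple adj h v}) →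
          phaseProb h ≤ pr (Φ.found adj) := by
  classical
  by_cases hex : ∃ r y s, Nat.log 2 y = a ∧ Nat.log 2 s = b ∧ 1 ≤ y ∧ y ≤ n ∧ 1 ≤ s ∧ s ≤ n ∧
      s ≤ y * y ∧ ProductSolvable K n ⌈(n : ℝ) / y⌉₊ s r
  · obtain ⟨y, t, hya, htb, hy, hyn, ht, htn, hty, H⟩ := Nat.find_spec hex
    obtain ⟨Φ, hΦ, hsound, hprob⟩ := exists_tuplePhase hh enc henc hy hyn ht htn hty H
    refine ⟨Φ, hsound, fun x s r hxa hsb hx hxn hs hsn hsx Hx => ⟨hΦ.trans ?_, ?_⟩⟩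
    · exact Nat.mul_le_mul_left _ (Nat.succ_le_succ
        (Nat.find_min' hex ⟨x, s, hxa, hsb, hx, hxn, hs, hsn, hsx, Hx⟩))
    · intro adj hadj h8 hlow
      have hxy := lt_two_mul_of_log_eq (Nat.one_le_iff_ne_zero.1 hy) (hxa.trans hya.symm)
      have hyx := lt_two_mul_of_log_eq (Nat.one_le_iff_ne_zero.1 hx) (hya.trans hxa.symm)
      have hst := lt_two_mul_of_log_eq (Nat.one_le_iff_ne_zero.1 ht) (hsb.trans htb.symm)
      have hts := lt_two_mul_of_log_eq (Nat.one_le_iff_ne_zero.1 hs) (htb.trans hsb.symm)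
      have hp := hprob adj (by omega)
      generalize Nat.card {v // IsCycleTuple adj h v} = M at *
      have hup : (t : ℝ) * M ≤ (8 * h * y : ℝ) ^ h / 4 := by
        rw [le_div_iff₀ (by norm_num)]
        have h1 : t * M * 4 ≤ (8 * h * y) ^ h :=
          calc t * M * 4 ≤ (2 * s) * M * 4 := by gcongr
            _ = 8 * (s * M) := by ring
            _ ≤ (4 * h * x) ^ h := h8
            _ ≤ (4 * h * (2 * y)) ^ h := by gcongr
            _ = (8 * h * y) ^ h := by ring
        exact_mod_cast h1
      refine le_trans ?_ (hp hup)
      have hh0 : (0 : ℝ) < h := by exact_mod_cast hh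
      have hy0 : (0 : ℝ) < y := by exact_mod_cast hy
      have hx0 : (0 : ℝ) < x := by exact_mod_cast hx
      have hlow' : (x : ℝ) ^ h ≤ 4 * h * (t * M) := by
        have : x ^ h ≤ 4 * h * (t * M) :=
          calc x ^ h ≤ 2 * h * (s * M) := hlow
            _ ≤ 2 * h * (2 * t * M) := by gcongr
            _ = _ := by ring
        exact_mod_cast this
      have hyx' : (y : ℝ) ≤ 2 * x := by exact_mod_cast hyx.le
      rw [phaseProb, div_le_div_iff₀ (by positivity) (by positivity), one_mul]
      calc 4 * (h : ℝ) ^ h * (8 * h * y) ^ h ≤ 4 * (h : ℝ) ^ h * (8 * h * (2 * x)) ^ h := by gcongr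
        _ = 4 * (h : ℝ) ^ h * (16 * h) ^ h * x ^ h := by
          rw [show (8 * h * (2 * x) : ℝ) = 16 * h * x by ring, mul_pow (16 * h : ℝ), ← mul_assoc]
        _ ≤ 4 * (h : ℝ) ^ h * (16 * h) ^ h * (4 * h * (t * M)) := by gcongr
        _ = _ := by ring
  · obtain ⟨Φ, hΦ⟩ := exists_trivialPhase n
    refine ⟨Φ, fun adj ρ hf => (hΦ adj ρ hf).elim, fun x s r hxa hsb hx hxn hs hsn hsx Hx => ?_⟩
    exact (hex ⟨r, x, s, hxa, hsb, hx, hxn, hs, hsn, hsx, Hx⟩).elim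

theorem exists_fastest_throughPhase (hh : 1 ≤ h) (enc : K → Fin κ → Msg n)
    (henc : Function.Injective enc) {X : ℕ} (hX : 1 ≤ X) :
    ∃ Φ : Phase n, (∀ adj ρ, Φ.found adj ρ → ∃ v, IsCycleTuple adj h v) ∧
      (X * X ≤ n → ∀ r, ProductSolvable K n ⌈(n : ℝ) / X⌉₊ (X * X) r →
        Φ.rounds ≤ phaseConstant h κ * (r + 1) ∧
        ∀ adj, X ≤ (cycleVertices adj h).ncard → phaseProb h ≤ pr (Φ.found adj)) := by
  classical
  by_cases hex : X * X ≤ n ∧ ∃ r, ProductSolvable K n ⌈(n : ℝ) / X⌉₊ (X * X) r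
  · obtain ⟨Φ, hΦ, hsound, hprob⟩ :=
      exists_throughPhase hh enc henc hX hex.1 (Nat.find_spec hex.2)
    refine ⟨Φ, hsound, fun _ r H => ⟨hΦ.trans ?_, fun adj hadj => le_trans ?_ (hprob adj hadj)⟩⟩
    · exact Nat.mul_le_mul_left _ (Nat.succ_le_succ (Nat.find_min' hex.2 H))
    · have hh1 : (1 : ℝ) ≤ h := by exact_mod_cast hh
      refine one_div_le_one_div_of_le (by positivity) ?_
      have h1 : (1 : ℝ) ≤ (h : ℝ) ^ h := one_le_pow₀ hh1
      calc 2 * ((h : ℝ) + 1) ^ h ≤ 2 * (16 * h) ^ h := by gcongr; linarith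
        _ ≤ (16 * h * h ^ h) * (16 * h) ^ h := by
          gcongr
          nlinarith
  · obtain ⟨Φ, hΦ⟩ := exists_trivialPhase n
    exact ⟨Φ, fun adj ρ hf => (hΦ adj ρ hf).elim, fun hXn r H => (hex ⟨hXn, r, H⟩).elim⟩

theorem one_sub_pow_le_inv_pow {p : ℝ} (hp0 : 0 < p) (hp1 : p ≤ 1) (hn : 1 ≤ n) (γ : ℕ) :
    (1 - p) ^ (⌈γ / p⌉₊ * (Nat.log 2 n + 1)) ≤ 1 / (n : ℝ) ^ γ := by
  have hn0 : (0 : ℝ) < n := by exact_mod_cast hn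
  set L := Nat.log 2 n + 1
  have h1 : 1 - p ≤ Real.exp (-p) := by linarith [Real.add_one_le_exp (-p)]
  have h2 : (n : ℝ) ≤ Real.exp L :=
    calc (n : ℝ) ≤ 2 ^ L := by exact_mod_cast (Nat.lt_pow_succ_log_self one_lt_two n).le
      _ ≤ Real.exp 1 ^ L := by
        gcongr
        linarith [Real.add_one_le_exp (1 : ℝ)]
      _ = Real.exp L := by rw [← Real.exp_nat_mul, mul_one]
  calc (1 - p) ^ (⌈γ / p⌉₊ * L) ≤ Real.exp (-p) ^ (⌈γ / p⌉₊ * L) :=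
        pow_le_pow_left₀ (by linarith) h1 _
    _ = Real.exp (-(⌈γ / p⌉₊ * p * L)) := by
        rw [← Real.exp_nat_mul]
        congr 1
        push_cast
        ring
    _ ≤ Real.exp (-(γ * L)) := by
        refine Real.exp_le_exp.2 (neg_le_neg (mul_le_mul_of_nonneg_right ?_ (Nat.cast_nonneg _)))
        exact (div_le_iff₀ hp0).1 (Nat.le_ceil _)
    _ = 1 / Real.exp L ^ γ := by
        rw [Real.exp_neg, ← Real.exp_nat_mul, one_div]
    _ ≤ 1 / (n : ℝ) ^ γ := by gcongr

/-- The constant in the number of rounds of the detection algorithm. -/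
noncomputable def scheduleConstant (h κ γ C : ℕ) : ℕ :=
  2 * ⌈γ / phaseProb h⌉₊ * phaseConstant h κ * (C + 1) + 1

theorem schedule_rounds_le {h κ γ C L B : ℕ} {c r : ℕ} {b : ℝ} (hc : c ≤ 2 * L ^ 2) (hL : 1 ≤ L)
    (hr : r ≤ phaseConstant h κ * (B + 1)) (hb : 1 ≤ b) (hB : (B : ℝ) ≤ C * b) :
    ((c * (⌈γ / phaseProb h⌉₊ * L) * r + 1 : ℕ) : ℝ) ≤ scheduleConstant h κ γ C * L ^ 3 * b := by
  set t := ⌈γ / phaseProb h⌉₊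
  have h1 : c * (t * L) * r + 1 ≤ 2 * t * phaseConstant h κ * L ^ 3 * (B + 1) + L ^ 3 :=
    add_le_add (calc
      c * (t * L) * r ≤ 2 * L ^ 2 * (t * L) * (phaseConstant h κ * (B + 1)) := by gcongr
      _ = _ := by ring) (Nat.one_le_pow _ _ hL)
  have h2 : ((c * (t * L) * r + 1 : ℕ) : ℝ) ≤
      ((2 * t * phaseConstant h κ * L ^ 3 * (B + 1) + L ^ 3 : ℕ) : ℝ) := by exact_mod_cast h1
  refine h2.trans ?_
  rw [scheduleConstant]
  push_cast
  calc 2 * (t : ℝ) * phaseConstant h κ * L ^ 3 * (B + 1) + L ^ 3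
      ≤ 2 * (t : ℝ) * phaseConstant h κ * L ^ 3 * (C * b + b) + L ^ 3 * b :=
        add_le_add (mul_le_mul_of_nonneg_left (add_le_add hB hb) (by positivity))
          (le_mul_of_one_le_right (by positivity) hb)
    _ = _ := by ring

end Schedule

/-! ### The detection protocol and the choice of the scale of start nodes. -/

section Detection

variable {n h κ C γ : ℕ} {K : Type} [Field K] {ρ : ℝ}

/-- The phases are the `L * L` cells and the `L` dyadic scales of start nodes. The fallback is the
scale `X = 1`, which has constant success probability on every graph with a cycle and takes `O(n ^
ρ)` rounds. -/
theorem exists_cycleDetection_of_pos (hn : 1 ≤ n) (hh : 1 ≤ h) (hρ : 0 ≤ ρ)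
    (enc : K → Fin κ → Msg n) (henc : Function.Injective enc)
    (hK : ∀ (x : ℕ) (δ : ℝ), 1 ≤ x → x ≤ n → 0 ≤ δ → (x : ℝ) ^ δ ≤ n →
      ∃ r : ℕ, ProductSolvable K n ⌈(n : ℝ) / x⌉₊ ⌈(x : ℝ) ^ δ⌉₊ r ∧
        (r : ℝ) ≤ C * explicitBound n x ρ δ) :
    ∃ P : DetectionProtocol n,
      (∀ adj (R : ℕ), (scheduleConstant h κ γ C : ℝ) * ((Nat.log 2 n + 1 : ℕ) : ℝ) ^ 3 *
        (n : ℝ) ^ ρ ≤ R → ∀ c, ∃ b, AllAnswer P adj R c b) ∧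
      (∀ adj, (¬ ∃ v, IsCycleTuple adj h v) → ∀ R (c : P.Coins R) v,
        P.result (localView adj) R c v ≠ some true) ∧
      (∀ adj (x s r R : ℕ), (cycleVertices adj h).ncard = x → 1 ≤ x → x ≤ n → 1 ≤ s → s ≤ n →
        s ≤ x * x → 8 * (s * Nat.card {v // IsCycleTuple adj h v}) ≤ (4 * h * x) ^ h →
        x ^ h ≤ 2 * h * (s * Nat.card {v // IsCycleTuple adj h v}) →
        ProductSolvable K n ⌈(n : ℝ) / x⌉₊ s r →
        (scheduleConstant h κ γ 1 : ℝ) * ((Nat.log 2 n + 1 : ℕ) : ℝ) ^ 3 * (r + 1) ≤ R →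
        DetectsWhp P adj γ R) ∧
      (∀ adj (a R : ℕ), 2 ^ a ≤ (cycleVertices adj h).ncard → 2 ^ a * 2 ^ a ≤ n →
        (scheduleConstant h κ γ C : ℝ) * ((Nat.log 2 n + 1 : ℕ) : ℝ) ^ 3 *
          explicitBound n (2 ^ a) ρ 2 ≤ R → DetectsWhp P adj γ R) := by
  set L := Nat.log 2 n + 1 with hL
  have hL1 : 1 ≤ L := Nat.le_add_left _ _
  have hlog : ∀ {a}, a ≤ n → Nat.log 2 a < L := fun ha => Nat.lt_succ_of_le (Nat.log_mono_right ha)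
  choose cell hcell1 hcell2 using fun i : Fin L × Fin L =>
    exists_cellPhase (h := h) hh enc henc i.1 i.2
  choose thr hthr1 hthr2 using fun a : Fin L =>
    exists_fastest_throughPhase (h := h) hh enc henc (X := 2 ^ (a : ℕ)) Nat.one_le_two_pow
  let ph : (Fin L × Fin L) ⊕ Fin L → Phase n := Sum.elim cell thr
  let i₀ : (Fin L × Fin L) ⊕ Fin L := .inr ⟨0, hL1⟩
  have hcard : Nat.card ((Fin L × Fin L) ⊕ Fin L) ≤ 2 * L ^ 2 := by
    rw [Nat.card_sum, Nat.card_prod, Nat.card_fin]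
    nlinarith
  have hr : ∀ a : ℕ, 2 ^ a * 2 ^ a ≤ n → ∃ r : ℕ,
      ProductSolvable K n ⌈(n : ℝ) / (2 ^ a : ℕ)⌉₊ (2 ^ a * 2 ^ a) r ∧
        (r : ℝ) ≤ C * explicitBound n (2 ^ a) ρ 2 := by
    intro a ha
    have e : ((2 ^ a : ℕ) : ℝ) ^ (2 : ℝ) = ((2 ^ a * 2 ^ a : ℕ) : ℝ) := by
      rw [Real.rpow_two]; push_cast; ring
    obtain ⟨r, h1, h2⟩ := hK (2 ^ a) 2 Nat.one_le_two_pow ((Nat.le_mul_self _).trans ha)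
      zero_le_two (by rw [e]; exact_mod_cast ha)
    rw [e, Nat.ceil_natCast] at h1
    exact ⟨r, h1, h2⟩
  obtain ⟨r₀, hr₀, hr₀'⟩ := hr 0 (by simpa using hn)
  have h₀ := hthr2 ⟨0, hL1⟩ (by simpa using hn) r₀ hr₀
  have hn1 : (1 : ℝ) ≤ (n : ℝ) ^ ρ := Real.one_le_rpow (by exact_mod_cast hn) hρ
  have e₀ : explicitBound n (2 ^ 0) ρ 2 = (n : ℝ) ^ ρ := by
    rw [explicitBound, pow_zero, Nat.cast_one, Real.one_rpow, mul_one, max_eq_right hn1]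
  rw [e₀] at hr₀'
  obtain ⟨P, hhalt, hsound, hprob⟩ :=
    exists_detectionProtocol ph (⌈γ / phaseProb h⌉₊ * L) i₀
  have hwhp : ∀ adj i R, phaseProb h ≤ pr ((ph i).found adj) → (ph i).rounds ≤ (ph i₀).rounds →
      Nat.card ((Fin L × Fin L) ⊕ Fin L) * (⌈γ / phaseProb h⌉₊ * L) * (ph i).rounds + 1 ≤ R →
      DetectsWhp P adj γ R := by
    intro adj i R hp hi hR
    refine le_trans ?_ (hprob adj i R hi hR)
    have h1 := one_sub_pow_le_inv_pow (phaseProb_pos hh) (hp.trans (pr_le_one _)) hn γ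
    have h2 : (1 - pr ((ph i).found adj)) ^ (⌈γ / phaseProb h⌉₊ * L) ≤
        (1 - phaseProb h) ^ (⌈γ / phaseProb h⌉₊ * L) :=
      pow_le_pow_left₀ (by linarith [pr_le_one ((ph i).found adj)]) (by linarith) _
    linarith
  have hdet : ∀ adj i (R : ℕ) (B C' : ℕ) (b : ℝ), phaseProb h ≤ pr ((ph i).found adj) →
      1 ≤ (cycleVertices adj h).ncard → (ph i).rounds ≤ phaseConstant h κ * (B + 1) → 1 ≤ b →
      (B : ℝ) ≤ C' * b → (scheduleConstant h κ γ C' : ℝ) * (L : ℝ) ^ 3 * b ≤ R →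
      DetectsWhp P adj γ R := by
    intro adj i R B C' b hp hx hi hb hB hR
    -- A phase slower than the fallback may be missing from the schedule, but then the fallback
    -- itself succeeds within the time claimed for it.
    rcases le_total (ph i).rounds (ph i₀).rounds with hle | hle
    · refine hwhp adj i R hp hle ?_
      exact_mod_cast (schedule_rounds_le hcard hL1 hi hb hB).trans hR
    · refine hwhp adj i₀ R (h₀.2 adj (by simpa using hx)) le_rfl ?_
      exact_mod_cast (schedule_rounds_le hcard hL1 (hle.trans hi) hb hB).trans hR
  refine ⟨P, ?_, ?_, ?_, ?_⟩
  · intro adj R hR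
    refine hhalt adj R ?_
    exact_mod_cast (schedule_rounds_le hcard hL1 h₀.1 hn1 hr₀').trans hR
  · intro adj hadj
    refine hsound adj ?_
    rintro (i | i) ω hf
    · exact hadj (hcell1 i adj ω hf)
    · exact hadj (hthr1 i adj ω hf)
  · intro adj x s r R hx hx1 hxn hs hsn hsx h8 hlow H hR
    obtain ⟨hrounds, hp⟩ := hcell2 (⟨_, hlog hxn⟩, ⟨_, hlog hsn⟩) x s r rfl rfl hx1 hxn hs hsn hsx H
    refine hdet adj (.inl (⟨_, hlog hxn⟩, ⟨_, hlog hsn⟩)) R r 1 (r + 1) (hp adj hx h8 hlow)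
      (hx ▸ hx1) hrounds ?_ ?_ hR
    · linarith [Nat.cast_nonneg (α := ℝ) r]
    · push_cast; linarith
  · intro adj a R hx ha hR
    obtain ⟨r, H, hrC⟩ := hr a ha
    have haL : a < L := by
      have := hlog ((Nat.le_mul_self _).trans ha)
      rwa [Nat.log_pow one_lt_two] at this
    obtain ⟨hrounds, hp⟩ := hthr2 ⟨a, haL⟩ ha r H
    exact hdet adj (.inr ⟨a, haL⟩) R r C _ (hp adj hx) (Nat.one_le_two_pow.trans hx) hrounds
      (explicitBound_ge_one _ _ _ _) hrC hR

/-- A finite time bound forces the infimum `MM` to be finite, and an infimum of natural numbers is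
then attained. -/
theorem exists_productSolvable_of_MM_add_one_le {k s R A : ℕ} (hA : 1 ≤ A)
    (hR : (A : ℕ∞) * (MM K n k s + 1) ≤ R) :
    ∃ r, ProductSolvable K n k s r ∧ A * (r + 1) ≤ R := by
  have h1 : MM K n k s < (R : ℕ∞) :=
    calc MM K n k s < MM K n k s + 1 := by
          refine ENat.lt_add_one_iff ?_ |>.2 le_rfl
          rintro h
          rw [h, top_add, ENat.mul_top (by exact_mod_cast (Nat.one_le_iff_ne_zero.1 hA))] at hR
          exact absurd hR (by simp)
      _ ≤ A * (MM K n k s + 1) := le_mul_of_one_le_left (by simp) (by exact_mod_cast hA)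
      _ ≤ R := hR
  obtain ⟨m, hm⟩ := ENat.ne_top_iff_exists.1 (h1.trans (ENat.natCast_lt_top R)).ne
  rw [← hm] at hR
  have h2 : MM K n k s < ((m + 1 : ℕ) : ℕ∞) := by
    rw [← hm]
    exact_mod_cast Nat.lt_succ_self m
  simp only [MM, iInf_lt_iff] at h2
  obtain ⟨r, H, hr⟩ := h2
  have h3 : r ≤ m := Nat.lt_succ_iff.1 (by exact_mod_cast hr)
  refine ⟨r, H, le_trans (Nat.mul_le_mul_left _ (Nat.succ_le_succ h3)) ?_⟩
  exact_mod_cast hR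

theorem explicitBound_eq_max_div_rpow (n : ℕ) {x : ℕ} (hx : 1 ≤ x) (ρ : ℝ) :
    explicitBound n x ρ 2 = max 1 (((n : ℝ) / (x * x)) ^ ρ) := by
  have hx0 : (0 : ℝ) < x := by exact_mod_cast hx
  rw [explicitBound, Real.div_rpow (Nat.cast_nonneg _) (by positivity), div_eq_mul_inv,
    ← Real.rpow_neg (by positivity), ← pow_two, ← Real.rpow_natCast, ← Real.rpow_mul hx0.le]
  congr 3
  push_cast
  ring

theorem explicitBound_mono (n : ℕ) {x : ℕ} (hx : 1 ≤ x) {ρ δ ε : ℝ} (hρ : ρ ≤ 1) (h : δ ≤ ε) :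
    explicitBound n x ρ δ ≤ explicitBound n x ρ ε := by
  unfold explicitBound
  gcongr ?_ ⊔ ?_ * ?_
  · exact le_rfl
  · refine Real.rpow_le_rpow_of_exponent_le (by exact_mod_cast hx) ?_
    nlinarith

/-- The exponent `δ` may be slightly negative, as the count `m` can exceed `x ^ h` by a constant
factor. Then `x ^ (-δ)` is bounded, and the case `δ = 0` can be used instead. -/
theorem explicitBound_zero_le (n : ℕ) {x : ℕ} (hx : 1 ≤ x) {ρ δ c : ℝ} (hρ0 : 0 ≤ ρ)
    (hδ : δ ≤ 0) (hc : (x : ℝ) ^ (-δ) ≤ c) :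
    explicitBound n x ρ 0 ≤ c * explicitBound n x ρ δ := by
  have hx1 : (1 : ℝ) ≤ x := by exact_mod_cast hx
  have hc1 : 1 ≤ c := (Real.one_le_rpow hx1 (by linarith)).trans hc
  unfold explicitBound
  refine max_le ?_ ?_
  · nlinarith [le_max_left 1 ((n : ℝ) ^ ρ * (x : ℝ) ^ (-(2 + δ * (ρ - 1))))]
  · have h1 : (x : ℝ) ^ (-(2 + 0 * (ρ - 1))) ≤ c * (x : ℝ) ^ (-(2 + δ * (ρ - 1))) :=
      calc (x : ℝ) ^ (-(2 + 0 * (ρ - 1))) ≤ (x : ℝ) ^ (-δ + -(2 + δ * (ρ - 1))) :=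
            Real.rpow_le_rpow_of_exponent_le hx1 (by nlinarith)
        _ = (x : ℝ) ^ (-δ) * (x : ℝ) ^ (-(2 + δ * (ρ - 1))) := Real.rpow_add (by linarith) _ _
        _ ≤ _ := by gcongr
    calc (n : ℝ) ^ ρ * (x : ℝ) ^ (-(2 + 0 * (ρ - 1)))
        ≤ (n : ℝ) ^ ρ * (c * (x : ℝ) ^ (-(2 + δ * (ρ - 1)))) := by gcongr
      _ = c * ((n : ℝ) ^ ρ * (x : ℝ) ^ (-(2 + δ * (ρ - 1)))) := by ring
      _ ≤ _ := by gcongr; exact le_max_right _ _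

/-- The search through start nodes costs `(n / (X * X)) ^ ρ`, so `X` should be as large as `X ≤ x`
and `X * X ≤ n` permit; rounding to a power of two loses at most `4 ^ ρ`. If `x` is the smaller
limit, the bound at `δ = 2` is the relevant one; otherwise the cost is constant. -/
theorem exists_two_pow_explicitBound_le {x : ℕ} (hn : 1 ≤ n) (hx : 1 ≤ x) {δ : ℝ} (hρ0 : 0 ≤ ρ)
    (hρ : ρ ≤ 1) (H : 2 ≤ δ ∨ n ≤ x * x) :
    ∃ a : ℕ, 2 ^ a ≤ x ∧ 2 ^ a * 2 ^ a ≤ n ∧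
      explicitBound n (2 ^ a) ρ 2 ≤ 4 * explicitBound n x ρ δ := by
  have hs : 1 ≤ Nat.sqrt n := Nat.le_sqrt.2 (by simpa using hn)
  set z := min x (Nat.sqrt n) with hz
  have hz1 : 1 ≤ z := le_min hx hs
  have ha := Nat.pow_log_le_self 2 (Nat.one_le_iff_ne_zero.1 hz1)
  have ha' : z < 2 * 2 ^ Nat.log 2 z := by
    have := Nat.lt_pow_succ_log_self one_lt_two z
    rwa [pow_succ, mul_comm] at this
  set a := Nat.log 2 z
  refine ⟨a, ha.trans (min_le_left _ _), ?_, ?_⟩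
  · exact (Nat.mul_self_le_mul_self (ha.trans (min_le_right _ _))).trans (Nat.sqrt_le n)
  have hX : (0 : ℝ) < ((2 ^ a : ℕ) : ℝ) := by positivity
  have hx0 : (0 : ℝ) < x := by exact_mod_cast hx
  have hb1 := explicitBound_ge_one n x ρ δ
  have h4 : (4 : ℝ) ^ ρ ≤ 4 := by
    simpa using Real.rpow_le_rpow_of_exponent_le (by norm_num : (1 : ℝ) ≤ 4) hρ
  rw [explicitBound_eq_max_div_rpow n Nat.one_le_two_pow]
  refine max_le (by linarith) ?_
  rcases le_total (x : ℕ) (Nat.sqrt n) with hxs | hxs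
  · have hzx : z = x := min_eq_left hxs
    have hbd : explicitBound n x ρ 2 ≤ explicitBound n x ρ δ := by
      rcases H with H | H
      · exact explicitBound_mono n hx hρ H
      · rw [explicitBound_eq_max_div_rpow n hx]
        refine max_le hb1 (le_trans (Real.rpow_le_one (by positivity) ?_ hρ0) hb1)
        rw [div_le_one (by positivity)]
        exact_mod_cast H
    have h1 : (n : ℝ) / (((2 ^ a : ℕ) : ℝ) * ((2 ^ a : ℕ) : ℝ)) ≤ 4 * (n / (x * x)) := by
      have h2 : (x : ℝ) ≤ 2 * ((2 ^ a : ℕ) : ℝ) := by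
        rw [hzx] at ha'
        exact_mod_cast ha'.le
      rw [← mul_div_assoc, div_le_div_iff₀ (by positivity) (by positivity)]
      have h3 := mul_le_mul h2 h2 hx0.le (by positivity)
      nlinarith [Nat.cast_nonneg (α := ℝ) n]
    calc _ ≤ (4 * ((n : ℝ) / (x * x))) ^ ρ := by gcongr
      _ = 4 ^ ρ * ((n : ℝ) / (x * x)) ^ ρ := Real.mul_rpow (by norm_num) (by positivity)
      _ ≤ 4 * explicitBound n x ρ 2 := by
        rw [explicitBound_eq_max_div_rpow n hx]
        gcongr
        exact le_max_right _ _
      _ ≤ _ := by gcongr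
  · have hzx : z = Nat.sqrt n := min_eq_right hxs
    have h1 : (n : ℝ) / (((2 ^ a : ℕ) : ℝ) * ((2 ^ a : ℕ) : ℝ)) ≤ 4 := by
      rw [div_le_iff₀ (by positivity)]
      have h2 := Nat.lt_succ_sqrt n
      rw [hzx] at ha'
      have h3 : n ≤ 4 * (2 ^ a * 2 ^ a) :=
        h2.le.trans ((Nat.mul_self_le_mul_self ha').trans (le_of_eq (by ring)))
      exact_mod_cast h3
    calc _ ≤ (4 : ℝ) ^ ρ := by gcongr
      _ ≤ 4 * explicitBound n x ρ δ := by linarith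

end Detection

/-! ### From the phases to the guarantees. -/

section Guarantees

variable {n h κ γ : ℕ} {K : Type} [Field K] {ρ : ℝ}

/-- The constant in the guarantees, for `MM`-bounds with constant `C`. -/
noncomputable def guaranteeConstant (h κ γ C : ℕ) : ℕ :=
  4 * (scheduleConstant h κ γ C + scheduleConstant h κ γ 1) * ((C + 1) * (h + 1)) + C + 3

theorem polylog_guaranteeConstant_ge {C D c : ℕ} (hD : D ≤ scheduleConstant h κ γ C +
    scheduleConstant h κ γ 1) (hc : c ≤ 4 * ((C + 1) * (h + 1))) :
    D * (Nat.log 2 n + 1) ^ 3 * c ≤ polylog (guaranteeConstant h κ γ C) n := by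
  unfold polylog
  calc D * (Nat.log 2 n + 1) ^ 3 * c
      ≤ (scheduleConstant h κ γ C + scheduleConstant h κ γ 1) * (Nat.log 2 n + 1) ^ 3 *
          (4 * ((C + 1) * (h + 1))) := by gcongr
    _ = 4 * (scheduleConstant h κ γ C + scheduleConstant h κ γ 1) * ((C + 1) * (h + 1)) *
          (Nat.log 2 n + 1) ^ 3 := by ring
    _ ≤ _ := by
      refine Nat.mul_le_mul ?_ (Nat.pow_le_pow_right (Nat.le_add_left _ _) ?_)
      · unfold guaranteeConstant; omega
      · unfold guaranteeConstant; omega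

theorem cast_polylog_guaranteeConstant_ge {C D : ℕ} {c b : ℝ} (hD : D ≤ scheduleConstant h κ γ C +
    scheduleConstant h κ γ 1) (hc : c ≤ 4 * ((C + 1) * (h + 1))) (hb : 0 ≤ b) :
    (D : ℝ) * ((Nat.log 2 n + 1 : ℕ) : ℝ) ^ 3 * (c * b) ≤
      (polylog (guaranteeConstant h κ γ C) n : ℝ) * b := by
  have h1 : ((D * (Nat.log 2 n + 1) ^ 3 * (4 * ((C + 1) * (h + 1))) : ℕ) : ℝ) ≤
      (polylog (guaranteeConstant h κ γ C) n : ℝ) := by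
    exact_mod_cast polylog_guaranteeConstant_ge hD le_rfl
  rw [← mul_assoc]
  refine mul_le_mul_of_nonneg_right (le_trans ?_ h1) hb
  push_cast
  gcongr

theorem ncard_cycleVertices_pos {adj : Fin n → Fin n → Prop} {m : ℕ} (hh : 1 ≤ h)
    (hm : CountsCycles adj h m) (hm0 : m ≠ 0) : 1 ≤ (cycleVertices adj h).ncard := by
  by_contra h0
  have h1 := card_cycleTuple_le adj h
  rw [Nat.lt_one_iff.1 (not_le.1 h0), zero_pow (Nat.one_le_iff_ne_zero.1 hh)] at h1
  have h2 := hm.le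
  rw [Nat.le_zero.1 h1] at h2
  exact hm0 (Nat.le_zero.1 (by simpa using h2))

/-- The number of cyclic tuples is `m = x ^ (h - δ)` up to constants, so its product with `x ^ δ` is
about `x ^ h`. The rounding of `x ^ δ` is absorbed by the trivial bound of `x ^ h` on the number of
tuples, and `16 ≤ 4 ^ h` by `2 ≤ h`. -/
theorem ceil_rpow_mul_card_bounds {adj : Fin n → Fin n → Prop} {m : ℕ} {δ : ℝ} (hh : 2 ≤ h)
    (hm : CountsCycles adj h m) (hx : 1 ≤ (cycleVertices adj h).ncard)
    (hδ : ((cycleVertices adj h).ncard : ℝ) ^ ((h : ℝ) - δ) = m) :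
    8 * (⌈((cycleVertices adj h).ncard : ℝ) ^ δ⌉₊ * Nat.card {v // IsCycleTuple adj h v}) ≤
      (4 * h * (cycleVertices adj h).ncard) ^ h ∧
    (cycleVertices adj h).ncard ^ h ≤
      2 * h * (⌈((cycleVertices adj h).ncard : ℝ) ^ δ⌉₊ * Nat.card {v // IsCycleTuple adj h v}) := by
  have hMx := card_cycleTuple_le adj h
  obtain ⟨hle, hge⟩ := hm
  generalize Nat.card {v // IsCycleTuple adj h v} = M at *
  generalize (cycleVertices adj h).ncard = x at *
  have hx0 : (0 : ℝ) < x := by exact_mod_cast hx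
  have hxm : (x : ℝ) ^ δ * m = (x : ℝ) ^ h := by
    rw [← hδ, ← Real.rpow_add hx0, add_sub_cancel, Real.rpow_natCast]
  have hle' : (m : ℝ) ≤ 2 * h * M := by exact_mod_cast hle
  have hge' : (M : ℝ) ≤ (h : ℝ) ^ h * m := by exact_mod_cast hge
  have hMx' : (M : ℝ) ≤ (x : ℝ) ^ h := by exact_mod_cast hMx
  have hs1 := Nat.le_ceil ((x : ℝ) ^ δ)
  have hs2 := (Nat.ceil_lt_add_one (Real.rpow_nonneg hx0.le δ)).le
  have hp : 0 ≤ (x : ℝ) ^ δ := Real.rpow_nonneg hx0.le δ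
  generalize ⌈(x : ℝ) ^ δ⌉₊ = s at *
  have hh1 : (1 : ℝ) ≤ (h : ℝ) ^ h := one_le_pow₀ (by exact_mod_cast (by omega : 1 ≤ h))
  have h16 : (16 : ℝ) ≤ 4 ^ h := by
    calc (16 : ℝ) = 4 ^ 2 := by norm_num
      _ ≤ 4 ^ h := pow_le_pow_right₀ (by norm_num) hh
  constructor
  · have h1 : (8 * (s * M) : ℝ) ≤ (4 * h * x) ^ h :=
      calc (8 * (s * M) : ℝ) ≤ 8 * (((x : ℝ) ^ δ + 1) * M) := by gcongr
        _ = 8 * ((x : ℝ) ^ δ * M + M) := by ring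
        _ ≤ 8 * ((x : ℝ) ^ δ * ((h : ℝ) ^ h * m) + (h : ℝ) ^ h * (x : ℝ) ^ h) := by
          have : (M : ℝ) ≤ (h : ℝ) ^ h * (x : ℝ) ^ h :=
            hMx'.trans (le_mul_of_one_le_left (by positivity) hh1)
          gcongr
        _ = 16 * ((h : ℝ) ^ h * (x : ℝ) ^ h) := by
          rw [mul_left_comm, hxm]; ring
        _ ≤ 4 ^ h * ((h : ℝ) ^ h * (x : ℝ) ^ h) := by gcongr
        _ = _ := by rw [mul_pow, mul_pow, mul_assoc]
    exact_mod_cast h1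
  · have h1 : (x : ℝ) ^ h ≤ 2 * h * (s * M) :=
      calc (x : ℝ) ^ h = (x : ℝ) ^ δ * m := hxm.symm
        _ ≤ s * (2 * h * M) := by gcongr
        _ = _ := by ring
    exact_mod_cast h1

theorem exists_guarantee (hh : 2 ≤ h) (hρ0 : 0 ≤ ρ) (hρ : ρ ≤ 1)
    (enc : K → Fin κ → Msg n) (henc : Function.Injective enc) {C : ℕ}
    (hK : ∀ (x : ℕ) (δ : ℝ), 1 ≤ x → x ≤ n → 0 ≤ δ → (x : ℝ) ^ δ ≤ n →
      ∃ r : ℕ, ProductSolvable K n ⌈(n : ℝ) / x⌉₊ ⌈(x : ℝ) ^ δ⌉₊ r ∧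
        (r : ℝ) ≤ C * explicitBound n x ρ δ) :
    ∃ P : DetectionProtocol n, ∀ adj m, CountsCycles adj h m →
      Guarantee K ρ h γ (guaranteeConstant h κ γ C) P adj m := by
  have hh1 : 1 ≤ h := by omega
  -- Without nodes there are no cycles, and statements about all nodes are vacuous.
  rcases Nat.eq_zero_or_pos n with rfl | hn
  · obtain ⟨Φ, -⟩ := exists_trivialPhase 0
    obtain ⟨P, -⟩ := exists_detectionProtocol (fun _ : Unit => Φ) 0 ()
    have hno : ∀ (adj : Fin 0 → Fin 0 → Prop) m, CountsCycles adj h m → m ≠ 0 → False := fun adj m hm hm0 => by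
      have h1 := ncard_cycleVertices_pos hh1 hm hm0
      rw [Set.eq_empty_of_isEmpty (cycleVertices adj h), Set.ncard_empty] at h1
      omega
    exact ⟨P, fun adj m hm => ⟨fun _ _ _ => ⟨true, fun v => v.elim0⟩, fun _ _ _ v => v.elim0,
      fun hm0 => (hno adj m hm hm0).elim, fun hm0 => (hno adj m hm hm0).elim⟩⟩
  obtain ⟨P, hhalt, hsound, hcell, hthr⟩ :=
    exists_cycleDetection_of_pos (γ := γ) hn hh1 hρ0 enc henc hK
  have hc1 : (1 : ℝ) ≤ (C + 1) * (h + 1) := by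
    exact_mod_cast Nat.mul_pos (Nat.succ_pos C) (Nat.succ_pos h)
  refine ⟨P, fun adj m hm => ⟨?_, ?_, ?_, ?_⟩⟩
  · intro R hR
    refine hhalt adj R (le_trans ?_ hR)
    have := cast_polylog_guaranteeConstant_ge (n := n) (h := h) (κ := κ) (γ := γ) (C := C) (c := 1)
      (b := (n : ℝ) ^ ρ) (Nat.le_add_right (scheduleConstant h κ γ C) _) (by linarith)
      (by positivity)
    rwa [one_mul] at this
  · intro hm0
    refine hsound adj ?_
    rintro ⟨v, hv⟩
    have h1 : 0 < Nat.card {v // IsCycleTuple adj h v} := Nat.card_pos_iff.2 ⟨⟨v, hv⟩, inferInstance⟩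
    have h2 := hm.ge
    rw [hm0, mul_zero] at h2
    omega
  · intro hm0 x δ hx hδ hδ2 hxδ R hR
    have hx1 := ncard_cycleVertices_pos hh1 hm hm0
    obtain ⟨h8, hlow⟩ := ceil_rpow_mul_card_bounds hh hm hx1 (hx ▸ hδ)
    rw [← hx] at hx1 h8 hlow
    have hxn : x ≤ n := by
      simpa [hx] using Set.ncard_le_card (cycleVertices adj h)
    have hpos : 1 ≤ polylog (guaranteeConstant h κ γ C) n := by
      unfold polylog guaranteeConstant
      exact Nat.mul_pos (by omega) (by positivity)
    obtain ⟨r, H, hr⟩ := exists_productSolvable_of_MM_add_one_le hpos hR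
    have hx0 : (1 : ℝ) ≤ x := by exact_mod_cast hx1
    refine hcell adj x _ r R hx.symm hx1 hxn (Nat.ceil_pos.2 (Real.rpow_pos_of_pos (by linarith) _))
      (Nat.ceil_le.2 hxδ) (Nat.ceil_le.2 ?_) h8 hlow H ?_
    · calc (x : ℝ) ^ δ ≤ (x : ℝ) ^ (2 : ℝ) := Real.rpow_le_rpow_of_exponent_le hx0 hδ2
        _ = ((x * x : ℕ) : ℝ) := by rw [Real.rpow_two]; push_cast; ring
    · have h1 := polylog_guaranteeConstant_ge (n := n) (h := h) (κ := κ) (γ := γ) (C := C) (c := 1)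
        (Nat.le_add_left (scheduleConstant h κ γ 1) _) (by
          have : 0 < (C + 1) * (h + 1) := by positivity
          omega)
      rw [mul_one] at h1
      exact_mod_cast (Nat.mul_le_mul_right _ h1).trans hr
  · intro hm0 x δ hx hδ R hR
    have hx1 := ncard_cycleVertices_pos hh1 hm hm0
    obtain ⟨h8, hlow⟩ := ceil_rpow_mul_card_bounds hh hm hx1 (hx ▸ hδ)
    have hxM := card_cycleTuple_le adj h
    rw [← hx] at hx1 h8 hlow hxM
    have hxn : x ≤ n := by
      simpa [hx] using Set.ncard_le_card (cycleVertices adj h)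
    have hx0 : (1 : ℝ) ≤ x := by exact_mod_cast hx1
    have hxp : (0 : ℝ) < x := by linarith
    have hb := explicitBound_ge_one n x ρ δ
    -- In this range the cell of `x` and `⌈x ^ δ⌉₊` is used, outside of it the search through start
    -- nodes.
    by_cases hcase : δ ≤ 2 ∧ (x : ℝ) ^ δ ≤ n
    · obtain ⟨hδ2, hxδ⟩ := hcase
      have hr : ∃ r : ℕ, ProductSolvable K n ⌈(n : ℝ) / x⌉₊ ⌈(x : ℝ) ^ δ⌉₊ r ∧
          (r : ℝ) ≤ C * (2 * h * explicitBound n x ρ δ) := by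
        rcases le_total 0 δ with h0 | h0
        · obtain ⟨r, H, hr⟩ := hK x δ hx1 hxn h0 hxδ
          refine ⟨r, H, hr.trans (mul_le_mul_of_nonneg_left ?_ (Nat.cast_nonneg _))⟩
          refine le_mul_of_one_le_left (by linarith) ?_
          exact_mod_cast (by omega : 1 ≤ 2 * h)
        · obtain ⟨r, H, hr⟩ := hK x 0 hx1 hxn le_rfl
            (by rw [Real.rpow_zero]; exact_mod_cast hn)
          -- For `δ ≤ 0` a single tuple is examined, just as for `δ = 0`.
          have e : ⌈(x : ℝ) ^ δ⌉₊ = 1 := by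
            refine le_antisymm (Nat.ceil_le.2 ?_) (Nat.ceil_pos.2 (Real.rpow_pos_of_pos hxp _))
            exact_mod_cast Real.rpow_le_one_of_one_le_of_nonpos hx0 h0
          rw [Real.rpow_zero, Nat.ceil_one] at H
          rw [e]
          refine ⟨r, H, hr.trans (mul_le_mul_of_nonneg_left ?_ (Nat.cast_nonneg _))⟩
          refine explicitBound_zero_le n hx1 hρ0 h0 ?_
          have hxh : (0 : ℝ) < (x : ℝ) ^ h := by positivity
          have h1 : (m : ℝ) ≤ 2 * h * (x : ℝ) ^ h := by
            exact_mod_cast hm.le.trans (Nat.mul_le_mul_left _ hxM)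
          rw [← hδ, sub_eq_add_neg, Real.rpow_add hxp, Real.rpow_natCast, mul_comm] at h1
          exact le_of_mul_le_mul_right h1 hxh
      obtain ⟨r, H, hr⟩ := hr
      refine hcell adj x _ r R hx.symm hx1 hxn
        (Nat.ceil_pos.2 (Real.rpow_pos_of_pos (by linarith) _))
        (Nat.ceil_le.2 hxδ) (Nat.ceil_le.2 ?_) h8 hlow H ?_
      · calc (x : ℝ) ^ δ ≤ (x : ℝ) ^ (2 : ℝ) := Real.rpow_le_rpow_of_exponent_le hx0 hδ2
          _ = ((x * x : ℕ) : ℝ) := by rw [Real.rpow_two]; push_cast; ring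
      · refine le_trans ?_ ((cast_polylog_guaranteeConstant_ge (κ := κ) (γ := γ) (c := C * (2 * h) + 1)
          (Nat.le_add_left (scheduleConstant h κ γ 1) _) ?_ (zero_le_one.trans hb)).trans hR)
        · refine mul_le_mul_of_nonneg_left ?_ (by positivity)
          calc (r : ℝ) + 1 ≤ C * (2 * h * explicitBound n x ρ δ) + explicitBound n x ρ δ :=
                add_le_add hr hb
            _ = _ := by ring
        · exact_mod_cast (by nlinarith : C * (2 * h) + 1 ≤ 4 * ((C + 1) * (h + 1)))
    · have hcase' : 2 ≤ δ ∨ n ≤ x * x := by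
        rcases le_total 2 δ with h2 | h2
        · exact .inl h2
        · refine .inr ?_
          have h3 : (n : ℝ) < (x : ℝ) ^ δ := lt_of_not_ge fun h4 => hcase ⟨h2, h4⟩
          have h4 : (x : ℝ) ^ δ ≤ ((x * x : ℕ) : ℝ) :=
            calc (x : ℝ) ^ δ ≤ (x : ℝ) ^ (2 : ℝ) := Real.rpow_le_rpow_of_exponent_le hx0 h2
              _ = ((x * x : ℕ) : ℝ) := by rw [Real.rpow_two]; push_cast; ring
          exact_mod_cast (h3.le.trans h4)
      obtain ⟨a, ha1, ha2, ha3⟩ := exists_two_pow_explicitBound_le hn hx1 hρ0 hρ hcase'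
      refine hthr adj a R (hx ▸ ha1) ha2 (le_trans ?_
        ((cast_polylog_guaranteeConstant_ge (κ := κ) (γ := γ) (C := C) (c := 4)
          (Nat.le_add_right (scheduleConstant h κ γ C) _) (by linarith)
          (zero_le_one.trans hb)).trans hR))
      gcongr

end Guarantees

end CongestedClique

/-! ### The main theorem. -/

open CongestedClique in
theorem mainTheorem5
    (h : ℕ) (hh : 2 ≤ h)
    (K : ℕ → Type) [∀ n, Field (K n)] [∀ n, Finite (K n)]
    (κ : ℕ) (hκ : ∀ n, Nat.card (K n) ≤ 2 ^ (κ * (Nat.log 2 n + 1)))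
    (σ : ℝ) (hσ2 : 2 ≤ σ) (hσ : IsMatMulExponent K σ)
    (ρ : ℝ) (hρ : ρ = 1 - 2 / σ)
    (γ : ℕ) :
    ∃ (C : ℕ) (A : ∀ n, DetectionProtocol n),
      (∀ (n : ℕ) (D : Digraph (Fin n)),
        Guarantee (K n) ρ h γ C (A n) D.Adj (h * (directedCycles D h).ncard)) ∧
      (3 ≤ h → ∀ (n : ℕ) (G : SimpleGraph (Fin n)),
        Guarantee (K n) ρ h γ C (A n) G.Adj (2 * h * (undirectedCycles G h).ncard)) ∧
      (∀ (n x : ℕ) (δ : ℝ), 1 ≤ x → x ≤ n → 0 ≤ δ → δ ≤ 2 → (x : ℝ) ^ δ ≤ n →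
        MM (K n) n ⌈(n : ℝ) / x⌉₊ ⌈(x : ℝ) ^ δ⌉₊ ≤ (⌊C * explicitBound n x ρ δ⌋₊ : ℕ∞)) := by
  have hσ0 : 0 < σ := by linarith
  have hρ0 : 0 ≤ ρ := by
    rw [hρ, sub_nonneg, div_le_one hσ0]
    exact hσ2
  have hρ1 : ρ ≤ 1 := by
    rw [hρ]
    have : 0 ≤ 2 / σ := by positivity
    linarith
  obtain ⟨C, hC⟩ := exists_productSolvable K κ hκ σ hσ2 hσ
  rw [← hρ] at hC
  choose enc henc using fun n => exists_encoding (hκ n)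
  -- The protocol sees only the adjacency relation, and its guarantee needs the count only through
  -- `CountsCycles`; hence one protocol serves digraphs and undirected graphs.
  choose A hA using fun n => exists_guarantee (γ := γ) hh hρ0 hρ1 (enc n) (henc n) (hC n)
  refine ⟨guaranteeConstant h κ γ C, A, fun n D => ?_, fun _ n G => ?_, ?_⟩
  · exact hA n _ _ (countsCycles_directed D (by omega))
  · exact hA n _ _ (countsCycles_undirected G (by omega))
  · intro n x δ hx hxn hδ _ hxδ
    obtain ⟨r, H, hr⟩ := hC n x δ hx hxn hδ hxδ
    refine (iInf₂_le r H).trans ?_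
    refine Nat.cast_le.2 (Nat.le_floor (hr.trans ?_))
    refine mul_le_mul_of_nonneg_right ?_ (zero_le_one.trans (explicitBound_ge_one _ _ _ _))
    exact_mod_cast (by unfold guaranteeConstant; omega : C ≤ guaranteeConstant h κ γ C)
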